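/- **Setting.** Let $F$ be a connected oriented punctured surface of finite type with an ideal triangulation $\Delta$ (finitely many faces, vertices at the punctures). A *broken hyperbolic structure* $H$ on $(F,\Delta)$ makes every face, completed and with its vertices deleted, isometric to a hyperbolic ideal triangle, such that: (i) the gluing map of each pair of identified edges is a homothety for the arc lengths of the two adjacent faces; $\sigma(f_1,f_2)>0$ denotes the factor by which lengths on the common edge are multiplied from $f_1$ to $f_2$; (ii) if $f_1,\dots,f_n,f_{n+1}=f_1$ are the consecutive faces around a puncture, then $\prod_{i=1}^n\sigma(f_i,f_{i+1})=1$; (iii) each puncture has a neighborhood in which the leaves of the horocyclic foliation (the arcs of horocycles centered at the vertices of the faces) are circles around the puncture. A *decoration* of $H$ is a choice, for each puncture, of a closed horocyclic leaf turning once around it. With a decoration, the $\lambda$-length of a triangle-edge pair $(t,e)$ is $\lambda(t,e)=\sqrt{2\exp\delta(t,e)}$, where $\delta(t,e)\ge 0$ is the distance in $t$ between the two distinguished horocycles that meet $e$. Let $\langle\cdot,\cdot\rangle$ be the Minkowski form on $\mathbb R^3$ with quadratic form $x^2+y^2-z^2$, $\mathbf H=\{\langle u,u\rangle=-1,\ z>0\}$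 the hyperbolic plane and $L^+=\{\langle u,u\rangle=0,\ z>0\}$ the light cone. Let $\widetilde F\to F$ be the universal cover with the lifted triangulation $\widetilde\Delta$. The *developing construction* lifts the vertices of the faces of $\widetilde\Delta$ to $L^+$. The vertices of an initial face $T_0$ are lifted to linearly independent points of $L^+$ whose pairwise products are $-\lambda(T_0,\cdot)^2$. Suppose that $T_0,T_1,\dots,T_n$ are consecutive adjacent faces without backtracking and that $T_{n-1}$ has been lifted. The two ideal points $u,v$ of the common edge of $T_{n-1}$ and $T_n$ keep their lifts, and the third vertex of $T_n$ is lifted to the point $z\in L^+$ on the side of the plane spanned by $u,v$ opposite to the third vertex of $T_{n-1}$ such that $\sqrt{-\langle z,u\rangle}$ and $\sqrt{-\langle z,v\rangle}$ are the $\lambda$-lengths of the corresponding edges of $T_n$ multiplied by $\sigma(T_0,T_1)\sigma(T_1,T_2)\cdots\sigma(T_{n-1},T_n)$. The *developing image* is the union in $\mathbf H$ of the ideal triangles spanned by the lifted vertices of all faces of $\widetilde\Delta$. **Theorem B.11.** Every broken hyperbolic structure $H$ on $(F,\Delta)$ admits a decoration, and for every decoration every face can serve as an initial face. For every decoration, initial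 face $T_0$ and lift of its vertices: 1. the construction lifts the vertices of every face of $\widetilde\Delta$ in exactly one way; 2. the developing image is the entire hyperbolic plane $\mathbf H$; 3. there is a developing homeomorphism $D:\widetilde F\to\mathbf H$ which maps each face of $\widetilde\Delta$ onto its ideal triangle and the edges of the face onto the corresponding edges, such that every covering transformation of $\widetilde F\to F$ is a quasi-isometry of $\widetilde F$ for the metric that makes $D$ an isometry onto $\mathbf H$. The same holds if the factor $\sigma(T_0,T_1)\cdots\sigma(T_{n-1},T_n)$ is replaced by its inverse throughout the construction. -/

import Mathlib

open Filter Topology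

namespace BrokenHyperbolic

noncomputable section

/-! ## The Minkowski model -/

/-- The Minkowski bilinear form on `ℝ³`, with quadratic form `x² + y² - z²`. -/
def form (u v : Fin 3 → ℝ) : ℝ := u 0 * v 0 + u 1 * v 1 - u 2 * v 2

/-- The hyperbolic plane: the upper sheet of the hyperboloid `⟨u, u⟩ = -1`. -/
def HypPlane : Set (Fin 3 → ℝ) := {u | form u u = -1 ∧ 0 < u 2}

/-- The open positive light cone. Its points stand for the horocycles of the hyperbolic plane, and
its rays for the ideal points. -/
def LightCone : Set (Fin 3 → ℝ) := {u | form u u = 0 ∧ 0 < u 2}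

/-- The hyperbolic distance. -/
def hdist (x y : HypPlane) : ℝ := Real.arcosh (-form x.1 y.1)

/-- The λ-length of the horocycles given by two points of the light cone. -/
def minkLambda (u v : Fin 3 → ℝ) : ℝ := Real.sqrt (-form u v)

/-- `w` and `z` lie strictly on opposite sides of the plane through the origin spanned by
`u` and `v`. -/
def OppositeSides (u v w z : Fin 3 → ℝ) : Prop :=
  Matrix.det ![u, v, w] * Matrix.det ![u, v, z] < 0

/-- The ideal triangle whose ideal vertices are the rays through `u 0`, `u 1`, `u 2`: their convex
hull in the hyperbolic plane. -/
def idealTriangle (u : Fin 3 → Fin 3 → ℝ) : Set HypPlane :=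
  {w | ∃ a : Fin 3 → ℝ, (∀ k, 0 ≤ a k) ∧ w.1 = ∑ k, a k • u k}

/-- The edge of the ideal triangle opposite to the vertex `u i`. -/
def idealEdge (u : Fin 3 → Fin 3 → ℝ) (i : Fin 3) : Set HypPlane :=
  {w | ∃ a : Fin 3 → ℝ, (∀ k, 0 ≤ a k) ∧ a i = 0 ∧ w.1 = ∑ k, a k • u k}

/-! ## The standard ideal triangle -/

/-- Three points of the light cone over the vertices of an equilateral triangle, in
counterclockwise order, with pairwise products `-1`. -/
def stdVertex : Fin 3 → Fin 3 → ℝ :=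
  ![![√(2 / 3), 0, √(2 / 3)],
    ![-√(2 / 3) / 2, √2 / 2, √(2 / 3)],
    ![-√(2 / 3) / 2, -√2 / 2, √(2 / 3)]]

/-- The standard ideal triangle (closed in the hyperbolic plane, without its ideal vertices). All
ideal triangles are isometric to it. -/
abbrev StdTriangle : Type := idealTriangle stdVertex

/-- The point of the edge `i` of the standard triangle at signed arc length `x` from the
distinguished point of the edge (the foot of the perpendicular from the center of the triangle).
The edge `i` is opposite to the vertex `i`, and `x` increases from the vertex `i + 1` towards the
vertex `i + 2`, that is, counterclockwise along the boundary. -/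
def edgeVec (i : Fin 3) (x : ℝ) : Fin 3 → ℝ :=
  (Real.exp (-x) / √2) • stdVertex (i + 1) + (Real.exp x / √2) • stdVertex (i + 2)

theorem form_stdVertex_self (i : Fin 3) : form (stdVertex i) (stdVertex i) = 0 := by
  have h1 : √(2 / 3 : ℝ) * √(2 / 3 : ℝ) = 2 / 3 := Real.mul_self_sqrt (by norm_num)
  have h2 : √(2 : ℝ) * √(2 : ℝ) = 2 := Real.mul_self_sqrt (by norm_num)
  unfold form stdVertex
  generalize √(2 / 3 : ℝ) = a at *
  generalize √(2 : ℝ) = b at *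
  fin_cases i <;> simp <;> linarith

theorem form_stdVertex_ne (i : Fin 3) : form (stdVertex (i + 1)) (stdVertex (i + 2)) = -1 := by
  have h1 : √(2 / 3 : ℝ) * √(2 / 3 : ℝ) = 2 / 3 := Real.mul_self_sqrt (by norm_num)
  have h2 : √(2 : ℝ) * √(2 : ℝ) = 2 := Real.mul_self_sqrt (by norm_num)
  unfold form stdVertex
  generalize √(2 / 3 : ℝ) = a at *
  generalize √(2 : ℝ) = b at *
  fin_cases i <;> simp <;> linarith

theorem edgeVec_mem (i : Fin 3) (x : ℝ) : edgeVec i x ∈ HypPlane := by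
  have h2 : √(2 : ℝ) ^ 2 = 2 := Real.sq_sqrt (by norm_num)
  have h2' : 0 < √(2 : ℝ) := by positivity
  have hz : ∀ k, 0 < stdVertex k 2 := by
    intro k
    fin_cases k <;> simp [stdVertex]
  constructor
  · have hs1 := form_stdVertex_self (i + 1)
    have hs2 := form_stdVertex_self (i + 2)
    have hn := form_stdVertex_ne i
    have he : Real.exp (-x) * Real.exp x = 1 := by rw [← Real.exp_add]; simp
    have key : form (edgeVec i x) (edgeVec i x) =
        (Real.exp (-x) / √2) ^ 2 * form (stdVertex (i + 1)) (stdVertex (i + 1)) +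
        (Real.exp x / √2) ^ 2 * form (stdVertex (i + 2)) (stdVertex (i + 2)) +
        2 * (Real.exp (-x) * Real.exp x / √2 ^ 2) *
          form (stdVertex (i + 1)) (stdVertex (i + 2)) := by
      simp only [form, edgeVec, Pi.add_apply, Pi.smul_apply, smul_eq_mul]
      ring
    rw [key, hs1, hs2, hn, he, h2]
    norm_num
  · have h1 := hz (i + 1)
    have h3 := hz (i + 2)
    simp only [edgeVec, Pi.add_apply, Pi.smul_apply, smul_eq_mul]
    positivity

theorem edgeVec_mem_edge (i : Fin 3) (x : ℝ) :
    (⟨edgeVec i x, edgeVec_mem i x⟩ : HypPlane) ∈ idealEdge stdVertex i := by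
  refine ⟨fun k => if k = i + 1 then Real.exp (-x) / √2 else
    if k = i + 2 then Real.exp x / √2 else 0, ?_, ?_, ?_⟩
  · intro k
    dsimp only
    split_ifs <;> positivity
  · fin_cases i <;> simp
  · fin_cases i <;> simp [edgeVec, Fin.sum_univ_three, add_comm]

/-- `edgeVec i x` as a point of the standard ideal triangle. -/
def edgePoint (i : Fin 3) (x : ℝ) : StdTriangle :=
  ⟨⟨edgeVec i x, edgeVec_mem i x⟩,
    let ⟨a, ha, _, h⟩ := edgeVec_mem_edge i x
    ⟨a, ha, h⟩⟩

/-! ## Ideal triangulations of punctured surfaces -/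

/-- The combinatorics of an ideal triangulation, with set of faces `T`, of a connected oriented
punctured surface. The vertices of each face are numbered by `Fin 3` counterclockwise and the edge
`i` of a face is opposite to its vertex `i`, so that `T × Fin 3` is the set of triangle-edge pairs,
and also the set of sectors (triangle-vertex pairs). Edges are glued in pairs. -/
structure IdealTriangulation (T : Type*) where
  /-- the triangle-edge pair on the other side of the edge -/
  opp : T × Fin 3 → T × Fin 3
  opp_opp : ∀ q, opp (opp q) = q
  opp_ne : ∀ q, opp q ≠ q
  connected : ∀ t t', Relation.ReflTransGen (fun a b => ∃ i, (opp (a, i)).1 = b) t t'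

/-- The triangle-edge pair through which one leaves the sector `s` when turning counterclockwise
about its vertex. -/
def exitEdge {T : Type*} (s : T × Fin 3) : T × Fin 3 := (s.1, s.2 + 1)

/-- The next sector, counterclockwise, about the same puncture. The cycles of this permutation of
the sectors are the punctures of the surface. -/
def IdealTriangulation.next {T : Type*} (Δ : IdealTriangulation T) (s : T × Fin 3) : T × Fin 3 :=
  ((Δ.opp (exitEdge s)).1, (Δ.opp (exitEdge s)).2 + 1)

/-- The surface `F` as the quotient of a disjoint union of ideal triangles, glued along their edges
in pairs by homotheties which reverse the boundary orientation. Here `chart t` is the map of the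
completed face `t` (with the metric of an ideal triangle) to `F`, and the edge `q = (t, i)` is glued
to the opposite edge by `x ↦ shift q - scale q * x` in the arc length coordinates, so that
`scale q` is the homothetic scaling factor `σ(t, t')` from `t` to the face `t'` across the edge: an
arc of length `ρ` in `t` has length `scale q * ρ` in `t'`. -/
structure HomotheticGluing {T : Type*} (Δ : IdealTriangulation T) (F : Type*)
    [TopologicalSpace F] where
  chart : T → StdTriangle → F
  scale : T × Fin 3 → ℝ
  shift : T × Fin 3 → ℝ
  scale_pos : ∀ q, 0 < scale q
  isQuotientMap : IsQuotientMap (fun q : (Σ _ : T, StdTriangle) => chart q.1 q.2)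
  chart_eq_iff : ∀ t w t' w', chart t w = chart t' w' ↔
    (t = t' ∧ w = w') ∨
    ∃ i x, w = edgePoint i x ∧ t' = (Δ.opp (t, i)).1 ∧
      w' = edgePoint (Δ.opp (t, i)).2 (shift (t, i) - scale (t, i) * x)

section Structures

variable {T : Type*} {Δ : IdealTriangulation T} {F : Type*} [TopologicalSpace F]

/-- Follow counterclockwise a leaf of the horocyclic foliation about a puncture. The leaf starts in
the sector `s`, on the horocyclic arc which meets the two edges of the sector at arc length `x` from
their distinguished points towards the vertex; the value at `k` is the corresponding number in the
sector `k` steps further. (The foliated part of a sector is given by the nonnegative numbers.) -/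
def HomotheticGluing.leafDepth (G : HomotheticGluing Δ F) (s : T × Fin 3) (x : ℝ) : ℕ → ℝ
  | 0 => x
  | k + 1 => G.scale (exitEdge (Δ.next^[k] s)) * G.leafDepth s x k -
      G.shift (exitEdge (Δ.next^[k] s))

/-- A broken hyperbolic structure on the triangulated surface: ideal triangles glued by homotheties
such that the product of the scaling factors around each puncture is one, and such that the leaves
of the horocyclic foliation which are close to a puncture close up after one turn about it. -/
structure BrokenHyperbolicStructure (Δ : IdealTriangulation T) (F : Type*) [TopologicalSpace F]
    extends HomotheticGluing Δ F where
  no_horocyclic_holonomy : ∀ s n, Δ.next^[n] s = s →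
    ∏ k ∈ Finset.range n, scale (exitEdge (Δ.next^[k] s)) = 1
  complete : ∀ s n, Δ.next^[n] s = s →
    ∀ᶠ x in atTop, toHomotheticGluing.leafDepth s x n = x

/-- A decoration: for each puncture, a closed leaf of the horocyclic foliation which turns once
about the puncture, given by the position `depth s` of its arc in each sector `s`. -/
structure Decoration (H : BrokenHyperbolicStructure Δ F) where
  depth : T × Fin 3 → ℝ
  depth_nonneg : ∀ s, 0 ≤ depth s
  closed : ∀ s, depth (Δ.next s) =
    H.scale (exitEdge s) * depth s - H.shift (exitEdge s)

variable {H : BrokenHyperbolicStructure Δ F}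

/-- The distance, in the face `q.1`, between the two horocycles of the decoration which meet the
edge `q.2`. -/
def Decoration.horoDist (d : Decoration H) (q : T × Fin 3) : ℝ :=
  d.depth (q.1, q.2 + 1) + d.depth (q.1, q.2 + 2)

/-- The λ-length `√(2 exp δ)` of a triangle-edge pair. -/
def Decoration.lam (d : Decoration H) (q : T × Fin 3) : ℝ :=
  √(2 * Real.exp (d.horoDist q))

/-! ## Developing -/

variable {E : Type*} [TopologicalSpace E]

/-- A face of the lifted triangulation of a covering space `p : E → F`: a face `face` of the
triangulation with a lift of its map to `F`. -/
structure LiftedFace (H : BrokenHyperbolicStructure Δ F) (p : E → F) where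
  face : T
  lift : StdTriangle → E
  continuous_lift : Continuous lift
  proj_lift : ∀ w, p (lift w) = H.chart face w

variable {p : E → F}

/-- The lifted face `L'` is adjacent to `L` across the edge `i` of `L`. -/
def AdjacentAcross (L : LiftedFace H p) (i : Fin 3) (L' : LiftedFace H p) : Prop :=
  (Δ.opp (L.face, i)).1 = L'.face ∧
  ∀ x, L.lift (edgePoint i x) =
    L'.lift (edgePoint (Δ.opp (L.face, i)).2
      (H.shift (L.face, i) - H.scale (L.face, i) * x))

/-- The basis step: three linearly independent points of the light cone which realize the λ-lengths
of the initial face. -/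
def IsBaseLift (d : Decoration H) (L₀ : LiftedFace H p) (u₀ : Fin 3 → Fin 3 → ℝ) : Prop :=
  (∀ i, u₀ i ∈ LightCone) ∧ LinearIndependent ℝ u₀ ∧
  ∀ i, minkLambda (u₀ (i + 1)) (u₀ (i + 2)) = d.lam (L₀.face, i)

/-- The inductive construction of the decorated triangles in the Minkowski model.
`Developed d e L₀ u₀ L o c u` says that the construction, started with the lift `u₀` of the vertices
of the face `L₀`, lifts the vertices of the face `L` to the points `u 0`, `u 1`, `u 2` of the light
cone, where `o` is the edge of `L` through which `L` has been reached (`none` for `L₀`), and `c` is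
the product of the factors `σ ^ e` of the edges which have been crossed, `σ` being the homothetic
scaling factor across the edge in the direction of the crossing.

In the step from `L` to the adjacent face `L'` across an edge, not turning back, the lifts of the
two ideal points of this edge are kept, and the third vertex of `L'` is lifted to the point of the
light cone on the other side from `L` which realizes the λ-lengths of the two other edges of `L'`,
multiplied by the accumulated factor. -/
inductive Developed (d : Decoration H) (e : ℤ) (L₀ : LiftedFace H p) (u₀ : Fin 3 → Fin 3 → ℝ) :
    LiftedFace H p → Option (Fin 3) → ℝ → (Fin 3 → Fin 3 → ℝ) → Prop
  | base : Developed d e L₀ u₀ L₀ none 1 u₀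
  | step (L : LiftedFace H p) (o : Option (Fin 3)) (c : ℝ) (u : Fin 3 → Fin 3 → ℝ)
      (i : Fin 3) (L' : LiftedFace H p) (j : Fin 3) (c' : ℝ) (u' : Fin 3 → Fin 3 → ℝ) :
      Developed d e L₀ u₀ L o c u →
      o ≠ some i →
      AdjacentAcross L i L' →
      j = (Δ.opp (L.face, i)).2 →
      c' = c * H.scale (L.face, i) ^ e →
      u' (j + 1) = u (i + 2) →
      u' (j + 2) = u (i + 1) →
      u' j ∈ LightCone →
      OppositeSides (u (i + 1)) (u (i + 2)) (u i) (u' j) →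
      minkLambda (u' j) (u' (j + 1)) = c' * d.lam (L'.face, j + 2) →
      minkLambda (u' j) (u' (j + 2)) = c' * d.lam (L'.face, j + 1) →
      Developed d e L₀ u₀ L' (some j) c' u'

/-- The developing image: the union of all ideal triangles of the construction. -/
def developingImage (d : Decoration H) (e : ℤ) (L₀ : LiftedFace H p)
    (u₀ : Fin 3 → Fin 3 → ℝ) : Set HypPlane :=
  {x | ∃ L o c u, Developed d e L₀ u₀ L o c u ∧ x ∈ idealTriangle u}

end Structures

/-- `f` is a quasi-isometry for the distance function `dist`. -/
def IsQuasiIsometry {X : Type*} (dist : X → X → ℝ) (f : X → X) : Prop :=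
  ∃ K C : ℝ, 1 ≤ K ∧ 0 ≤ C ∧
    (∀ x y, dist x y / K - C ≤ dist (f x) (f y) ∧ dist (f x) (f y) ≤ K * dist x y + C) ∧
    ∀ y, ∃ x, dist (f x) y ≤ C

end

end BrokenHyperbolic

namespace BrokenHyperbolic

noncomputable section

/-! ## Minkowski geometry -/

/-! The factors accumulated along a path in the universal cover need not be bounded, but they can be
gauged away. Since the scaling factors around a puncture multiply to one, there is a positive
function `ρ` on the sectors with `ρ (Δ.next s) = σ ^ e * ρ s` (`exists_sectorScale`). Multiplying a
lifted vertex by `ρ` of its sector and dividing it by the accumulated factor changes no ideal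
triangle and keeps the vertices shared by adjacent triangles equal as vectors. In the rescaled
development (`devData`, `devVert`) the prescribed products depend only on the triangle-edge pair of
the finite triangulation, so all products along edges lie in an interval `[ε, K]` with `ε > 0`
(`exists_weight_bounds`).

Tiling. Along a path without backtracking the half-planes beyond the crossed edges are nested, so
two triangles meet at most in a common edge (`overlap`). Suppose that a point `x` lies in no
triangle and walk towards it. The hyperbolic sine of the distance from `x` to the crossed edge drops
in each step by at least a constant times `-⟨x, v⟩`, where `v` is the vertex about which the walk
turns, so `-⟨x, v⟩` tends to zero. Two vertices joined by an edge cannot both have a small product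
with `x`, so the walk finally turns about one fixed vertex, whose product with `x` is a nonzero
constant: a contradiction (`exists_coord_nonneg`).

Homeomorphism. Each developed triangle is parametrized by the standard triangle, by a map which is
affine of slope `√σ` in logarithmic coordinates on each edge (`triMap`). These maps fit together
across the edges and exhibit the hyperbolic plane as a gluing of the same kind, over a triangulation
which covers `Δ` (`hypGluing`). A morphism of gluings of this kind is a covering map
(`exists_isCoveringMap`). Since the hyperbolic plane is simply connected, uniqueness of simply
connected coverings gives `D`, under which lifted faces and developed triangles correspond.

Quasi-isometry. A covering transformation permutes the developed triangles and is the identity in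
their homogeneous coordinates (`exists_map_triangles`). A triangle and its image may have different
products, and then this map distorts the horocycles near the ideal vertices. It has bounded distance
from the quadratic map `shear`, which is nearly a homothety at each vertex and fits together across
the edges. An estimate in coordinates (`spread_estimate`) shows that `shear` is locally Lipschitz
with a uniform constant, hence Lipschitz along geodesics. Applying this to the inverse
transformation as well finishes the proof. -/

theorem fin3_add_one_one (k : Fin 3) : k + 1 + 1 = k + 2 := by fin_cases k <;> rfl
theorem fin3_add_one_two (k : Fin 3) : k + 1 + 2 = k := by fin_cases k <;> rfl
theorem fin3_add_two_one (k : Fin 3) : k + 2 + 1 = k := by fin_cases k <;> rfl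
theorem fin3_add_two_two (k : Fin 3) : k + 2 + 2 = k + 1 := by fin_cases k <;> rfl

theorem fin3_add_one_ne (k : Fin 3) : k + 1 ≠ k := by fin_cases k <;> decide
theorem fin3_add_two_ne (k : Fin 3) : k + 2 ≠ k := by fin_cases k <;> decide
theorem fin3_add_one_ne_add_two (k : Fin 3) : k + 1 ≠ k + 2 := by fin_cases k <;> decide

theorem fin3_cases (i k : Fin 3) : k = i ∨ k = i + 1 ∨ k = i + 2 := by
  fin_cases i <;> fin_cases k <;> decide

theorem sum_fin3 {M : Type*} [AddCommMonoid M] (f : Fin 3 → M) (i : Fin 3) :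
    ∑ k, f k = f i + f (i + 1) + f (i + 2) := by
  have h2 : (1 : Fin 3) + 1 = 2 := rfl
  have h3 : (1 : Fin 3) + 2 = 0 := rfl
  have h4 : (2 : Fin 3) + 1 = 0 := rfl
  have h5 : (2 : Fin 3) + 2 = 1 := rfl
  fin_cases i
  · simp [Fin.sum_univ_three]
  · simp only [Fin.sum_univ_three, Fin.mk_one, h2, h3]; abel
  · simp only [Fin.sum_univ_three, Fin.reduceFinMk, h4, h5]; abel

/-! ### Bilinearity, Gram determinants and causal vectors. -/

theorem form_comm (u v : Fin 3 → ℝ) : form u v = form v u := by simp only [form]; ring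

theorem form_add_left (u v w : Fin 3 → ℝ) : form (u + v) w = form u w + form v w := by
  simp only [form, Pi.add_apply]; ring

theorem form_smul_left (c : ℝ) (u v : Fin 3 → ℝ) : form (c • u) v = c * form u v := by
  simp only [form, Pi.smul_apply, smul_eq_mul]; ring

theorem form_add_right (u v w : Fin 3 → ℝ) : form u (v + w) = form u v + form u w := by
  rw [form_comm, form_add_left, form_comm v, form_comm w]

theorem form_smul_right (c : ℝ) (u v : Fin 3 → ℝ) : form u (c • v) = c * form u v := by
  rw [form_comm, form_smul_left, form_comm]

theorem continuous_form_left (u : Fin 3 → ℝ) : Continuous fun x => form x u := by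
  unfold form; fun_prop

theorem det_vec (a b c : Fin 3 → ℝ) : Matrix.det ![a, b, c] =
    a 0 * b 1 * c 2 - a 0 * b 2 * c 1 - a 1 * b 0 * c 2 + a 1 * b 2 * c 0 + a 2 * b 0 * c 1 -
      a 2 * b 1 * c 0 :=
  Matrix.det_fin_three _

/-- The Gram determinant of three vectors of Minkowski space. -/
theorem det_sq (a b c : Fin 3 → ℝ) : Matrix.det ![a, b, c] ^ 2 =
    -(form a a * (form b b * form c c - form b c ^ 2) -
      form a b * (form a b * form c c - form b c * form a c) +
      form a c * (form a b * form b c - form b b * form a c)) := by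
  simp only [det_vec, form]
  ring

theorem det_rotate (a b c : Fin 3 → ℝ) : Matrix.det ![b, c, a] = Matrix.det ![a, b, c] := by
  simp only [det_vec]
  ring

theorem det_swap (a b c : Fin 3 → ℝ) : Matrix.det ![b, a, c] = -Matrix.det ![a, b, c] := by
  simp only [det_vec]
  ring

/-- If `z 2 ≤ 0`, the Cauchy–Schwarz inequality for the horizontal parts would give `form z u ≥ 0`.
-/
theorem pos_of_form_neg {z u : Fin 3 → ℝ} (hz : form z z ≤ 0) (hu : form u u ≤ 0) (hu2 : 0 < u 2)
    (h : form z u < 0) : 0 < z 2 := by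
  by_contra! hz2
  simp only [form] at *
  have h1 : (z 0 * u 0 + z 1 * u 1) ^ 2 ≤ (z 2 * u 2) ^ 2 := by
    have : (z 0 * u 0 + z 1 * u 1) ^ 2 ≤ (z 0 * z 0 + z 1 * z 1) * (u 0 * u 0 + u 1 * u 1) := by
      nlinarith [sq_nonneg (z 0 * u 1 - z 1 * u 0)]
    have h2 : (z 0 * z 0 + z 1 * z 1) * (u 0 * u 0 + u 1 * u 1) ≤ (z 2 * z 2) * (u 2 * u 2) :=
      mul_le_mul (by linarith) (by linarith)
        (add_nonneg (mul_self_nonneg _) (mul_self_nonneg _)) (mul_self_nonneg _)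
    nlinarith
  have h3 := abs_le_of_sq_le_sq' (a := z 0 * u 0 + z 1 * u 1) (b := -(z 2 * u 2)) (by linarith)
    (by nlinarith)
  linarith [h3.1]

theorem form_nonpos_of_causal {u v : Fin 3 → ℝ} (hu : form u u ≤ 0) (hu2 : 0 < u 2)
    (hv : form v v ≤ 0) (hv2 : 0 < v 2) : form u v ≤ 0 := by
  by_contra! h
  have := pos_of_form_neg (z := (-1 : ℝ) • u) (u := v)
    (by rw [form_smul_left, form_smul_right]; linarith) hv hv2
    (by rw [form_smul_left]; linarith)
  simp at this
  linarith

theorem form_hyp_cone_neg {x u : Fin 3 → ℝ} (hx : x ∈ HypPlane) (hu : u ∈ LightCone) :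
    form x u < 0 := by
  obtain ⟨hx1, hx2⟩ := hx
  obtain ⟨hu1, hu2⟩ := hu
  refine lt_of_le_of_ne (form_nonpos_of_causal (by linarith) hx2 (by linarith) hu2) fun h => ?_
  simp only [form] at *
  have hxu : x 0 * u 0 + x 1 * u 1 = x 2 * u 2 := by linarith
  have h1 : (x 2 * u 2) ^ 2 ≤ (x 0 * x 0 + x 1 * x 1) * (u 2 * u 2) := by
    rw [← hxu, show u 2 * u 2 = u 0 * u 0 + u 1 * u 1 by linarith]
    nlinarith [sq_nonneg (x 0 * u 1 - x 1 * u 0)]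
  nlinarith [mul_pos hu2 hu2]

/-- Reversed Cauchy–Schwarz inequality: the ordinary one is applied to `(x 0, x 1, 1)` and `(y 0, y
1, 1)`, whose Euclidean norms are `x 2` and `y 2`. -/
theorem form_hyp_le {x y : Fin 3 → ℝ} (hx : x ∈ HypPlane) (hy : y ∈ HypPlane) :
    form x y ≤ -1 := by
  obtain ⟨hx1, hx2⟩ := hx
  obtain ⟨hy1, hy2⟩ := hy
  simp only [form] at *
  have h := abs_le_of_sq_le_sq' (a := x 0 * y 0 + x 1 * y 1 + 1) (b := x 2 * y 2) (by
    have : (x 2 * y 2) ^ 2 = (x 0 * x 0 + x 1 * x 1 + 1) * (y 0 * y 0 + y 1 * y 1 + 1) := by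
      rw [show x 0 * x 0 + x 1 * x 1 + 1 = x 2 * x 2 by linarith,
        show y 0 * y 0 + y 1 * y 1 + 1 = y 2 * y 2 by linarith]; ring
    rw [this]
    nlinarith [sq_nonneg (x 0 * y 1 - x 1 * y 0), sq_nonneg (x 0 - y 0), sq_nonneg (x 1 - y 1)])
    (by positivity)
  linarith [h.2]

/-- The lower bound on the product of the distances to two horocycles. -/
theorem neg_form_le_mul {x u v : Fin 3 → ℝ} (hx : x ∈ HypPlane) (hu : u ∈ LightCone)
    (hv : v ∈ LightCone) (huv : form u v < 0) : -form u v ≤ 2 * (form x u * form x v) := by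
  -- The Gram determinant of two null vectors and a unit timelike vector factors as `-⟨u, v⟩ * (⟨u,
  -- v⟩ + 2 ⟨x, u⟩ ⟨x, v⟩)`, and it is a square.
  have h := det_sq u v x
  rw [hu.1, hv.1, hx.1, form_comm v x, form_comm u x] at h
  have h2 := sq_nonneg (Matrix.det ![u, v, x])
  rw [h] at h2
  nlinarith

/-! ### Triples of points of the light cone -/

/-- Three linearly independent points of the light cone, the vertices of a decorated ideal
triangle. -/
structure IsConeTriple (u : Fin 3 → Fin 3 → ℝ) : Prop where
  mem : ∀ i, u i ∈ LightCone
  det_ne : ∀ i, Matrix.det ![u (i + 1), u (i + 2), u i] ≠ 0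

/-- The determinant of a triple, up to an even permutation. -/
def orient (u : Fin 3 → Fin 3 → ℝ) : ℝ := Matrix.det ![u 1, u 2, u 0]

theorem det_eq_orient (u : Fin 3 → Fin 3 → ℝ) (i : Fin 3) :
    Matrix.det ![u (i + 1), u (i + 2), u i] = orient u := by
  have h2 : (1 : Fin 3) + 1 = 2 := rfl
  have h3 : (1 : Fin 3) + 2 = 0 := rfl
  have h4 : (2 : Fin 3) + 1 = 0 := rfl
  have h5 : (2 : Fin 3) + 2 = 1 := rfl
  unfold orient
  fin_cases i
  · rfl
  · simp only [Fin.mk_one, h2, h3]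
    rw [det_rotate]
  · simp only [Fin.reduceFinMk, h4, h5]
    rw [← det_rotate]

theorem IsConeTriple.of_orient {u : Fin 3 → Fin 3 → ℝ} (hu : ∀ i, u i ∈ LightCone)
    (h : orient u ≠ 0) : IsConeTriple u :=
  ⟨hu, fun i => by rwa [det_eq_orient]⟩

theorem IsConeTriple.orient_ne {u : Fin 3 → Fin 3 → ℝ} (h : IsConeTriple u) : orient u ≠ 0 := by
  rw [← det_eq_orient u 0]; exact h.det_ne 0

theorem det_of_eq_orient (u : Fin 3 → Fin 3 → ℝ) : Matrix.det (Matrix.of u) = orient u := by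
  simp only [orient, det_vec, Matrix.det_fin_three, Matrix.of_apply]
  ring

theorem linearIndependent_iff_orient (u : Fin 3 → Fin 3 → ℝ) :
    LinearIndependent ℝ u ↔ orient u ≠ 0 := by
  have := Matrix.linearIndependent_rows_iff_isUnit (A := Matrix.of u)
  rw [Matrix.isUnit_iff_isUnit_det, isUnit_iff_ne_zero, det_of_eq_orient] at this
  exact this

/-- The product of the two vertices on the edge `k` of a triple, with positive sign: the square of
the λ-length. -/
def gram (u : Fin 3 → Fin 3 → ℝ) (k : Fin 3) : ℝ := -form (u (k + 1)) (u (k + 2))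

theorem gram_add_one (u : Fin 3 → Fin 3 → ℝ) (k : Fin 3) :
    gram u (k + 1) = -form (u (k + 2)) (u k) := by
  rw [gram, fin3_add_one_one, fin3_add_one_two]

theorem gram_add_two (u : Fin 3 → Fin 3 → ℝ) (k : Fin 3) :
    gram u (k + 2) = -form (u k) (u (k + 1)) := by
  rw [gram, fin3_add_two_one, fin3_add_two_two]

namespace IsConeTriple

variable {u : Fin 3 → Fin 3 → ℝ} (hu : IsConeTriple u)
include hu

theorem orient_sq : orient u ^ 2 = 2 * (gram u 0 * gram u 1 * gram u 2) := by
  have h := det_sq (u 1) (u 2) (u 0)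
  rw [(hu.mem 0).1, (hu.mem 1).1, (hu.mem 2).1] at h
  have h1 : gram u 1 = -form (u 2) (u 0) := rfl
  have h2 : gram u 2 = -form (u 0) (u 1) := rfl
  have h0 : gram u 0 = -form (u 1) (u 2) := rfl
  rw [orient, h, h0, h1, h2, form_comm (u 1) (u 0)]
  ring

/-- Each product has the weak sign by causality, and none vanishes because by `orient_sq` the
product of all three is half the square of a nonzero determinant. -/
theorem gram_pos (k : Fin 3) : 0 < gram u k := by
  have hle : ∀ k, 0 ≤ gram u k := fun k => by
    have := form_nonpos_of_causal (hu.mem (k + 1)).1.le (hu.mem (k + 1)).2 (hu.mem (k + 2)).1.le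
      (hu.mem (k + 2)).2
    rw [gram]; linarith
  have h := hu.orient_sq
  have h2 : 0 < orient u ^ 2 := by have := hu.orient_ne; positivity
  refine lt_of_le_of_ne (hle k) fun h0 => ?_
  fin_cases k <;> simp at h0 <;> rw [← h0] at h <;> simp at h <;> exact hu.orient_ne h

theorem form_sum_left (a : Fin 3 → ℝ) (i : Fin 3) :
    -form (∑ k, a k • u k) (u i) = gram u (i + 2) * a (i + 1) + gram u (i + 1) * a (i + 2) := by
  rw [sum_fin3 _ i, form_add_left, form_add_left, form_smul_left, form_smul_left, form_smul_left,
    (hu.mem i).1, gram_add_one, gram_add_two, form_comm (u (i + 1)) (u i)]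
  ring

theorem form_sum_sum (a b : Fin 3 → ℝ) :
    -form (∑ k, a k • u k) (∑ k, b k • u k) =
      ∑ k, b k * (gram u (k + 2) * a (k + 1) + gram u (k + 1) * a (k + 2)) := by
  simp only [← hu.form_sum_left]
  rw [sum_fin3 (fun k => b k • u k) 0, form_add_right, form_add_right, form_smul_right,
    form_smul_right, form_smul_right, sum_fin3 (fun _ => _ * _) 0]
  ring

end IsConeTriple

/-- The coordinates of `x` with respect to a triple of points of the light cone. -/
def coord (u : Fin 3 → Fin 3 → ℝ) (x : Fin 3 → ℝ) (k : Fin 3) : ℝ :=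
  (gram u k * form x (u k) - gram u (k + 1) * form x (u (k + 1)) -
    gram u (k + 2) * form x (u (k + 2))) / (2 * gram u (k + 1) * gram u (k + 2))

theorem continuous_coord (u : Fin 3 → Fin 3 → ℝ) (k : Fin 3) :
    Continuous fun x => coord u x k := by
  unfold coord
  have := fun i => continuous_form_left (u i)
  fun_prop

namespace IsConeTriple

variable {u : Fin 3 → Fin 3 → ℝ} (hu : IsConeTriple u)
include hu

/-- The products with the three vertices form a linear system for the coefficients. Weighting its
equations by `gram u` with suitable signs eliminates all coefficients but `a k`. -/
theorem coord_sum (a : Fin 3 → ℝ) (k : Fin 3) : coord u (∑ i, a i • u i) k = a k := by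
  have h := hu.form_sum_left a
  have h0 := h k
  have h1 := h (k + 1)
  have h2 := h (k + 2)
  rw [fin3_add_one_one, fin3_add_one_two] at h1
  rw [fin3_add_two_one, fin3_add_two_two] at h2
  rw [coord, div_eq_iff (by have := hu.gram_pos (k + 1); have := hu.gram_pos (k + 2); positivity)]
  linear_combination -gram u k * h0 + gram u (k + 1) * h1 + gram u (k + 2) * h2

theorem sum_coord (x : Fin 3 → ℝ) : ∑ k, coord u x k • u k = x := by
  have hli := (linearIndependent_iff_orient u).2 hu.orient_ne
  have hspan : Submodule.span ℝ (Set.range u) = ⊤ :=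
    hli.span_eq_top_of_card_eq_finrank (by simp)
  have hx : x ∈ Submodule.span ℝ (Set.range u) := by rw [hspan]; trivial
  obtain ⟨c, hc⟩ := (Submodule.mem_span_range_iff_exists_fun ℝ).1 hx
  subst hc
  simp only [hu.coord_sum]

theorem form_eq (x : Fin 3 → ℝ) (i : Fin 3) :
    -form x (u i) = gram u (i + 2) * coord u x (i + 1) + gram u (i + 1) * coord u x (i + 2) := by
  conv_lhs => rw [← hu.sum_coord x]
  exact hu.form_sum_left _ i

/-- Cramer's rule. It makes the sign of `coord u x i` a test for the side of the edge `i` on which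
`x` lies. -/
theorem det_edge (x : Fin 3 → ℝ) (i : Fin 3) :
    Matrix.det ![u (i + 1), u (i + 2), x] = coord u x i * orient u := by
  have hx := hu.sum_coord x
  rw [sum_fin3 _ i] at hx
  rw [← det_eq_orient u i]
  conv_lhs => rw [← hx]
  simp only [det_vec, Pi.add_apply, Pi.smul_apply, smul_eq_mul]
  ring

/-- A point of the hyperbolic plane is beyond at most one edge of a triangle. -/
theorem coord_pos_of_nonpos {x : Fin 3 → ℝ} (hx : x ∈ HypPlane) {i j : Fin 3} (hij : i ≠ j)
    (hi : coord u x i ≤ 0) : 0 < coord u x j := by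
  by_contra! hj
  -- If the coordinates at both neighbors of `k` were nonpositive, then so would be `-form x (u k)`.
  have key : ∀ k : Fin 3, coord u x (k + 1) ≤ 0 → coord u x (k + 2) ≤ 0 → False := by
    intro k h1 h2
    have h := hu.form_eq x k
    have hx := form_hyp_cone_neg hx (hu.mem k)
    nlinarith [hu.gram_pos (k + 1), hu.gram_pos (k + 2),
      mul_nonpos_of_nonneg_of_nonpos (hu.gram_pos (k + 2)).le h1,
      mul_nonpos_of_nonneg_of_nonpos (hu.gram_pos (k + 1)).le h2]
  rcases fin3_cases i j with h | h | h
  · exact hij h.symm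
  · refine key (i + 2) ?_ ?_
    · rwa [fin3_add_two_one]
    · rwa [fin3_add_two_two, ← h]
  · refine key (i + 1) ?_ ?_
    · rwa [fin3_add_one_one, ← h]
    · rwa [fin3_add_one_two]

end IsConeTriple

/-! ### The third vertex -/

/-- The point of the light cone with products `-α` with `v₁` and `-β` with `v₂` on the other side
of the plane spanned by `v₁` and `v₂` from `w`. -/
def thirdVertex (v₁ v₂ w : Fin 3 → ℝ) (α β : ℝ) : Fin 3 → ℝ :=
  -- For every `c` the other two coefficients solve the two product conditions. The vector is null
  -- exactly when `c ^ 2 * (form w v₁ * form w v₂) = α * β`, and the negative root puts it on the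
  -- side opposite to `w`.
  let c := -√(α * β / (form w v₁ * form w v₂))
  ((β + c * form w v₂) / -form v₁ v₂) • v₁ + ((α + c * form w v₁) / -form v₁ v₂) • v₂ + c • w

variable {v₁ v₂ w : Fin 3 → ℝ} {α β : ℝ}

theorem thirdVertex_spec (h₁ : v₁ ∈ LightCone) (h₂ : v₂ ∈ LightCone) (hw : w ∈ LightCone)
    (h12 : form v₁ v₂ < 0) (hw1 : form w v₁ < 0) (hw2 : form w v₂ < 0) (hα : 0 < α) (hβ : 0 < β) :
    thirdVertex v₁ v₂ w α β ∈ LightCone ∧ form (thirdVertex v₁ v₂ w α β) v₁ = -α ∧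
      form (thirdVertex v₁ v₂ w α β) v₂ = -β := by
  have hww : 0 < form w v₁ * form w v₂ := mul_pos_of_neg_of_neg hw1 hw2
  have hc : (-√(α * β / (form w v₁ * form w v₂))) ^ 2 * (form w v₁ * form w v₂) = α * β := by
    rw [neg_sq, Real.sq_sqrt (by positivity), div_mul_cancel₀ _ hww.ne']
  have h12' := h12.ne
  unfold thirdVertex
  generalize -√(α * β / (form w v₁ * form w v₂)) = c at hc ⊢
  dsimp only
  have e1 : form ((((β + c * form w v₂) / -form v₁ v₂) • v₁ +
      ((α + c * form w v₁) / -form v₁ v₂) • v₂ + c • w)) v₁ = -α := by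
    rw [form_add_left, form_add_left, form_smul_left, form_smul_left, form_smul_left, h₁.1,
      form_comm v₂ v₁]
    field_simp
    ring
  have e2 : form ((((β + c * form w v₂) / -form v₁ v₂) • v₁ +
      ((α + c * form w v₁) / -form v₁ v₂) • v₂ + c • w)) v₂ = -β := by
    rw [form_add_left, form_add_left, form_smul_left, form_smul_left, form_smul_left, h₂.1]
    field_simp
    ring
  have e0 : form ((((β + c * form w v₂) / -form v₁ v₂) • v₁ +
      ((α + c * form w v₁) / -form v₁ v₂) • v₂ + c • w)) ((((β + c * form w v₂) / -form v₁ v₂) • v₁ +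
      ((α + c * form w v₁) / -form v₁ v₂) • v₂ + c • w)) = 0 := by
    rw [form_add_right, form_add_right, form_smul_right, form_smul_right, form_smul_right, e1, e2,
      form_add_left, form_add_left, form_smul_left, form_smul_left, form_smul_left, hw.1,
      form_comm v₁ w, form_comm v₂ w]
    field_simp
    linear_combination -2 * hc
  refine ⟨⟨e0, pos_of_form_neg e0.le h₁.1.le h₁.2 ?_⟩, e1, e2⟩
  rw [e1]
  linarith

theorem det_thirdVertex : Matrix.det ![v₁, v₂, thirdVertex v₁ v₂ w α β] =
    -√(α * β / (form w v₁ * form w v₂)) * Matrix.det ![v₁, v₂, w] := by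
  simp only [thirdVertex, det_vec, Pi.add_apply, Pi.smul_apply,
    smul_eq_mul]
  ring

theorem oppositeSides_thirdVertex (hdet : Matrix.det ![v₁, v₂, w] ≠ 0)
    (hw1 : form w v₁ < 0) (hw2 : form w v₂ < 0) (hα : 0 < α) (hβ : 0 < β) :
    OppositeSides v₁ v₂ w (thirdVertex v₁ v₂ w α β) := by
  have hww : 0 < form w v₁ * form w v₂ := mul_pos_of_neg_of_neg hw1 hw2
  have hs : 0 < √(α * β / (form w v₁ * form w v₂)) := by positivity
  rw [OppositeSides, det_thirdVertex]
  have : 0 < Matrix.det ![v₁, v₂, w] ^ 2 := by positivity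
  nlinarith

/-- The lift of the third vertex of a triangle is determined by its products with the two other
vertices and by its side. -/
theorem eq_of_form_eq {z z' : Fin 3 → ℝ} (h₁ : v₁ ∈ LightCone) (h₂ : v₂ ∈ LightCone)
    (h12 : form v₁ v₂ < 0) (hz : form z z = 0) (hz' : form z' z' = 0)
    (hz1 : form z v₁ = form z' v₁) (hz2 : form z v₂ = form z' v₂)
    (hs : 0 < Matrix.det ![v₁, v₂, z] * Matrix.det ![v₁, v₂, z']) : z = z' := by
  have hd := det_sq v₁ v₂ z
  have hd' := det_sq v₁ v₂ z'
  rw [h₁.1, h₂.1, hz, form_comm v₁ z, form_comm v₂ z, hz1, hz2] at hd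
  rw [h₁.1, h₂.1, hz', form_comm v₁ z', form_comm v₂ z'] at hd'
  -- Equal Gram determinants leave only a sign, which the common side decides.
  have hdd : Matrix.det ![v₁, v₂, z] = Matrix.det ![v₁, v₂, z'] := by
    rcases sq_eq_sq_iff_eq_or_eq_neg.1 (hd.trans hd'.symm) with h | h
    · exact h
    · rw [h] at hs
      nlinarith [sq_nonneg (Matrix.det ![v₁, v₂, z'])]
  have hne : Matrix.det ![v₁, v₂, z'] ≠ 0 := by
    intro h0; rw [h0] at hs; simp at hs
  have hform : 0 < form z' v₁ * form z' v₂ := by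
    have h0 : 0 < Matrix.det ![v₁, v₂, z'] ^ 2 := by positivity
    rw [hd'] at h0
    nlinarith
  -- the difference `z - z'` is orthogonal to `v₁` and `v₂` and lies in their span
  have hd0 : Matrix.det ![v₁, v₂, z - z'] = 0 := by
    have : Matrix.det ![v₁, v₂, z - z'] = Matrix.det ![v₁, v₂, z] - Matrix.det ![v₁, v₂, z'] := by
      simp only [det_vec, Pi.sub_apply]; ring
    rw [this, hdd, sub_self]
  set y := z - z' with hy
  have hy1 : form y v₁ = 0 := by
    have : form y v₁ = form z v₁ - form z' v₁ := by simp only [hy, form, Pi.sub_apply]; ring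
    rw [this, hz1, sub_self]
  have hy2 : form y v₂ = 0 := by
    have : form y v₂ = form z v₂ - form z' v₂ := by simp only [hy, form, Pi.sub_apply]; ring
    rw [this, hz2, sub_self]
  have hyy : form y y = 0 := by
    have h := det_sq v₁ v₂ y
    rw [hd0, h₁.1, h₂.1, form_comm v₁ y, form_comm v₂ y, hy1, hy2] at h
    have : form v₁ v₂ ^ 2 * form y y = 0 := by linarith
    rcases mul_eq_zero.1 this with h | h
    · exact absurd (pow_eq_zero_iff (by norm_num) |>.1 h) h12.ne
    · exact h
  -- a null vector orthogonal to `v₁` and `v₂` vanishes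
  have key : ∀ v ∈ LightCone, form y v = 0 → ∃ c : ℝ, y = c • v := by
    intro v hv h0
    refine ⟨y 2 / v 2, ?_⟩
    have hv2 := hv.2.ne'
    have hvv := hv.1
    simp only [form] at hyy h0 hvv
    have e1 : (v 2 * y 0 - y 2 * v 0) ^ 2 + (v 2 * y 1 - y 2 * v 1) ^ 2 = 0 := by
      linear_combination (v 2 ^ 2) * hyy + y 2 ^ 2 * hvv - 2 * v 2 * y 2 * h0
    have e2 : v 2 * y 0 - y 2 * v 0 = 0 := by
      apply pow_eq_zero_iff (two_ne_zero) |>.1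
      nlinarith [sq_nonneg (v 2 * y 0 - y 2 * v 0), sq_nonneg (v 2 * y 1 - y 2 * v 1)]
    have e3 : v 2 * y 1 - y 2 * v 1 = 0 := by
      apply pow_eq_zero_iff (two_ne_zero) |>.1
      nlinarith [sq_nonneg (v 2 * y 0 - y 2 * v 0), sq_nonneg (v 2 * y 1 - y 2 * v 1)]
    ext k
    fin_cases k <;> simp <;> field_simp <;> linarith
  obtain ⟨c, hc⟩ := key v₁ h₁ hy1
  have hc0 : c = 0 := by
    rw [hc, form_smul_left] at hy2
    rcases mul_eq_zero.1 hy2 with h | h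
    · exact h
    · exact absurd h h12.ne
  rw [hc0, zero_smul] at hc
  exact sub_eq_zero.1 hc

end

noncomputable section

/-! ## The tree of triangles -/

/-- A decorated triangle of the development: its face, the edge through which it has been reached,
and its vertices. -/
structure Node (T : Type*) where
  face : T
  entry : Option (Fin 3)
  vert : Fin 3 → Fin 3 → ℝ

/-- The initial triangle of a development, and the squared λ-lengths of all triangle-edge pairs. -/
structure DevData {T : Type*} (Δ : IdealTriangulation T) where
  face : T
  vert : Fin 3 → Fin 3 → ℝ
  weight : T × Fin 3 → ℝ
  triple : IsConeTriple vert
  weight_pos : ∀ q, 0 < weight q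
  gram_vert : ∀ i, gram vert i = weight (face, i)

variable {T : Type*} {Δ : IdealTriangulation T}

/-- The triangle `b` is glued along its edge `j` to the edge `i` of `a`. -/
structure Glued (Δ : IdealTriangulation T) (a : Node T) (i : Fin 3) (b : Node T) (j : Fin 3) :
    Prop where
  opp : Δ.opp (a.face, i) = (b.face, j)
  vert_one : b.vert (j + 1) = a.vert (i + 2)
  vert_two : b.vert (j + 2) = a.vert (i + 1)
  orient : 0 < orient a.vert * orient b.vert

namespace Glued

variable {a b : Node T} {i j : Fin 3} (h : Glued Δ a i b j)
include h

theorem symm : Glued Δ b j a i :=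
  ⟨by rw [← h.opp, Δ.opp_opp], h.vert_two.symm, h.vert_one.symm, by rw [mul_comm]; exact h.orient⟩

theorem gram_eq : gram b.vert j = gram a.vert i := by
  rw [gram, gram, h.vert_one, h.vert_two, form_comm]

/-- Both sides are determinants of `x` with the two shared vertices, which the two triangles list in
opposite orders. -/
theorem coord_mul_orient (ha : IsConeTriple a.vert) (hb : IsConeTriple b.vert) (x : Fin 3 → ℝ) :
    coord b.vert x j * BrokenHyperbolic.orient b.vert =
      -(coord a.vert x i * BrokenHyperbolic.orient a.vert) := by
  rw [← hb.det_edge, ← ha.det_edge, h.vert_one, h.vert_two, det_swap]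

theorem coord_pos_iff (ha : IsConeTriple a.vert) (hb : IsConeTriple b.vert) (x : Fin 3 → ℝ) :
    0 < coord b.vert x j ↔ coord a.vert x i < 0 := by
  have h1 := h.coord_mul_orient ha hb x
  have h2 := h.orient
  have ha0 : 0 < BrokenHyperbolic.orient a.vert ^ 2 := by have := ha.orient_ne; positivity
  have key : coord b.vert x j * (BrokenHyperbolic.orient a.vert * BrokenHyperbolic.orient b.vert) =
      -coord a.vert x i * BrokenHyperbolic.orient a.vert ^ 2 := by
    linear_combination BrokenHyperbolic.orient a.vert * h1
  constructor
  · intro hb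
    have := mul_pos hb h2
    rw [key] at this
    have := pos_of_mul_pos_left this ha0.le
    linarith
  · intro hb
    have := mul_pos (neg_pos.2 hb) ha0
    rw [← key] at this
    exact pos_of_mul_pos_left this h2.le

theorem coord_neg_iff (ha : IsConeTriple a.vert) (hb : IsConeTriple b.vert) (x : Fin 3 → ℝ) :
    coord b.vert x j < 0 ↔ 0 < coord a.vert x i :=
  (h.symm.coord_pos_iff hb ha x).symm

theorem coord_eq_zero_iff (ha : IsConeTriple a.vert) (hb : IsConeTriple b.vert) (x : Fin 3 → ℝ) :
    coord b.vert x j = 0 ↔ coord a.vert x i = 0 := by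
  have h1 := h.coord_pos_iff ha hb x
  have h2 := h.coord_neg_iff ha hb x
  constructor <;> intro h0 <;> rw [h0] at h1 h2 <;> simp at h1 h2 <;> linarith

end Glued

/-- The step of the construction across the edge `i`. -/
def Node.step (Δ : IdealTriangulation T) (m : T × Fin 3 → ℝ) (a : Node T) (i : Fin 3) : Node T where
  face := (Δ.opp (a.face, i)).1
  entry := some (Δ.opp (a.face, i)).2
  vert k :=
    if k = (Δ.opp (a.face, i)).2 then
      -- With `j` the entry edge, `a.vert (i + 2)` becomes the vertex `j + 1`. The edge joining it
      -- to the new vertex `j` is opposite to `j + 2`, which explains the order of the two weights.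
      thirdVertex (a.vert (i + 2)) (a.vert (i + 1)) (a.vert i)
        (m ((Δ.opp (a.face, i)).1, (Δ.opp (a.face, i)).2 + 2))
        (m ((Δ.opp (a.face, i)).1, (Δ.opp (a.face, i)).2 + 1))
    else if k = (Δ.opp (a.face, i)).2 + 1 then a.vert (i + 2) else a.vert (i + 1)

section Step

variable {m : T × Fin 3 → ℝ} (hm : ∀ q, 0 < m q) {a : Node T} (ha : IsConeTriple a.vert) (i : Fin 3)

theorem Node.step_vert_self : (a.step Δ m i).vert (Δ.opp (a.face, i)).2 =
    thirdVertex (a.vert (i + 2)) (a.vert (i + 1)) (a.vert i)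
      (m ((Δ.opp (a.face, i)).1, (Δ.opp (a.face, i)).2 + 2))
      (m ((Δ.opp (a.face, i)).1, (Δ.opp (a.face, i)).2 + 1)) := if_pos rfl

theorem Node.step_vert_one : (a.step Δ m i).vert ((Δ.opp (a.face, i)).2 + 1) = a.vert (i + 2) := by
  simp only [Node.step, if_neg (fin3_add_one_ne _), if_true]

theorem Node.step_vert_two : (a.step Δ m i).vert ((Δ.opp (a.face, i)).2 + 2) = a.vert (i + 1) := by
  simp only [Node.step, if_neg (fin3_add_two_ne _), if_neg (fin3_add_one_ne_add_two _).symm]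

include ha in
theorem form_vert_neg : form (a.vert (i + 2)) (a.vert (i + 1)) < 0 ∧
    form (a.vert i) (a.vert (i + 2)) < 0 ∧ form (a.vert i) (a.vert (i + 1)) < 0 := by
  have h0 := ha.gram_pos i
  have h1 := ha.gram_pos (i + 1)
  have h2 := ha.gram_pos (i + 2)
  rw [gram] at h0
  rw [gram_add_one] at h1
  rw [gram_add_two] at h2
  rw [form_comm (a.vert (i + 2)), form_comm (a.vert i) (a.vert (i + 2))]
  exact ⟨by linarith, by linarith, by linarith⟩

include hm ha

theorem Node.step_spec :
    (a.step Δ m i).vert (Δ.opp (a.face, i)).2 ∈ LightCone ∧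
    gram (a.step Δ m i).vert ((Δ.opp (a.face, i)).2 + 1) =
      m ((Δ.opp (a.face, i)).1, (Δ.opp (a.face, i)).2 + 1) ∧
    gram (a.step Δ m i).vert ((Δ.opp (a.face, i)).2 + 2) =
      m ((Δ.opp (a.face, i)).1, (Δ.opp (a.face, i)).2 + 2) := by
  obtain ⟨h12, h1, h2⟩ := form_vert_neg ha i
  obtain ⟨h3, h4, h5⟩ := thirdVertex_spec (ha.mem (i + 2)) (ha.mem (i + 1)) (ha.mem i) h12 h1 h2
    (hm ((Δ.opp (a.face, i)).1, (Δ.opp (a.face, i)).2 + 2))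
    (hm ((Δ.opp (a.face, i)).1, (Δ.opp (a.face, i)).2 + 1))
  rw [gram_add_one, gram_add_two, form_comm _ ((a.step Δ m i).vert (Δ.opp (a.face, i)).2),
    step_vert_self, step_vert_one, step_vert_two, h4, h5, neg_neg, neg_neg]
  exact ⟨h3, rfl, rfl⟩

theorem Node.glued_step : Glued Δ a i (a.step Δ m i) (Δ.opp (a.face, i)).2 := by
  refine ⟨rfl, step_vert_one i, step_vert_two i, ?_⟩
  obtain ⟨h12, h1, h2⟩ := form_vert_neg ha i
  have hd := ha.det_ne i
  rw [← det_swap_ne] at hd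
  have := oppositeSides_thirdVertex hd h1 h2
    (hm ((Δ.opp (a.face, i)).1, (Δ.opp (a.face, i)).2 + 2))
    (hm ((Δ.opp (a.face, i)).1, (Δ.opp (a.face, i)).2 + 1))
  rw [← det_eq_orient a.vert i, ← det_eq_orient (a.step Δ m i).vert (Δ.opp (a.face, i)).2,
    step_vert_self, step_vert_one, step_vert_two]
  rw [OppositeSides, det_swap (a.vert (i + 1)) (a.vert (i + 2)) (a.vert i)] at this
  linarith
where
  det_swap_ne {a b c : Fin 3 → ℝ} : Matrix.det ![b, a, c] ≠ 0 ↔ Matrix.det ![a, b, c] ≠ 0 := by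
    rw [det_swap a b c, neg_ne_zero]

theorem Node.step_triple : IsConeTriple (a.step Δ m i).vert := by
  have hor := (Node.glued_step (Δ := Δ) hm ha i).orient
  refine .of_orient (fun k => ?_) fun h => by rw [h] at hor; simp at hor
  rcases fin3_cases (Δ.opp (a.face, i)).2 k with h | h | h <;> rw [h]
  · exact (Node.step_spec hm ha i).1
  · rw [step_vert_one]; exact ha.mem _
  · rw [step_vert_two]; exact ha.mem _

end Step

namespace DevData

variable (R : DevData Δ)

/-- The triangle reached from the initial one by crossing the edges of a list, the last one of
which is the head of the list. -/
def node : List (Fin 3) → Node T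
  | [] => ⟨R.face, none, R.vert⟩
  | i :: l => (node l).step Δ R.weight i

/-- The lists of edges which do not turn back. -/
def Valid : List (Fin 3) → Prop
  | [] => True
  | i :: l => Valid l ∧ (R.node l).entry ≠ some i

theorem triple_node (l : List (Fin 3)) : IsConeTriple (R.node l).vert := by
  induction l with
  | nil => exact R.triple
  | cons i l ih => exact Node.step_triple R.weight_pos ih i

theorem glued_cons (i : Fin 3) (l : List (Fin 3)) :
    Glued Δ (R.node l) i (R.node (i :: l)) (Δ.opp ((R.node l).face, i)).2 :=
  Node.glued_step R.weight_pos (R.triple_node l) i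

/-- The entry edge is excluded: it keeps the product from the previous triangle, which may differ
from the weight of the same edge seen from the new face. -/
theorem gram_node (l : List (Fin 3)) (k : Fin 3) (hk : (R.node l).entry ≠ some k) :
    gram (R.node l).vert k = R.weight ((R.node l).face, k) := by
  cases l with
  | nil => exact R.gram_vert k
  | cons i l =>
    have := Node.step_spec (Δ := Δ) R.weight_pos (R.triple_node l) i
    rcases fin3_cases (Δ.opp ((R.node l).face, i)).2 k with h | h | h
    · exact absurd (by rw [h]; rfl) hk
    · rw [h]; exact this.2.1
    · rw [h]; exact this.2.2

/-- Without backtracking, the edge just crossed is not the entry edge of the previous triangle, so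
even the entry edge carries a weight, namely that of the pair on its other side. Hence only finitely
many products occur when there are finitely many faces. -/
theorem exists_gram_node {l : List (Fin 3)} (hl : R.Valid l) (k : Fin 3) :
    ∃ q, gram (R.node l).vert k = R.weight q := by
  by_cases hk : (R.node l).entry = some k
  · cases l with
    | nil => exact absurd hk (by simp [node])
    | cons i l =>
      have : (Δ.opp ((R.node l).face, i)).2 = k := by simpa [node, Node.step] using hk
      subst this
      exact ⟨_, (R.glued_cons i l).gram_eq.trans (R.gram_node l i hl.2)⟩
  · exact ⟨_, R.gram_node l k hk⟩

/-! ### Triangles overlap in common edges only -/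

/-- Nesting of half-planes: a point on or beyond the edge `k` of the new triangle is strictly inside
its entry edge, a different edge, and thus strictly beyond the edge `i` of the old one. -/
theorem coord_neg_of_beyond {i k : Fin 3} {l : List (Fin 3)} (hl : R.Valid (k :: i :: l))
    {x : Fin 3 → ℝ} (hx : x ∈ HypPlane) (h : coord (R.node (i :: l)).vert x k ≤ 0) :
    coord (R.node l).vert x i < 0 := by
  rw [← (R.glued_cons i l).coord_pos_iff (R.triple_node _) (R.triple_node _)]
  refine (R.triple_node (i :: l)).coord_pos_of_nonpos hx (fun h0 => hl.2 ?_) h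
  rw [h0]
  rfl

theorem coord_neg_of_beyond_append {i k : Fin 3} {l' l : List (Fin 3)}
    (hl : R.Valid (k :: (l' ++ i :: l))) {x : Fin 3 → ℝ} (hx : x ∈ HypPlane)
    (h : coord (R.node (l' ++ i :: l)).vert x k ≤ 0) : coord (R.node l).vert x i < 0 := by
  induction l' generalizing k with
  | nil => exact R.coord_neg_of_beyond hl hx h
  | cons k' l' ih => exact ih hl.1 (R.coord_neg_of_beyond hl hx h).le

theorem coord_nonpos_of_mem {i : Fin 3} {l : List (Fin 3)} {x : Fin 3 → ℝ}
    (h : ∀ k, 0 ≤ coord (R.node (i :: l)).vert x k) : coord (R.node l).vert x i ≤ 0 := by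
  by_contra! h0
  rw [← (R.glued_cons i l).coord_neg_iff (R.triple_node _) (R.triple_node _)] at h0
  exact absurd (h _) (not_le.2 h0)

theorem coord_of_mem_append {i : Fin 3} {l' l : List (Fin 3)} (hl : R.Valid (l' ++ i :: l))
    {x : Fin 3 → ℝ} (hx : x ∈ HypPlane)
    (h : ∀ k, 0 ≤ coord (R.node (l' ++ i :: l)).vert x k) :
    coord (R.node l).vert x i ≤ 0 ∧ (l' ≠ [] → coord (R.node l).vert x i < 0) := by
  cases l' with
  | nil => exact ⟨R.coord_nonpos_of_mem h, fun h => absurd rfl h⟩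
  | cons k l' =>
    have := R.coord_neg_of_beyond_append hl hx (R.coord_nonpos_of_mem h)
    exact ⟨this.le, fun _ => this⟩

end DevData

/-! ### The last common triangle of two paths. -/

theorem exists_common_prefix {α : Type*} (w w' : List α) :
    w = w' ∨ (∃ i l, w' = w ++ i :: l) ∨ (∃ i l, w = w' ++ i :: l) ∨
      ∃ v i l i' l', i ≠ i' ∧ w = v ++ i :: l ∧ w' = v ++ i' :: l' := by
  induction w generalizing w' with
  | nil =>
    cases w' with
    | nil => exact .inl rfl
    | cons i l => exact .inr (.inl ⟨i, l, rfl⟩)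
  | cons a w ih =>
    cases w' with
    | nil => exact .inr (.inr (.inl ⟨a, w, rfl⟩))
    | cons b w' =>
      by_cases hab : a = b
      · subst hab
        rcases ih w' with h | ⟨i, l, h⟩ | ⟨i, l, h⟩ | ⟨v, i, l, i', l', hi, h, h'⟩
        · exact .inl (by rw [h])
        · exact .inr (.inl ⟨i, l, by rw [h]; rfl⟩)
        · exact .inr (.inr (.inl ⟨i, l, by rw [h]; rfl⟩))
        · exact .inr (.inr (.inr ⟨a :: v, i, l, i', l', hi, by rw [h]; rfl, by rw [h']; rfl⟩))
      · exact .inr (.inr (.inr ⟨[], a, w, b, w', hab, rfl, rfl⟩))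

theorem exists_common_suffix {α : Type*} (w w' : List α) :
    w = w' ∨ (∃ i l, w' = l ++ i :: w) ∨ (∃ i l, w = l ++ i :: w') ∨
      ∃ v i l i' l', i ≠ i' ∧ w = l ++ i :: v ∧ w' = l' ++ i' :: v := by
  have key : ∀ {a b : List α} {i : α} {l : List α}, a.reverse = b.reverse ++ i :: l →
      a = l.reverse ++ i :: b := fun h => by
    rw [← List.reverse_reverse (as := _ ++ _), List.reverse_append]
    simpa using congrArg List.reverse h
  rcases exists_common_prefix w.reverse w'.reverse with h | ⟨i, l, h⟩ | ⟨i, l, h⟩ |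
    ⟨v, i, l, i', l', hi, h, h'⟩
  · exact .inl (List.reverse_injective h)
  · exact .inr (.inl ⟨i, l.reverse, key h⟩)
  · exact .inr (.inr (.inl ⟨i, l.reverse, key h⟩))
  · refine .inr (.inr (.inr ⟨v.reverse, i, l.reverse, i', l'.reverse, hi, key ?_, key ?_⟩))
    · rw [List.reverse_reverse, h]
    · rw [List.reverse_reverse, h']

namespace DevData

variable (R : DevData Δ)

/-- The latest crossing is the head of a list, so the last common triangle of two paths is their
longest common suffix. If both paths leave it, `x` would be on or beyond two different edges of it.
If one path extends the other, strict nesting forbids more than one extra step. -/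
theorem overlap {w w' : List (Fin 3)} (hw : R.Valid w) (hw' : R.Valid w') {x : Fin 3 → ℝ}
    (hx : x ∈ HypPlane) (h : ∀ k, 0 ≤ coord (R.node w).vert x k)
    (h' : ∀ k, 0 ≤ coord (R.node w').vert x k) :
    w = w' ∨ (∃ i, w' = i :: w ∧ coord (R.node w).vert x i = 0) ∨
      ∃ i, w = i :: w' ∧ coord (R.node w').vert x i = 0 := by
  have key : ∀ {a b : List (Fin 3)}, R.Valid b → (∀ k, 0 ≤ coord (R.node a).vert x k) →
      (∀ k, 0 ≤ coord (R.node b).vert x k) → ∀ i l, b = l ++ i :: a →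
      b = i :: a ∧ coord (R.node a).vert x i = 0 := by
    intro a b hb ha' hb' i l hab
    subst hab
    have := R.coord_of_mem_append hb hx hb'
    have h0 := le_antisymm this.1 (ha' i)
    cases l with
    | nil => exact ⟨rfl, h0⟩
    | cons k l => exact absurd (this.2 (by simp)) (by rw [h0]; exact lt_irrefl 0)
  rcases exists_common_suffix w w' with e | ⟨i, l, e⟩ | ⟨i, l, e⟩ | ⟨v, i, l, i', l', hi, e, e'⟩
  · exact .inl e
  · exact .inr (.inl ⟨i, key hw' h h' i l e⟩)
  · exact .inr (.inr ⟨i, key hw h' h i l e⟩)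
  · subst e e'
    have h1 := (R.coord_of_mem_append hw hx h).1
    have h2 := (R.coord_of_mem_append hw' hx h').1
    exact absurd ((R.triple_node v).coord_pos_of_nonpos hx hi h1) (not_lt.2 h2)

end DevData

end

noncomputable section

/-! ## The triangles cover the hyperbolic plane -/

/-- The elements of `Fin 3` add up to zero, so `-(i + j)` is the index different from `i` and `j`:
the vertex common to the edges `i` and `j`. -/
theorem fin3_third {i j : Fin 3} (h : i ≠ j) :
    (i = -(i + j) + 1 ∧ j = -(i + j) + 2) ∨ (i = -(i + j) + 2 ∧ j = -(i + j) + 1) := by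
  revert i j; decide

theorem fin3_third' {i j : Fin 3} (h : i ≠ j) :
    (-(i + j) = i + 1 ∧ j = i + 2) ∨ (-(i + j) = i + 2 ∧ j = i + 1) := by
  revert i j; decide

variable {T : Type*} {Δ : IdealTriangulation T} (R : DevData Δ)

namespace DevData

/-- The function which decreases along a sequence of triangles towards a point: the hyperbolic sine
of the distance to the edge. -/
def edgeHeight (l : List (Fin 3)) (x : Fin 3 → ℝ) (i : Fin 3) : ℝ :=
  |coord (R.node l).vert x i * orient (R.node l).vert| / gram (R.node l).vert i

theorem edgeHeight_cons (i : Fin 3) (l : List (Fin 3)) (x : Fin 3 → ℝ) :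
    R.edgeHeight (i :: l) x (Δ.opp ((R.node l).face, i)).2 = R.edgeHeight l x i := by
  rw [edgeHeight, edgeHeight, (R.glued_cons i l).gram_eq,
    (R.glued_cons i l).coord_mul_orient (R.triple_node _) (R.triple_node _), abs_neg]

end DevData

theorem IsConeTriple.form_third {u : Fin 3 → Fin 3 → ℝ} (hu : IsConeTriple u) (x : Fin 3 → ℝ)
    {i j : Fin 3} (hij : i ≠ j) :
    -form x (u (-(i + j))) = gram u i * coord u x j + gram u j * coord u x i := by
  have h := hu.form_eq x (-(i + j))
  rcases fin3_third hij with ⟨h1, h2⟩ | ⟨h1, h2⟩ <;> rw [← h1, ← h2] at h <;> linarith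

theorem IsConeTriple.orient_ge {u : Fin 3 → Fin 3 → ℝ} (hu : IsConeTriple u) {ε : ℝ} (hε : 0 < ε)
    (h : ∀ k, ε ≤ gram u k) : √(2 * ε ^ 3) ≤ |orient u| := by
  rw [← Real.sqrt_sq_eq_abs, hu.orient_sq]
  apply Real.sqrt_le_sqrt
  have h0 := h 0
  have h1 := h 1
  have h2 := h 2
  have : ε * ε * ε ≤ gram u 0 * gram u 1 * gram u 2 :=
    mul_le_mul (mul_le_mul h0 h1 hε.le (hε.le.trans h0)) h2 hε.le
      (mul_nonneg (hε.le.trans h0) (hε.le.trans h1))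
  nlinarith

namespace DevData

theorem exists_weight_bounds [Finite T] :
    ∃ ε K : ℝ, 0 < ε ∧ 0 < K ∧ ∀ l, R.Valid l → ∀ k, ε ≤ gram (R.node l).vert k ∧
      gram (R.node l).vert k ≤ K := by
  have : Nonempty (T × Fin 3) := ⟨(R.face, 0)⟩
  obtain ⟨q₁, h₁⟩ := Finite.exists_min R.weight
  obtain ⟨q₂, h₂⟩ := Finite.exists_max R.weight
  refine ⟨R.weight q₁, R.weight q₂, R.weight_pos _, R.weight_pos _, fun l hl k => ?_⟩
  obtain ⟨q, hq⟩ := R.exists_gram_node hl k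
  rw [hq]
  exact ⟨h₁ q, h₂ q⟩

/-- A point in no triangle is always beyond some edge, and crossing such edges gives an infinite
path. The decrease of its distances to the crossed edges is summable, which controls the vertices
about which the path turns. -/
theorem exists_coord_nonneg [Finite T] {x : Fin 3 → ℝ} (hx : x ∈ HypPlane) :
    ∃ l, R.Valid l ∧ ∀ k, 0 ≤ coord (R.node l).vert x k := by
  by_contra! H
  obtain ⟨ε, K, hε, hK, hεK⟩ := R.exists_weight_bounds
  have H' : ∀ l, ∃ k, R.Valid l → coord (R.node l).vert x k < 0 := fun l => by
    by_cases hl : R.Valid l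
    · obtain ⟨k, hk⟩ := H l hl
      exact ⟨k, fun _ => hk⟩
    · exact ⟨0, fun h => absurd h hl⟩
  choose nxt hnxt using H'
  -- the triangles on the way to `x`
  obtain ⟨L, hL0, hL⟩ : ∃ L : ℕ → List (Fin 3), L 0 = [] ∧ ∀ n, L (n + 1) = nxt (L n) :: L n :=
    ⟨fun n => Nat.rec [] (fun _ l => nxt l :: l) n, rfl, fun _ => rfl⟩
  have tri : ∀ n, IsConeTriple (R.node (L n)).vert := fun n => R.triple_node _
  have hvalid : ∀ n, R.Valid (L n) ∧
      ∀ j, (R.node (L n)).entry = some j → 0 < coord (R.node (L n)).vert x j := by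
    intro n
    induction n with
    | zero => rw [hL0]; exact ⟨trivial, fun j hj => by simp [node] at hj⟩
    | succ n ih =>
      rw [hL]
      refine ⟨⟨ih.1, fun h => ?_⟩, fun j hj => ?_⟩
      · exact absurd (ih.2 _ h) (not_lt.2 (hnxt _ ih.1).le)
      · have : (Δ.opp ((R.node (L n)).face, nxt (L n))).2 = j := by
          simpa [node, Node.step] using hj
        rw [← this, (R.glued_cons _ _).coord_pos_iff (tri n) (R.triple_node _)]
        exact hnxt _ ih.1
  let e : ℕ → Fin 3 := fun n => (Δ.opp ((R.node (L n)).face, nxt (L n))).2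
  have he : ∀ n, (R.node (L (n + 1))).entry = some (e n) := fun n => by rw [hL]; rfl
  have hglue : ∀ n, Glued Δ (R.node (L n)) (nxt (L n)) (R.node (L (n + 1))) (e n) := fun n => by
    rw [hL]; exact R.glued_cons _ _
  have hneg : ∀ n, coord (R.node (L n)).vert x (nxt (L n)) < 0 := fun n => hnxt _ (hvalid n).1
  have hpos : ∀ n, 0 < coord (R.node (L (n + 1))).vert x (e n) := fun n =>
    (hvalid (n + 1)).2 _ (he n)
  -- The point is strictly inside the entry edge and strictly beyond the exit edge, so the path does
  -- not turn back.
  have hne : ∀ n, e n ≠ nxt (L (n + 1)) := fun n h => by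
    have h1 := hpos n
    rw [h] at h1
    exact lt_asymm h1 (hneg (n + 1))
  -- the vertex about which one turns
  let v : ℕ → Fin 3 → ℝ := fun n => (R.node (L (n + 1))).vert (-(e n + nxt (L (n + 1))))
  let s : ℕ → ℝ := fun n => R.edgeHeight (L n) x (nxt (L n))
  have hs0 : ∀ n, 0 ≤ s n := fun n => div_nonneg (abs_nonneg _) ((tri n).gram_pos _).le
  have hv0 : ∀ n, 0 < -form x (v n) := fun n => by
    have := form_hyp_cone_neg hx ((tri (n + 1)).mem (-(e n + nxt (L (n + 1)))))
    linarith
  -- This bounds `|orient| / (gram * gram)` from below: by `orient_sq`, `|orient|` is at least `√(2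
  -- * ε ^ 3)`, and both products are at most `K`.
  set κ := √(2 * ε ^ 3) / (K * K) with hκ
  have hκ0 : 0 < κ := by positivity
  -- Seen from the triangle `n + 1`, the two heights are multiples of its entry and exit
  -- coordinates. By `form_third` their difference is a multiple of the product of `x` with the
  -- vertex shared by the two edges.
  have hdec : ∀ n, κ * -form x (v n) ≤ s n - s (n + 1) := by
    intro n
    have h1 : s n = coord (R.node (L (n + 1))).vert x (e n) * |orient (R.node (L (n + 1))).vert| /
        gram (R.node (L (n + 1))).vert (e n) := by
      rw [← abs_of_pos (hpos n), ← abs_mul]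
      have := (R.edgeHeight_cons (nxt (L n)) (L n) x).symm
      rw [← hL] at this
      exact this
    have h2 : s (n + 1) = -coord (R.node (L (n + 1))).vert x (nxt (L (n + 1))) *
        |orient (R.node (L (n + 1))).vert| /
        gram (R.node (L (n + 1))).vert (nxt (L (n + 1))) := by
      rw [← abs_of_neg (hneg (n + 1)), ← abs_mul]
      rfl
    have h3 := (tri (n + 1)).form_third x (hne n)
    have g1 := (tri (n + 1)).gram_pos (e n)
    have g2 := (tri (n + 1)).gram_pos (nxt (L (n + 1)))
    have h4 : s n - s (n + 1) = |orient (R.node (L (n + 1))).vert| /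
        (gram (R.node (L (n + 1))).vert (e n) * gram (R.node (L (n + 1))).vert (nxt (L (n + 1)))) *
        -form x (v n) := by
      rw [h3, h1, h2]
      field_simp
      ring
    rw [h4]
    refine mul_le_mul_of_nonneg_right ?_ (hv0 n).le
    refine div_le_div₀ (abs_nonneg _) ((tri _).orient_ge hε fun k => (hεK _ (hvalid _).1 k).1)
      (mul_pos g1 g2) ?_
    exact mul_le_mul (hεK _ (hvalid _).1 _).2 (hεK _ (hvalid _).1 _).2 g2.le hK.le
  have hanti : Antitone s := antitone_nat_of_succ_le fun n => by
    have := hdec n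
    have := mul_pos hκ0 (hv0 n)
    linarith
  have hlim : Tendsto s atTop (𝓝 (⨅ n, s n)) :=
    tendsto_atTop_ciInf hanti ⟨0, by rintro _ ⟨n, rfl⟩; exact hs0 n⟩
  have hdiff : Tendsto (fun n => (s n - s (n + 1)) / κ) atTop (𝓝 0) := by
    have := ((hlim.sub (hlim.comp (tendsto_add_atTop_nat 1))).div_const κ)
    simpa using this
  have hA : Tendsto (fun n => -form x (v n)) atTop (𝓝 0) :=
    squeeze_zero (fun n => (hv0 n).le) (fun n => by
      rw [le_div_iff₀ hκ0, mul_comm]; exact hdec n) hdiff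
  -- Two products below `√(ε / 2)` multiply to less than `ε / 2`, which `neg_form_le_mul` forbids
  -- for two vertices joined by an edge.
  obtain ⟨N, hN⟩ := eventually_atTop.1 (hA.eventually (gt_mem_nhds (Real.sqrt_pos.2 (half_pos hε))))
  have hconst : ∀ n, N ≤ n → v (n + 1) = v n := by
    intro n hn
    have hprod : v (n + 1) ≠ (R.node (L (n + 1))).vert (e n) := by
      intro h
      have h1 := hN n hn
      have h2 := hN (n + 1) (by omega)
      have hk : ε ≤ -form (v n) (v (n + 1)) := by
        rw [h]
        have := (hεK _ (hvalid (n + 1)).1 (nxt (L (n + 1)))).1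
        simp only [v]
        rcases fin3_third' (hne n) with ⟨h3, h4⟩ | ⟨h3, h4⟩
        · rw [h4, gram_add_two] at this
          rwa [h3, form_comm]
        · rw [h4, gram_add_one] at this
          rwa [h3]
      have h5 := neg_form_le_mul hx ((tri (n + 1)).mem (-(e n + nxt (L (n + 1)))))
        ((tri (n + 2)).mem (-(e (n + 1) + nxt (L (n + 2))))) (by
          change form (v n) (v (n + 1)) < 0; linarith)
      change -form (v n) (v (n + 1)) ≤ 2 * (form x (v n) * form x (v (n + 1))) at h5
      have h6 : form x (v n) * form x (v (n + 1)) < ε / 2 := by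
        rw [← neg_mul_neg, ← Real.mul_self_sqrt (half_pos hε).le]
        exact mul_lt_mul'' h1 h2 (hv0 n).le (hv0 _).le
      linarith
    -- The crossed edge joins `v n` to the vertex opposite to the previous entry edge. The next
    -- turning vertex is one of these two, and `hprod` excludes the second.
    have hends : ∀ k, k ≠ e (n + 1) → (R.node (L (n + 2))).vert k = v n ∨
        (R.node (L (n + 2))).vert k = (R.node (L (n + 1))).vert (e n) := by
      intro k hk
      have h1 : (R.node (L (n + 2))).vert (e (n + 1) + 1) =
        (R.node (L (n + 1))).vert (nxt (L (n + 1)) + 2) := (hglue (n + 1)).vert_one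
      have h2 : (R.node (L (n + 2))).vert (e (n + 1) + 2) =
        (R.node (L (n + 1))).vert (nxt (L (n + 1)) + 1) := (hglue (n + 1)).vert_two
      have h3 : nxt (L (n + 1)) + 1 = e n ∧ nxt (L (n + 1)) + 2 = -(e n + nxt (L (n + 1))) ∨
          nxt (L (n + 1)) + 2 = e n ∧ nxt (L (n + 1)) + 1 = -(e n + nxt (L (n + 1))) := by
        rcases fin3_third' (hne n) with ⟨h3, h4⟩ | ⟨h3, h4⟩ <;> rw [h3, h4]
        · exact .inl ⟨fin3_add_two_one _, fin3_add_two_two _⟩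
        · exact .inr ⟨fin3_add_one_two _, fin3_add_one_one _⟩
      rcases fin3_cases (e (n + 1)) k with h | h | h
      · exact absurd h hk
      · rw [h, h1]
        rcases h3 with ⟨h3, h4⟩ | ⟨h3, h4⟩
        · exact .inl (by rw [h4])
        · exact .inr (by rw [h3])
      · rw [h, h2]
        rcases h3 with ⟨h3, h4⟩ | ⟨h3, h4⟩
        · exact .inr (by rw [h3])
        · exact .inl (by rw [h4])
    rcases hends (-(e (n + 1) + nxt (L (n + 2)))) (by
      rcases fin3_third' (hne (n + 1)) with ⟨h3, h4⟩ | ⟨h3, h4⟩ <;> rw [h3]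
      · exact fin3_add_one_ne _
      · exact fin3_add_two_ne _) with h | h
    · exact h
    · exact absurd h hprod
  have hconst' : ∀ n, N ≤ n → v n = v N := fun n hn => by
    induction n, hn using Nat.le_induction with
    | base => rfl
    | succ n hn ih => rw [hconst n hn, ih]
  have hA' : Tendsto (fun n => -form x (v n)) atTop (𝓝 (-form x (v N))) :=
    tendsto_const_nhds.congr' (eventually_atTop.2 ⟨N, fun n hn => by simp only [hconst' n hn]⟩)
  exact (hv0 N).ne' (tendsto_nhds_unique hA' hA)

/-! ## The lifted triangulation -/

/-- The triangles of the development. -/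
def Tri : Type := {l : List (Fin 3) // R.Valid l}

variable {R}

/-- The decorated triangle. -/
def Tri.nd (n : R.Tri) : Node T := R.node n.1

theorem Tri.triple (n : R.Tri) : IsConeTriple n.nd.vert := R.triple_node n.1

/-- The initial triangle. -/
def Tri.root : R.Tri := ⟨[], trivial⟩

/-- The triangle-edge pair on the other side of an edge. -/
def nbr : R.Tri × Fin 3 → R.Tri × Fin 3
  | (⟨[], h⟩, i) => (⟨[i], ⟨h, by simp [node]⟩⟩, (Δ.opp ((R.node []).face, i)).2)
  | (⟨i' :: l, h⟩, i) =>
    if hi : (R.node (i' :: l)).entry = some i then (⟨l, h.1⟩, i')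
    else (⟨i :: i' :: l, ⟨h, hi⟩⟩, (Δ.opp ((R.node (i' :: l)).face, i)).2)

theorem nbr_of_entry_ne (n : R.Tri) {i : Fin 3} (h : n.nd.entry ≠ some i) :
    nbr (n, i) = (⟨i :: n.1, ⟨n.2, h⟩⟩, (Δ.opp (n.nd.face, i)).2) := by
  obtain ⟨l, hl⟩ := n
  cases l with
  | nil => rfl
  | cons i' l => exact dif_neg h

theorem nbr_cons (l : List (Fin 3)) (i' i : Fin 3) (h : R.Valid (i' :: l))
    (hi : (R.node (i' :: l)).entry = some i) : nbr (⟨i' :: l, h⟩, i) = (⟨l, h.1⟩, i') :=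
  dif_pos hi

theorem nbr_spec (n : R.Tri) (i : Fin 3) :
    Glued Δ n.nd i (nbr (n, i)).1.nd (nbr (n, i)).2 ∧ nbr (nbr (n, i)) = (n, i) ∧
      nbr (n, i) ≠ (n, i) := by
  obtain ⟨l, hl⟩ := n
  by_cases h : (R.node l).entry = some i
  · cases l with
    | nil => simp [node] at h
    | cons i' l =>
      have hi : (Δ.opp ((R.node l).face, i')).2 = i := by simpa [node, Node.step] using h
      have h2 := nbr_of_entry_ne (R := R) ⟨l, hl.1⟩ (i := i') hl.2
      rw [nbr_cons l i' i hl h, h2]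
      refine ⟨?_, ?_, ?_⟩
      · have := (R.glued_cons i' l).symm
        rw [hi] at this
        exact this
      · exact Prod.ext rfl hi
      · intro h0
        have := congrArg (fun q => q.1.1.length) h0
        simp at this
  · rw [nbr_of_entry_ne ⟨l, hl⟩ h]
    refine ⟨R.glued_cons i l, ?_, ?_⟩
    · exact nbr_cons l i _ ⟨hl, h⟩ rfl
    · intro h0
      have := congrArg (fun q => q.1.1.length) h0
      simp at this

theorem Tri.reachable (n : R.Tri) :
    Relation.ReflTransGen (fun a b : R.Tri => ∃ i, (nbr (a, i)).1 = b) Tri.root n := by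
  obtain ⟨l, hl⟩ := n
  induction l with
  | nil => exact .refl
  | cons i l ih => exact (ih hl.1).tail ⟨i, by rw [nbr_of_entry_ne ⟨l, hl.1⟩ hl.2]⟩

variable (R) in
/-- The triangulation of the hyperbolic plane by the triangles of the development. -/
def triang : IdealTriangulation R.Tri where
  opp := nbr
  opp_opp q := (nbr_spec q.1 q.2).2.1
  opp_ne q := (nbr_spec q.1 q.2).2.2
  connected t t' := by
    have hsymm : ∀ a b : R.Tri, (∃ i, (nbr (a, i)).1 = b) → ∃ i, (nbr (b, i)).1 = a := by
      rintro a b ⟨i, h⟩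
      refine ⟨(nbr (a, i)).2, ?_⟩
      rw [← h]
      exact congrArg Prod.fst (nbr_spec a i).2.1
    have h := t.reachable
    have h' : Relation.ReflTransGen (fun a b : R.Tri => ∃ i, (nbr (a, i)).1 = b) t Tri.root := by
      induction h with
      | refl => exact .refl
      | tail _ hbc ih => exact .head (hsymm _ _ hbc) ih
    exact h'.trans t'.reachable

theorem glued_opp (n : R.Tri) (i : Fin 3) :
    Glued Δ n.nd i ((triang R).opp (n, i)).1.nd ((triang R).opp (n, i)).2 := (nbr_spec n i).1

/-- The triangles which contain a point. -/
def Tri.carrier (n : R.Tri) : Set HypPlane := {x | ∀ k, 0 ≤ coord n.nd.vert x.1 k}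

theorem isClosed_carrier (n : R.Tri) : IsClosed n.carrier := by
  have : n.carrier = ⋂ k, {x : HypPlane | 0 ≤ coord n.nd.vert x.1 k} := by
    ext; simp [Tri.carrier]
  rw [this]
  exact isClosed_iInter fun k => isClosed_le continuous_const
    ((continuous_coord _ k).comp continuous_subtype_val)

theorem exists_mem_carrier [Finite T] (x : HypPlane) : ∃ n : R.Tri, x ∈ n.carrier := by
  obtain ⟨l, hl, h⟩ := R.exists_coord_nonneg x.2
  exact ⟨⟨l, hl⟩, h⟩

theorem carrier_overlap {n m : R.Tri} {x : HypPlane} (hn : x ∈ n.carrier) (hm : x ∈ m.carrier) :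
    n = m ∨ ∃ i, m = ((triang R).opp (n, i)).1 ∧ coord n.nd.vert x.1 i = 0 := by
  rcases R.overlap n.2 m.2 x.2 hn hm with h | ⟨i, h, h0⟩ | ⟨i, h, h0⟩
  · exact .inl (Subtype.ext h)
  · have hi : n.nd.entry ≠ some i := by have := m.2; rw [h] at this; exact this.2
    refine .inr ⟨i, ?_, h0⟩
    change m = (nbr (n, i)).1
    rw [nbr_of_entry_ne n hi]
    exact Subtype.ext h
  · have hi : m.nd.entry ≠ some i := by have := n.2; rw [h] at this; exact this.2
    have h1 := nbr_of_entry_ne m hi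
    have h2 : (nbr (m, i)).1 = n := by rw [h1]; exact Subtype.ext h.symm
    obtain ⟨hg, h3, -⟩ := nbr_spec m i
    refine .inr ⟨(nbr (m, i)).2, ?_, ?_⟩
    · change m = (nbr (n, _)).1
      rw [← h2]
      exact (congrArg Prod.fst h3).symm
    · rw [h2] at hg
      exact (hg.coord_eq_zero_iff m.triple n.triple x.1).2 h0

theorem mem_carrier_opp {n : R.Tri} {x : HypPlane} {i : Fin 3}
    (h : coord n.nd.vert x.1 i = 0) : x ∈ ((triang R).opp (n, i)).1.carrier := by
  have hg := glued_opp n i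
  have h0 := (hg.coord_eq_zero_iff n.triple (Tri.triple _) x.1).2 h
  intro k
  by_cases hk : k = ((triang R).opp (n, i)).2
  · rw [hk, h0]
  · exact ((Tri.triple _).coord_pos_of_nonpos x.2 (Ne.symm hk) h0.le).le

/-- Near a point of a triangle there are only this triangle and its neighbor. -/
theorem exists_nhds_subset_carrier {n : R.Tri} {x : HypPlane} (hx : x ∈ n.carrier) :
    ∃ i, (∀ᶠ y in 𝓝 x, y ∈ n.carrier ∨
      (y ∈ ((triang R).opp (n, i)).1.carrier ∧ x ∈ ((triang R).opp (n, i)).1.carrier)) := by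
  have hopen : ∀ (m : R.Tri) k, 0 < coord m.nd.vert x.1 k →
      ∀ᶠ y : HypPlane in 𝓝 x, 0 < coord m.nd.vert y.1 k := fun m k hk =>
    ((continuous_coord m.nd.vert k).comp continuous_subtype_val).continuousAt.eventually
      (lt_mem_nhds hk)
  by_cases h : ∃ i, coord n.nd.vert x.1 i = 0
  · obtain ⟨i, hi⟩ := h
    refine ⟨i, ?_⟩
    have hg := glued_opp n i
    set m := (triang R).opp (n, i) with hm
    have h0 := (hg.coord_eq_zero_iff n.triple (Tri.triple _) x.1).2 hi
    have h1 : ∀ᶠ y : HypPlane in 𝓝 x, ∀ k, k ≠ i → 0 < coord n.nd.vert y.1 k := by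
      rw [eventually_all]
      intro k
      by_cases hk : k = i
      · simp [hk]
      · filter_upwards [hopen n k (n.triple.coord_pos_of_nonpos x.2 (Ne.symm hk) hi.le)]
          with y hy _ using hy
    have h2 : ∀ᶠ y : HypPlane in 𝓝 x, ∀ k, k ≠ m.2 → 0 < coord m.1.nd.vert y.1 k := by
      rw [eventually_all]
      intro k
      by_cases hk : k = m.2
      · simp [hk]
      · filter_upwards [hopen m.1 k (m.1.triple.coord_pos_of_nonpos x.2 (Ne.symm hk) h0.le)]
          with y hy _ using hy
    filter_upwards [h1, h2] with y hy1 hy2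
    rcases le_or_gt 0 (coord n.nd.vert y.1 i) with h | h
    · left
      intro k
      by_cases hk : k = i
      · rwa [hk]
      · exact (hy1 k hk).le
    · right
      refine ⟨fun k => ?_, mem_carrier_opp hi⟩
      by_cases hk : k = m.2
      · rw [hk]
        exact ((hg.coord_pos_iff n.triple (Tri.triple _) y.1).2 h).le
      · exact (hy2 k hk).le
  · push Not at h
    -- An interior point needs no neighbor, so the index is arbitrary.
    refine ⟨0, ?_⟩
    have h1 : ∀ᶠ y : HypPlane in 𝓝 x, ∀ k, 0 < coord n.nd.vert y.1 k := by
      rw [eventually_all]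
      exact fun k => hopen n k (lt_of_le_of_ne (hx k) (h k).symm)
    filter_upwards [h1] with y hy using .inl fun k => (hy k).le

/-- A neighborhood of `x` is covered by one triangle and at most one neighbor. By `carrier_overlap`
any triangle meeting them there is one of the two or adjacent to one of them. -/
theorem locallyFinite_carrier [Finite T] : LocallyFinite fun n : R.Tri => n.carrier := by
  intro x
  obtain ⟨n, hn⟩ := exists_mem_carrier (R := R) x
  obtain ⟨i, hi⟩ := exists_nhds_subset_carrier hn
  refine ⟨_, hi, ?_⟩
  let o := (triang R).opp
  refine (((Set.finite_singleton n).union (Set.finite_range fun k => (o (n, k)).1)).union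
    ((Set.finite_singleton (o (n, i)).1).union
      (Set.finite_range fun k => (o ((o (n, i)).1, k)).1))).subset ?_
  rintro m ⟨y, hy, hy' | ⟨hy', -⟩⟩
  · left
    rcases carrier_overlap hy' hy with h | ⟨k, h, -⟩
    · exact .inl h.symm
    · exact .inr ⟨k, h.symm⟩
  · right
    rcases carrier_overlap hy' hy with h | ⟨k, h, -⟩
    · exact .inl h.symm
    · exact .inr ⟨k, h.symm⟩

end DevData

end

noncomputable section

/-! ## Ideal triangles as simplices without vertices -/

/-- Homogeneous coordinates of the points of an ideal triangle. -/
structure IsConePt (a : Fin 3 → ℝ) : Prop where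
  nonneg : ∀ k, 0 ≤ a k
  -- Two vanishing coordinates would give an ideal vertex, which is not a point of the hyperbolic
  -- plane.
  add_pos : ∀ k, 0 < a (k + 1) + a (k + 2)

/-- The positive multiple of a timelike vector in the hyperboloid. -/
def normalize (v : Fin 3 → ℝ) : Fin 3 → ℝ := (√(-form v v))⁻¹ • v

theorem normalize_mem {v : Fin 3 → ℝ} (h : form v v < 0) (h2 : 0 < v 2) :
    normalize v ∈ HypPlane := by
  have hs : 0 < √(-form v v) := Real.sqrt_pos.2 (by linarith)
  have hsq : √(-form v v) ^ 2 = -form v v := Real.sq_sqrt (by linarith)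
  refine ⟨?_, ?_⟩
  · rw [normalize, form_smul_left, form_smul_right]
    field_simp
    rw [hsq]
    field_simp [h.ne]
  · simp only [normalize, Pi.smul_apply, smul_eq_mul]
    positivity

theorem normalize_smul {x : Fin 3 → ℝ} (hx : x ∈ HypPlane) {c : ℝ} (hc : 0 < c) :
    normalize (c • x) = x := by
  have : √(-form (c • x) (c • x)) = c := by
    rw [form_smul_left, form_smul_right, hx.1]
    rw [show -(c * (c * -1)) = c ^ 2 by ring, Real.sqrt_sq hc.le]
  rw [normalize, this, smul_smul, inv_mul_cancel₀ hc.ne', one_smul]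

theorem IsConePt.smul {a : Fin 3 → ℝ} (ha : IsConePt a) {c : ℝ} (hc : 0 < c) :
    IsConePt (c • a) :=
  ⟨fun k => mul_nonneg hc.le (ha.nonneg k), fun k => by
    have := mul_pos hc (ha.add_pos k)
    simp only [Pi.smul_apply, smul_eq_mul]; linarith⟩

namespace IsConeTriple

variable {u : Fin 3 → Fin 3 → ℝ} (hu : IsConeTriple u)
include hu

theorem form_sum_neg {a : Fin 3 → ℝ} (ha : IsConePt a) :
    form (∑ k, a k • u k) (∑ k, a k • u k) < 0 := by
  have h := hu.form_sum_sum a a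
  have hterm : ∀ k, 0 ≤ a k * (gram u (k + 2) * a (k + 1) + gram u (k + 1) * a (k + 2)) := fun k =>
    mul_nonneg (ha.nonneg _) (add_nonneg (mul_nonneg (hu.gram_pos _).le (ha.nonneg _))
      (mul_nonneg (hu.gram_pos _).le (ha.nonneg _)))
  obtain ⟨k, hk⟩ : ∃ k, 0 < a k := by
    by_contra! h0
    have := ha.add_pos 0
    linarith [h0 (0 + 1), h0 (0 + 2)]
  have hpos : 0 < a k * (gram u (k + 2) * a (k + 1) + gram u (k + 1) * a (k + 2)) := by
    refine mul_pos hk ?_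
    have h1 := mul_nonneg (hu.gram_pos (k + 2)).le (ha.nonneg (k + 1))
    have h2 := mul_nonneg (hu.gram_pos (k + 1)).le (ha.nonneg (k + 2))
    by_contra! h0
    have e1 : a (k + 1) = 0 := by
      have : gram u (k + 2) * a (k + 1) = 0 := by linarith
      exact (mul_eq_zero.1 this).resolve_left (hu.gram_pos _).ne'
    have e2 : a (k + 2) = 0 := by
      have : gram u (k + 1) * a (k + 2) = 0 := by linarith
      exact (mul_eq_zero.1 this).resolve_left (hu.gram_pos _).ne'
    have := ha.add_pos k
    linarith
  have : 0 < ∑ k, a k * (gram u (k + 2) * a (k + 1) + gram u (k + 1) * a (k + 2)) :=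
    Finset.sum_pos' (fun k _ => hterm k) ⟨k, Finset.mem_univ _, hpos⟩
  linarith

theorem sum_two_pos {a : Fin 3 → ℝ} (ha : IsConePt a) : 0 < (∑ k, a k • u k) 2 := by
  obtain ⟨k, hk⟩ : ∃ k, 0 < a k := by
    by_contra! h0
    have := ha.add_pos 0
    linarith [h0 (0 + 1), h0 (0 + 2)]
  simp only [Finset.sum_apply, Pi.smul_apply, smul_eq_mul]
  exact Finset.sum_pos' (fun i _ => mul_nonneg (ha.nonneg i) (hu.mem i).2.le)
    ⟨k, Finset.mem_univ _, mul_pos hk (hu.mem k).2⟩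

/-- The point of an ideal triangle with given homogeneous coordinates. -/
def pt (a : Fin 3 → ℝ) (ha : IsConePt a) : HypPlane :=
  ⟨normalize (∑ k, a k • u k), normalize_mem (hu.form_sum_neg ha) (hu.sum_two_pos ha)⟩

theorem coord_isConePt {x : HypPlane} (hx : ∀ k, 0 ≤ coord u x.1 k) : IsConePt (coord u x.1) := by
  refine ⟨hx, fun k => ?_⟩
  have h1 := hx (k + 1)
  have h2 := hx (k + 2)
  rcases h1.eq_or_lt with h | h
  · have := hu.coord_pos_of_nonpos x.2 (fin3_add_one_ne_add_two k) h.symm.le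
    linarith
  · linarith

theorem exists_coord_pt (a : Fin 3 → ℝ) (ha : IsConePt a) :
    ∃ c : ℝ, 0 < c ∧ coord u (hu.pt a ha).1 = c • a := by
  refine ⟨(√(-form (∑ k, a k • u k) (∑ k, a k • u k)))⁻¹,
    inv_pos.2 (Real.sqrt_pos.2 (by linarith [hu.form_sum_neg ha])), ?_⟩
  funext k
  change coord u ((√(-form (∑ k, a k • u k) (∑ k, a k • u k)))⁻¹ • ∑ k, a k • u k) k = _
  rw [Finset.smul_sum]
  simp only [smul_smul]
  exact hu.coord_sum (fun i => _ * a i) k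

theorem pt_eq_of_smul {a : Fin 3 → ℝ} (ha : IsConePt a) {x : HypPlane} {c : ℝ} (hc : 0 < c)
    (h : coord u x.1 = c • a) : hu.pt a ha = x := by
  apply Subtype.ext
  have hx := hu.sum_coord x.1
  have : ∑ k, a k • u k = c⁻¹ • x.1 := by
    rw [← hx, Finset.smul_sum]
    refine Finset.sum_congr rfl fun k _ => ?_
    rw [h, smul_smul, Pi.smul_apply, smul_eq_mul, inv_mul_cancel_left₀ hc.ne']
  change normalize (∑ k, a k • u k) = x.1
  rw [this]
  exact normalize_smul x.2 (inv_pos.2 hc)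

theorem pt_coord {x : HypPlane} (hx : ∀ k, 0 ≤ coord u x.1 k) :
    hu.pt (coord u x.1) (hu.coord_isConePt hx) = x :=
  hu.pt_eq_of_smul _ one_pos (one_smul _ _).symm

theorem mem_idealTriangle_iff (x : HypPlane) : x ∈ idealTriangle u ↔ ∀ k, 0 ≤ coord u x.1 k := by
  constructor
  · rintro ⟨a, ha, h⟩ k
    rw [h, hu.coord_sum]
    exact ha k
  · exact fun h => ⟨_, h, (hu.sum_coord x.1).symm⟩

theorem mem_idealEdge_iff (x : HypPlane) (i : Fin 3) :
    x ∈ idealEdge u i ↔ (∀ k, 0 ≤ coord u x.1 k) ∧ coord u x.1 i = 0 := by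
  constructor
  · rintro ⟨a, ha, hi, h⟩
    rw [h]
    simp only [hu.coord_sum]
    exact ⟨ha, hi⟩
  · exact fun h => ⟨_, h.1, h.2, (hu.sum_coord x.1).symm⟩

theorem pt_mem (a : Fin 3 → ℝ) (ha : IsConePt a) : hu.pt a ha ∈ idealTriangle u := by
  rw [hu.mem_idealTriangle_iff]
  obtain ⟨c, hc, h⟩ := hu.exists_coord_pt a ha
  intro k
  rw [h]
  exact mul_nonneg hc.le (ha.nonneg k)

end IsConeTriple

/-- The simplex without its vertices. -/
def PuncturedSimplex : Set (Fin 3 → ℝ) := {a | IsConePt a ∧ ∑ k, a k = 1}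

theorem convex_puncturedSimplex : Convex ℝ PuncturedSimplex := by
  rintro a ⟨ha, ha1⟩ b ⟨hb, hb1⟩ s t hs ht hst
  refine ⟨⟨fun k => add_nonneg (mul_nonneg hs (ha.nonneg k)) (mul_nonneg ht (hb.nonneg k)),
    fun k => ?_⟩, ?_⟩
  · have h1 := ha.add_pos k
    have h2 := hb.add_pos k
    simp only [Pi.add_apply, Pi.smul_apply, smul_eq_mul]
    rcases hs.eq_or_lt with rfl | hs
    · have : t = 1 := by linarith
      subst this
      linarith
    · nlinarith [mul_pos hs h1, mul_nonneg ht h2.le]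
  · simp only [Pi.add_apply, Pi.smul_apply, smul_eq_mul, Finset.sum_add_distrib,
      ← Finset.mul_sum, ha1, hb1]
    linarith

theorem IsConePt.sum_pos {a : Fin 3 → ℝ} (ha : IsConePt a) : 0 < ∑ k, a k := by
  have := ha.add_pos 0
  have := ha.nonneg 0
  rw [sum_fin3 _ 0]
  linarith

/-- The simplex without its vertices as an ideal triangle. -/
def triHomeo {u : Fin 3 → Fin 3 → ℝ} (hu : IsConeTriple u) :
    PuncturedSimplex ≃ₜ idealTriangle u where
  toFun a := ⟨hu.pt a.1 a.2.1, hu.pt_mem _ _⟩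
  invFun x := ⟨(∑ k, coord u x.1.1 k)⁻¹ • coord u x.1.1, by
    have h := hu.coord_isConePt ((hu.mem_idealTriangle_iff _).1 x.2)
    refine ⟨h.smul (inv_pos.2 h.sum_pos), ?_⟩
    simp only [Pi.smul_apply, smul_eq_mul, ← Finset.mul_sum]
    exact inv_mul_cancel₀ h.sum_pos.ne'⟩
  left_inv a := by
    apply Subtype.ext
    obtain ⟨c, hc, h⟩ := hu.exists_coord_pt a.1 a.2.1
    dsimp only
    rw [h]
    simp only [Pi.smul_apply, smul_eq_mul, ← Finset.mul_sum, a.2.2, mul_one]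
    rw [smul_smul, inv_mul_cancel₀ hc.ne', one_smul]
  right_inv x := by
    apply Subtype.ext
    have h := hu.coord_isConePt ((hu.mem_idealTriangle_iff _).1 x.2)
    refine hu.pt_eq_of_smul (h.smul (inv_pos.2 h.sum_pos)) h.sum_pos ?_
    rw [smul_smul, mul_inv_cancel₀ h.sum_pos.ne', one_smul]
  continuous_toFun := by
    refine Continuous.subtype_mk (Continuous.subtype_mk ?_ _) _
    have h1 : Continuous fun a : PuncturedSimplex => ∑ k, a.1 k • u k :=
      continuous_finsetSum _ fun k _ =>
        ((continuous_apply k).comp continuous_subtype_val).smul continuous_const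
    have h2 : Continuous fun a : PuncturedSimplex =>
        √(-form (∑ k, a.1 k • u k) (∑ k, a.1 k • u k)) := by
      unfold form
      have := fun i : Fin 3 => (continuous_apply i).comp h1
      simp only [Function.comp_def] at this
      fun_prop
    refine Continuous.smul (h2.inv₀ fun a => ?_) h1
    exact (Real.sqrt_pos.2 (by linarith [hu.form_sum_neg a.2.1])).ne'
  continuous_invFun := by
    refine Continuous.subtype_mk ?_ _
    have h1 : Continuous fun x : idealTriangle u => coord u x.1.1 :=
      continuous_pi fun k => (continuous_coord u k).comp
        (continuous_subtype_val.comp continuous_subtype_val)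
    have h2 : Continuous fun x : idealTriangle u => ∑ k, coord u x.1.1 k :=
      continuous_finsetSum _ fun k _ => (continuous_apply k).comp h1
    exact (h2.inv₀ fun x => (hu.coord_isConePt ((hu.mem_idealTriangle_iff _).1 x.2)).sum_pos.ne').smul h1

theorem coord_triHomeo {u : Fin 3 → Fin 3 → ℝ} (hu : IsConeTriple u) (a : PuncturedSimplex) :
    ∃ c : ℝ, 0 < c ∧ coord u (triHomeo hu a).1.1 = c • a.1 :=
  hu.exists_coord_pt a.1 a.2.1

theorem coord_triHomeo_eq_zero_iff {u : Fin 3 → Fin 3 → ℝ} (hu : IsConeTriple u)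
    (a : PuncturedSimplex) (i : Fin 3) : coord u (triHomeo hu a).1.1 i = 0 ↔ a.1 i = 0 := by
  obtain ⟨c, hc, h⟩ := coord_triHomeo hu a
  rw [h]
  simp [hc.ne']

/-! ### Points on the edges -/

/-- The point of the edge `i` with logarithmic coordinate `y`. -/
def simplexEdge (i : Fin 3) (y : ℝ) : PuncturedSimplex :=
  ⟨fun k => if k = i + 1 then Real.exp (-y) / (Real.exp (-y) + Real.exp y) else
    if k = i + 2 then Real.exp y / (Real.exp (-y) + Real.exp y) else 0, by
    refine ⟨⟨fun k => ?_, fun k => ?_⟩, ?_⟩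
    · split_ifs <;> positivity
    · have h1 : 0 < Real.exp (-y) / (Real.exp (-y) + Real.exp y) := by positivity
      have h2 : 0 < Real.exp y / (Real.exp (-y) + Real.exp y) := by positivity
      generalize Real.exp (-y) / (Real.exp (-y) + Real.exp y) = A at *
      generalize Real.exp y / (Real.exp (-y) + Real.exp y) = B at *
      fin_cases i <;> fin_cases k <;> simp <;> linarith
    · rw [sum_fin3 _ i]
      simp only [(fin3_add_one_ne i).symm, (fin3_add_two_ne i).symm,
        (fin3_add_one_ne_add_two i).symm, if_true, if_false]
      have : 0 < Real.exp (-y) + Real.exp y := by positivity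
      field_simp
      simp⟩

theorem simplexEdge_self (i : Fin 3) (y : ℝ) : (simplexEdge i y).1 i = 0 := by
  simp only [simplexEdge, (fin3_add_one_ne i).symm, (fin3_add_two_ne i).symm, if_false]

theorem simplexEdge_one (i : Fin 3) (y : ℝ) :
    (simplexEdge i y).1 (i + 1) = Real.exp (-y) / (Real.exp (-y) + Real.exp y) := by
  simp only [simplexEdge, if_true]

theorem simplexEdge_two (i : Fin 3) (y : ℝ) :
    (simplexEdge i y).1 (i + 2) = Real.exp y / (Real.exp (-y) + Real.exp y) := by
  simp only [simplexEdge, (fin3_add_one_ne_add_two i).symm, if_true, if_false]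

theorem ext_fin3 {α : Type*} {a b : Fin 3 → α} (i : Fin 3) (h0 : a i = b i)
    (h1 : a (i + 1) = b (i + 1)) (h2 : a (i + 2) = b (i + 2)) : a = b := by
  funext k
  rcases fin3_cases i k with h | h | h <;> rw [h] <;> assumption

theorem eq_simplexEdge {a : PuncturedSimplex} {i : Fin 3} (h : a.1 i = 0) (y : ℝ)
    (hy : a.1 (i + 2) = Real.exp (2 * y) * a.1 (i + 1)) : a = simplexEdge i y := by
  have hs := a.2.2
  rw [sum_fin3 _ i, h, hy] at hs
  have e2 : Real.exp (2 * y) = Real.exp y / Real.exp (-y) := by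
    rw [← Real.exp_sub]; ring_nf
  have hp := Real.exp_pos y
  have hn := Real.exp_pos (-y)
  have h1 : a.1 (i + 1) = Real.exp (-y) / (Real.exp (-y) + Real.exp y) := by
    rw [e2] at hs
    field_simp at hs ⊢
    linarith
  apply Subtype.ext
  refine ext_fin3 i ?_ ?_ ?_
  · rw [h, simplexEdge_self]
  · rw [h1, simplexEdge_one]
  · rw [hy, h1, simplexEdge_two, e2]
    field_simp

theorem exists_eq_simplexEdge {a : PuncturedSimplex} {i : Fin 3} (h : a.1 i = 0) :
    ∃ y, a = simplexEdge i y := by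
  have ha := a.2.1
  have h1 : 0 < a.1 (i + 1) := by
    have := ha.add_pos (i + 2)
    rwa [fin3_add_two_one, fin3_add_two_two, h, zero_add] at this
  have h2 : 0 < a.1 (i + 2) := by
    have := ha.add_pos (i + 1)
    rwa [fin3_add_one_one, fin3_add_one_two, h, add_zero] at this
  refine ⟨Real.log (a.1 (i + 2) / a.1 (i + 1)) / 2, eq_simplexEdge h _ ?_⟩
  rw [mul_div_cancel₀ _ (two_ne_zero), Real.exp_log (by positivity), div_mul_cancel₀ _ h1.ne']

theorem simplexEdge_injective {i j : Fin 3} {x y : ℝ} (h : simplexEdge i x = simplexEdge j y) :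
    i = j ∧ x = y := by
  have hpos : ∀ (i k : Fin 3) (y : ℝ), k ≠ i → 0 < (simplexEdge i y).1 k := by
    intro i k y hk
    rcases fin3_cases i k with h | h | h
    · exact absurd h hk
    · rw [h, simplexEdge_one]; positivity
    · rw [h, simplexEdge_two]; positivity
  have hij : i = j := by
    by_contra hne
    have h1 := hpos j i y hne
    rw [← h, simplexEdge_self] at h1
    exact lt_irrefl _ h1
  subst hij
  refine ⟨rfl, ?_⟩
  have h1 := congrArg (fun a => a.1 (i + 1)) h
  have h2 := congrArg (fun a => a.1 (i + 2)) h
  simp only [simplexEdge_one, simplexEdge_two] at h1 h2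
  have h3 : ∀ z : ℝ, Real.exp z / (Real.exp (-z) + Real.exp z) /
      (Real.exp (-z) / (Real.exp (-z) + Real.exp z)) = Real.exp (2 * z) := fun z => by
    rw [div_div_div_cancel_right₀ (by positivity), ← Real.exp_sub]; ring_nf
  have h4 := h3 x
  rw [h1, h2, h3 y] at h4
  have := Real.exp_injective h4
  linarith

/-! ### The standard triangle -/

theorem gram_stdVertex (i : Fin 3) : gram stdVertex i = 1 := by
  rw [gram, form_stdVertex_ne, neg_neg]

theorem stdTriple : IsConeTriple stdVertex := by
  refine .of_orient (fun i => ⟨form_stdVertex_self i, ?_⟩) fun h => ?_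
  · fin_cases i <;> simp [stdVertex]
  · have h1 := det_sq (stdVertex 1) (stdVertex 2) (stdVertex 0)
    have e0 : form (stdVertex 1) (stdVertex 2) = -1 := form_stdVertex_ne 0
    have e1 : form (stdVertex 2) (stdVertex 0) = -1 := form_stdVertex_ne 1
    have e2 : form (stdVertex 1) (stdVertex 0) = -1 := by
      rw [form_comm]; exact form_stdVertex_ne 2
    rw [← orient, h, form_stdVertex_self, form_stdVertex_self, form_stdVertex_self, e0, e1, e2] at h1
    norm_num at h1

/-- The standard triangle as a simplex without vertices. -/
def stdHomeo : PuncturedSimplex ≃ₜ StdTriangle := triHomeo stdTriple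

theorem edgePoint_eq (i : Fin 3) (x : ℝ) : edgePoint i x = stdHomeo (simplexEdge i x) := by
  apply Subtype.ext
  symm
  have hpos : 0 < Real.exp (-x) + Real.exp x := by positivity
  refine stdTriple.pt_eq_of_smul (simplexEdge i x).2.1 (c := (Real.exp (-x) + Real.exp x) / √2)
    (by positivity) ?_
  have h : edgeVec i x = ∑ k, (((Real.exp (-x) + Real.exp x) / √2) • (simplexEdge i x).1) k •
      stdVertex k := by
    rw [sum_fin3 _ i]
    simp only [Pi.smul_apply, simplexEdge_self, simplexEdge_one, simplexEdge_two, smul_eq_mul,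
      mul_zero, zero_smul, zero_add, edgeVec]
    congr 2 <;> field_simp
  funext k
  change coord stdVertex (edgeVec i x) k = _
  rw [h, stdTriple.coord_sum]

theorem edgePoint_injective {i j : Fin 3} {x y : ℝ} (h : edgePoint i x = edgePoint j y) :
    i = j ∧ x = y := by
  rw [edgePoint_eq, edgePoint_eq] at h
  exact simplexEdge_injective (stdHomeo.injective h)

theorem coord_edgePoint (i : Fin 3) (x : ℝ) : coord stdVertex (edgePoint i x).1.1 i = 0 := by
  rw [edgePoint_eq]
  exact (coord_triHomeo_eq_zero_iff stdTriple _ i).2 (simplexEdge_self i x)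

theorem exists_eq_edgePoint {w : StdTriangle} {i : Fin 3} (h : coord stdVertex w.1.1 i = 0) :
    ∃ x, w = edgePoint i x := by
  obtain ⟨a, rfl⟩ := stdHomeo.surjective w
  obtain ⟨y, rfl⟩ := exists_eq_simplexEdge ((coord_triHomeo_eq_zero_iff stdTriple a i).1 h)
  exact ⟨y, (edgePoint_eq i y).symm⟩

theorem coord_std_nonneg (w : StdTriangle) (k : Fin 3) : 0 ≤ coord stdVertex w.1.1 k :=
  (stdTriple.mem_idealTriangle_iff w.1).1 w.2 k

instance : PreconnectedSpace PuncturedSimplex :=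
  Subtype.preconnectedSpace convex_puncturedSimplex.isPreconnected

instance : PreconnectedSpace StdTriangle :=
  stdHomeo.surjective.denseRange.preconnectedSpace stdHomeo.continuous

/-! ### Homeomorphisms of the simplex with given edge maps -/

/-- The first coordinate of the image of the point with homogeneous coordinates `α`, `β` of an edge
under the affine map `y ↦ r * y + s` of its logarithmic coordinate. -/
def edgeMap (r s α β : ℝ) : ℝ := (α + β) * α ^ r / (α ^ r + Real.exp (2 * s) * β ^ r)

section EdgeMap

variable {r s α β : ℝ} (hr : 0 < r)

theorem edgeMap_nonneg (hα : 0 ≤ α) (hβ : 0 ≤ β) : 0 ≤ edgeMap r s α β := by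
  unfold edgeMap; positivity

theorem edgeMap_denom_pos (hα : 0 ≤ α) (hβ : 0 ≤ β) (h : 0 < α + β) :
    0 < α ^ r + Real.exp (2 * s) * β ^ r := by
  have hE := Real.exp_pos (2 * s)
  rcases hα.eq_or_lt with rfl | hα
  · have : 0 < β := by linarith
    positivity
  · positivity

theorem sub_edgeMap (hα : 0 ≤ α) (hβ : 0 ≤ β) : α + β - edgeMap r s α β =
    (α + β) * (Real.exp (2 * s) * β ^ r) / (α ^ r + Real.exp (2 * s) * β ^ r) := by
  rcases (add_nonneg hα hβ).eq_or_lt with h | h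
  · simp [edgeMap, ← h]
  · have := edgeMap_denom_pos (r := r) (s := s) hα hβ h
    rw [edgeMap]
    field_simp
    ring

theorem sub_edgeMap_nonneg (hα : 0 ≤ α) (hβ : 0 ≤ β) : 0 ≤ α + β - edgeMap r s α β := by
  rw [sub_edgeMap hα hβ]; positivity

include hr

theorem edgeMap_zero_left : edgeMap r s 0 β = 0 := by
  simp [edgeMap, Real.zero_rpow hr.ne']

theorem edgeMap_zero_right (hα : 0 ≤ α) : edgeMap r s α 0 = α := by
  rcases hα.eq_or_lt with rfl | hα
  · exact edgeMap_zero_left hr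
  · have : 0 < α ^ r := by positivity
    rw [edgeMap, Real.zero_rpow hr.ne', mul_zero, add_zero, add_zero, mul_div_assoc,
      div_self this.ne', mul_one]

/-- Since `edgeMap` preserves `α + β`, the second image coordinate is a difference. The parameters
are those of the inverse affine map `y ↦ r⁻¹ * y - s / r`. -/
theorem edgeMap_inv (hα : 0 ≤ α) (hβ : 0 ≤ β) :
    edgeMap r⁻¹ (-s / r) (edgeMap r s α β) (α + β - edgeMap r s α β) = α := by
  rcases (add_nonneg hα hβ).eq_or_lt with h | h
  · have hα0 : α = 0 := by linarith
    have hβ0 : β = 0 := by linarith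
    subst hα0 hβ0
    rw [edgeMap_zero_left hr, edgeMap_zero_left (inv_pos.2 hr)]
  · have hD := edgeMap_denom_pos (r := r) (s := s) hα hβ h
    set D := α ^ r + Real.exp (2 * s) * β ^ r with hDdef
    have hc : 0 < ((α + β) / D) ^ r⁻¹ := by positivity
    have e1 : edgeMap r s α β ^ r⁻¹ = ((α + β) / D) ^ r⁻¹ * α := by
      rw [edgeMap, ← hDdef, mul_div_right_comm, Real.mul_rpow (by positivity) (by positivity),
        Real.rpow_rpow_inv hα hr.ne']
    have e2 : Real.exp (2 * (-s / r)) * (α + β - edgeMap r s α β) ^ r⁻¹ =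
        ((α + β) / D) ^ r⁻¹ * β := by
      rw [sub_edgeMap hα hβ, ← hDdef, mul_div_right_comm,
        Real.mul_rpow (by positivity) (by positivity), Real.mul_rpow (by positivity) (by positivity),
        Real.rpow_rpow_inv hβ hr.ne', ← Real.exp_mul]
      have : Real.exp (2 * (-s / r)) * Real.exp (2 * s * r⁻¹) = 1 := by
        rw [← Real.exp_add, Real.exp_eq_one_iff]; field_simp; ring
      linear_combination ((α + β) / D) ^ r⁻¹ * β * this
    rw [edgeMap, e1, e2, add_sub_cancel, ← mul_add]
    field_simp

/-- The quotient degenerates where both arguments vanish. There the bounds `0 ≤ edgeMap ≤ α + β`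
squeeze it to zero. -/
theorem continuous_edgeMap {X : Type*} [TopologicalSpace X] {f g : X → ℝ} (hf : Continuous f)
    (hg : Continuous g) (hf0 : ∀ x, 0 ≤ f x) (hg0 : ∀ x, 0 ≤ g x) :
    Continuous fun x => edgeMap r s (f x) (g x) := by
  rw [continuous_iff_continuousAt]
  intro x
  have hfr : Continuous fun x => f x ^ r := hf.rpow_const fun _ => .inr hr.le
  have hgr : Continuous fun x => g x ^ r := hg.rpow_const fun _ => .inr hr.le
  rcases (add_nonneg (hf0 x) (hg0 x)).eq_or_lt with h | h
  · have h0 : edgeMap r s (f x) (g x) = 0 := by rw [edgeMap, ← h]; simp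
    have hsum : Tendsto (fun x => f x + g x) (𝓝 x) (𝓝 0) := by
      have : Tendsto (fun x => f x + g x) (𝓝 x) (𝓝 (f x + g x)) := (hf.add hg).tendsto x
      rwa [← h] at this
    rw [ContinuousAt, h0]
    exact squeeze_zero (fun y => edgeMap_nonneg (hf0 y) (hg0 y))
      (fun y => by linarith [sub_edgeMap_nonneg (r := r) (s := s) (hf0 y) (hg0 y)]) hsum
  · exact ContinuousAt.div (((hf.add hg).mul hfr).continuousAt)
      ((hfr.add (continuous_const.mul hgr)).continuousAt)
      (edgeMap_denom_pos (r := r) (s := s) (hf0 x) (hg0 x) h).ne'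

end EdgeMap

/-- The smallest coordinate. -/
def minCoord (a : Fin 3 → ℝ) : ℝ := min (a 0) (min (a 1) (a 2))

theorem minCoord_le (a : Fin 3 → ℝ) (k : Fin 3) : minCoord a ≤ a k := by
  fin_cases k <;> simp [minCoord]

theorem exists_minCoord_eq (a : Fin 3 → ℝ) : ∃ k, a k = minCoord a := by
  unfold minCoord
  rcases min_choice (a 1) (a 2) with h | h <;> rw [h]
  · rcases min_choice (a 0) (a 1) with h | h <;> rw [h] <;> exact ⟨_, rfl⟩
  · rcases min_choice (a 0) (a 2) with h | h <;> rw [h] <;> exact ⟨_, rfl⟩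

theorem minCoord_eq {a : Fin 3 → ℝ} {i : Fin 3} (h : ∀ k, a i ≤ a k) : minCoord a = a i := by
  obtain ⟨k, hk⟩ := exists_minCoord_eq a
  exact le_antisymm (minCoord_le a i) (hk ▸ h k)

theorem continuous_minCoord : Continuous minCoord := by unfold minCoord; fun_prop

/-- The extension of maps of the edges to the simplex, as a cone with apex at the center. -/
def coneMap (r s : Fin 3 → ℝ) (a : Fin 3 → ℝ) (k : Fin 3) : ℝ :=
  -- The index `k` is the first end of the edge `k + 2` and the second end of the edge `k + 1`. An
  -- edge not opposite to a smallest coordinate has a vanishing argument and contributes its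
  -- original coordinate, so the correction `2 * minCoord a - a k` gives the cone without a case
  -- distinction.
  2 * minCoord a - a k +
    edgeMap (r (k + 2)) (s (k + 2)) (a k - minCoord a) (a (k + 1) - minCoord a) +
    ((a (k + 2) - minCoord a) + (a k - minCoord a) -
      edgeMap (r (k + 1)) (s (k + 1)) (a (k + 2) - minCoord a) (a k - minCoord a))

section ConeMap

variable {r s : Fin 3 → ℝ} (hr : ∀ k, 0 < r k) {a : Fin 3 → ℝ} {i : Fin 3}
include hr

/-- Subtracting the smallest coordinate `a i` projects from the center to the edge `i`. The other
two edge maps have a zero argument and act as the identity. -/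
theorem coneMap_of_min (h : ∀ k, a i ≤ a k) :
    coneMap r s a i = a i ∧
    coneMap r s a (i + 1) = a i + edgeMap (r i) (s i) (a (i + 1) - a i) (a (i + 2) - a i) ∧
    coneMap r s a (i + 2) = a i + ((a (i + 1) - a i) + (a (i + 2) - a i) -
      edgeMap (r i) (s i) (a (i + 1) - a i) (a (i + 2) - a i)) := by
  have hm := minCoord_eq h
  have h1 : 0 ≤ a (i + 1) - a i := sub_nonneg.2 (h _)
  have h2 : 0 ≤ a (i + 2) - a i := sub_nonneg.2 (h _)
  simp only [coneMap, hm, fin3_add_one_one, fin3_add_one_two, fin3_add_two_one, fin3_add_two_two,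
    sub_self]
  refine ⟨?_, ?_, ?_⟩
  · rw [edgeMap_zero_left (hr _), edgeMap_zero_right (hr _) h2]; ring
  · rw [edgeMap_zero_left (hr _)]; ring
  · rw [edgeMap_zero_right (hr _) h2]; ring

theorem coneMap_mem (ha : a ∈ PuncturedSimplex) : coneMap r s a ∈ PuncturedSimplex := by
  obtain ⟨i, hi⟩ := exists_minCoord_eq a
  have h : ∀ k, a i ≤ a k := fun k => hi ▸ minCoord_le a k
  obtain ⟨e0, e1, e2⟩ := coneMap_of_min (s := s) hr h
  have h1 : 0 ≤ a (i + 1) - a i := sub_nonneg.2 (h _)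
  have h2 : 0 ≤ a (i + 2) - a i := sub_nonneg.2 (h _)
  have h0 := ha.1.nonneg i
  have n1 := edgeMap_nonneg (r := r i) (s := s i) h1 h2
  have n2 := sub_edgeMap_nonneg (r := r i) (s := s i) h1 h2
  have hs := ha.2
  rw [sum_fin3 _ i] at hs
  have hpos : 0 < a i ∨ (0 < edgeMap (r i) (s i) (a (i + 1) - a i) (a (i + 2) - a i) ∧
      0 < (a (i + 1) - a i) + (a (i + 2) - a i) -
        edgeMap (r i) (s i) (a (i + 1) - a i) (a (i + 2) - a i)) := by
    rcases h0.eq_or_lt with h0 | h0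
    · right
      have p1 := ha.1.add_pos (i + 2)
      have p2 := ha.1.add_pos (i + 1)
      rw [fin3_add_two_one, fin3_add_two_two] at p1
      rw [fin3_add_one_one, fin3_add_one_two] at p2
      have q1 : 0 < a (i + 1) - a i := by linarith
      have q2 : 0 < a (i + 2) - a i := by linarith
      rw [sub_edgeMap h1 h2, edgeMap]
      constructor <;> positivity
    · exact .inl h0
  refine ⟨⟨fun k => ?_, fun k => ?_⟩, ?_⟩
  · rcases fin3_cases i k with h | h | h <;> rw [h]
    · rw [e0]; exact h0
    · rw [e1]; linarith
    · rw [e2]; linarith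
  · rcases fin3_cases i k with h | h | h <;>
      simp only [h, fin3_add_one_one, fin3_add_one_two, fin3_add_two_one, fin3_add_two_two, e0, e1,
        e2] <;>
      rcases hpos with hp | ⟨hp, hq⟩ <;> linarith
  · rw [sum_fin3 _ i, e0, e1, e2]; linarith

theorem coneMap_inv (a : Fin 3 → ℝ) :
    coneMap (fun k => (r k)⁻¹) (fun k => -s k / r k) (coneMap r s a) = a := by
  obtain ⟨i, hi⟩ := exists_minCoord_eq a
  have h : ∀ k, a i ≤ a k := fun k => hi ▸ minCoord_le a k
  obtain ⟨e0, e1, e2⟩ := coneMap_of_min (s := s) hr h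
  have h1 : 0 ≤ a (i + 1) - a i := sub_nonneg.2 (h _)
  have h2 : 0 ≤ a (i + 2) - a i := sub_nonneg.2 (h _)
  have n1 := edgeMap_nonneg (r := r i) (s := s i) h1 h2
  have n2 := sub_edgeMap_nonneg (r := r i) (s := s i) h1 h2
  have h' : ∀ k, coneMap r s a i ≤ coneMap r s a k := fun k => by
    rcases fin3_cases i k with h | h | h <;> rw [h]
    · rw [e0, e1]; linarith
    · rw [e0, e2]; linarith
  obtain ⟨f0, f1, f2⟩ := coneMap_of_min (r := fun k => (r k)⁻¹) (s := fun k => -s k / r k)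
    (fun k => inv_pos.2 (hr k)) h'
  have key := edgeMap_inv (s := s i) (hr i) h1 h2
  refine ext_fin3 i ?_ ?_ ?_
  · rw [f0, e0]
  · rw [f1, e0, e1, e2, add_sub_cancel_left, add_sub_cancel_left, key]; ring
  · rw [f2, e0, e1, e2, add_sub_cancel_left, add_sub_cancel_left, key]; ring

theorem continuous_coneMap : Continuous fun a : PuncturedSimplex => coneMap r s a.1 := by
  refine continuous_pi fun k => ?_
  have hc : ∀ k, Continuous fun a : PuncturedSimplex => a.1 k - minCoord a.1 := fun k =>
    ((continuous_apply k).sub continuous_minCoord).comp continuous_subtype_val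
  have hnn : ∀ k (a : PuncturedSimplex), 0 ≤ a.1 k - minCoord a.1 := fun k a =>
    sub_nonneg.2 (minCoord_le _ _)
  have h0 : Continuous fun a : PuncturedSimplex => 2 * minCoord a.1 - a.1 k :=
    ((continuous_const.mul continuous_minCoord).sub (continuous_apply k)).comp
      continuous_subtype_val
  exact (h0.add (continuous_edgeMap (hr _) (hc _) (hc _) (hnn _) (hnn _))).add
    (((hc _).add (hc _)).sub (continuous_edgeMap (hr _) (hc _) (hc _) (hnn _) (hnn _)))

end ConeMap

/-- The homeomorphism of the simplex without vertices which extends the affine maps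
`y ↦ r i * y + s i` of the edges. -/
def coneHomeo (r s : Fin 3 → ℝ) (hr : ∀ k, 0 < r k) : PuncturedSimplex ≃ₜ PuncturedSimplex where
  toFun a := ⟨coneMap r s a.1, coneMap_mem hr a.2⟩
  invFun a := ⟨coneMap (fun k => (r k)⁻¹) (fun k => -s k / r k) a.1,
    coneMap_mem (fun k => inv_pos.2 (hr k)) a.2⟩
  left_inv a := Subtype.ext (coneMap_inv hr a.1)
  right_inv a := by
    apply Subtype.ext
    have := coneMap_inv (r := fun k => (r k)⁻¹) (s := fun k => -s k / r k)
      (fun k => inv_pos.2 (hr k)) a.1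
    have e1 : (fun k => ((r k)⁻¹)⁻¹) = r := by funext k; exact inv_inv _
    have e2 : (fun k => -(-s k / r k) / (r k)⁻¹) = s := by
      funext k; have := (hr k).ne'; field_simp
    rwa [e1, e2] at this
  continuous_toFun := Continuous.subtype_mk (continuous_coneMap hr) _
  continuous_invFun := Continuous.subtype_mk (continuous_coneMap fun k => inv_pos.2 (hr k)) _

theorem coneHomeo_simplexEdge (r s : Fin 3 → ℝ) (hr : ∀ k, 0 < r k) (i : Fin 3) (y : ℝ) :
    coneHomeo r s hr (simplexEdge i y) = simplexEdge i (r i * y + s i) := by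
  have h : ∀ k, (simplexEdge i y).1 i ≤ (simplexEdge i y).1 k := fun k => by
    rw [simplexEdge_self]; exact (simplexEdge i y).2.1.nonneg k
  obtain ⟨e0, e1, e2⟩ := coneMap_of_min (s := s) hr h
  have hn := (simplexEdge i y).2.1.nonneg
  rw [simplexEdge_self] at e0 e1 e2
  rw [sub_zero, sub_zero, zero_add] at e1 e2
  refine eq_simplexEdge e0 _ ?_
  change coneMap r s (simplexEdge i y).1 (i + 2) = _ * coneMap r s (simplexEdge i y).1 (i + 1)
  rw [e1, e2, sub_edgeMap (hn _) (hn _), edgeMap, simplexEdge_one, simplexEdge_two]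
  have hp := Real.exp_pos y
  have hm := Real.exp_pos (-y)
  have hd : 0 < Real.exp (-y) + Real.exp y := by positivity
  rw [Real.div_rpow hm.le hd.le, Real.div_rpow hp.le hd.le, ← Real.exp_mul, ← Real.exp_mul]
  have : Real.exp (2 * s i) * Real.exp (y * r i) =
      Real.exp (2 * (r i * y + s i)) * Real.exp (-y * r i) := by
    rw [← Real.exp_add, ← Real.exp_add]; ring_nf
  rw [mul_div_assoc', this]
  ring

end

noncomputable section

/-! ## Morphisms of gluings are coverings -/

/-- The part of the standard triangle which is nearest to an edge. -/
def edgeNhd (i : Fin 3) : Set StdTriangle :=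
  {w | ∀ k, k ≠ i → coord stdVertex w.1.1 i < coord stdVertex w.1.1 k}

/-- The interior of the standard triangle. -/
def stdInterior : Set StdTriangle := {w | ∀ k, 0 < coord stdVertex w.1.1 k}

theorem continuous_coord_std (k : Fin 3) :
    Continuous fun w : StdTriangle => coord stdVertex w.1.1 k :=
  (continuous_coord stdVertex k).comp (continuous_subtype_val.comp continuous_subtype_val)

theorem isOpen_edgeNhd (i : Fin 3) : IsOpen (edgeNhd i) := by
  have : edgeNhd i = ⋂ k, {w : StdTriangle | k ≠ i →
      coord stdVertex w.1.1 i < coord stdVertex w.1.1 k} := by ext; simp [edgeNhd]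
  rw [this]
  refine isOpen_iInter_of_finite fun k => ?_
  by_cases hk : k = i
  · simp [hk]
  · simpa [hk] using isOpen_lt (continuous_coord_std i) (continuous_coord_std k)

theorem isOpen_stdInterior : IsOpen stdInterior := by
  have : stdInterior = ⋂ k, {w : StdTriangle | 0 < coord stdVertex w.1.1 k} := by
    ext; simp [stdInterior]
  rw [this]
  exact isOpen_iInter_of_finite fun k => isOpen_lt continuous_const (continuous_coord_std k)

theorem eq_of_mem_edgeNhd {w : StdTriangle} {i j : Fin 3} (hi : w ∈ edgeNhd i)
    (hj : w ∈ edgeNhd j) : i = j := by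
  by_contra h
  exact lt_asymm (hi j (Ne.symm h)) (hj i h)

theorem edgePoint_mem_edgeNhd (i : Fin 3) (x : ℝ) : edgePoint i x ∈ edgeNhd i := fun k hk => by
  rw [coord_edgePoint]
  exact stdTriple.coord_pos_of_nonpos (edgePoint i x).1.2 (Ne.symm hk) (coord_edgePoint i x).le

theorem edgePoint_mem_edgeNhd_iff {i j : Fin 3} {x : ℝ} : edgePoint i x ∈ edgeNhd j ↔ i = j :=
  ⟨eq_of_mem_edgeNhd (edgePoint_mem_edgeNhd i x), fun h => h ▸ edgePoint_mem_edgeNhd i x⟩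

theorem edgePoint_notMem_stdInterior (i : Fin 3) (x : ℝ) : edgePoint i x ∉ stdInterior := fun h =>
  (h i).ne' (coord_edgePoint i x)

theorem mem_stdInterior_or (w : StdTriangle) : w ∈ stdInterior ∨ ∃ i x, w = edgePoint i x := by
  by_cases h : ∃ i, coord stdVertex w.1.1 i = 0
  · obtain ⟨i, hi⟩ := h
    exact .inr ⟨i, exists_eq_edgePoint hi⟩
  · push Not at h
    exact .inl fun k => lt_of_le_of_ne (coord_std_nonneg w k) (h k).symm

/-! ### The gluing relation and saturated open sets. -/

namespace HomotheticGluing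

variable {T : Type*} {Δ : IdealTriangulation T} {F : Type*} [TopologicalSpace F]
  (G : HomotheticGluing Δ F)

theorem chart_edgePoint (t : T) (i : Fin 3) (x : ℝ) : G.chart t (edgePoint i x) =
    G.chart (Δ.opp (t, i)).1
      (edgePoint (Δ.opp (t, i)).2 (G.shift (t, i) - G.scale (t, i) * x)) :=
  (G.chart_eq_iff _ _ _ _).2 (.inr ⟨i, x, rfl, rfl, rfl⟩)

/-- The gluing relation, read from the other side of the edge, must give back the original point.
The alternative of equal faces and equal points would make `q` its own opposite. -/
theorem opp_shift_scale (q : T × Fin 3) (x : ℝ) :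
    G.shift (Δ.opp q) - G.scale (Δ.opp q) * (G.shift q - G.scale q * x) = x := by
  obtain ⟨t, i⟩ := q
  rcases (G.chart_eq_iff _ _ _ _).1 (G.chart_edgePoint t i x).symm with ⟨h1, h2⟩ | ⟨i', x', h, h1, h2⟩
  · obtain ⟨h3, -⟩ := edgePoint_injective h2
    exact absurd (Prod.ext h1 h3) (Δ.opp_ne (t, i))
  · obtain ⟨h3, h4⟩ := edgePoint_injective h
    subst h3
    exact ((edgePoint_injective h2).2.trans (by rw [← h4])).symm

theorem scale_opp_mul (q : T × Fin 3) : G.scale (Δ.opp q) * G.scale q = 1 := by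
  have h0 := G.opp_shift_scale q 0
  have h1 := G.opp_shift_scale q 1
  linear_combination h1 - h0

theorem scale_opp (q : T × Fin 3) : G.scale (Δ.opp q) = (G.scale q)⁻¹ :=
  eq_inv_of_mul_eq_one_left (G.scale_opp_mul q)

theorem shift_opp (q : T × Fin 3) : G.shift (Δ.opp q) = G.shift q / G.scale q := by
  have h0 := G.opp_shift_scale q 0
  rw [scale_opp] at h0
  rw [div_eq_inv_mul]
  linarith

theorem continuous_chart (t : T) : Continuous (G.chart t) :=
  G.isQuotientMap.continuous.comp (continuous_sigmaMk (ι := T) (σ := fun _ => StdTriangle))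

theorem isOpen_iff (U : Set F) : IsOpen U ↔ ∀ t, IsOpen (G.chart t ⁻¹' U) := by
  rw [← G.isQuotientMap.isOpen_preimage, isOpen_sigma_iff]
  rfl

theorem exists_chart_eq (y : F) : ∃ t w, G.chart t w = y := by
  obtain ⟨⟨t, w⟩, h⟩ := G.isQuotientMap.surjective y
  exact ⟨t, w, h⟩

/-- The subset of the surface given by subsets of the faces. -/
def glue (A : T → Set StdTriangle) : Set F := ⋃ t, G.chart t '' A t

variable {G}

/-- Subsets of the faces which are respected by the gluing. -/
def Saturated (G : HomotheticGluing Δ F) (A : T → Set StdTriangle) : Prop :=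
  ∀ t i x, edgePoint i x ∈ A t →
    edgePoint (Δ.opp (t, i)).2 (G.shift (t, i) - G.scale (t, i) * x) ∈ A (Δ.opp (t, i)).1

theorem chart_mem_glue {A : T → Set StdTriangle} (hA : G.Saturated A) {t : T} {w : StdTriangle} :
    G.chart t w ∈ G.glue A ↔ w ∈ A t := by
  constructor
  · intro h
    obtain ⟨t', w', hw', h⟩ := Set.mem_iUnion.1 h
    rcases (G.chart_eq_iff _ _ _ _).1 h with ⟨rfl, rfl⟩ | ⟨i, x, rfl, rfl, rfl⟩
    · exact hw'
    · exact hA _ _ _ hw'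
  · exact fun h => Set.mem_iUnion.2 ⟨t, w, h, rfl⟩

theorem isOpen_glue {A : T → Set StdTriangle} (hA : G.Saturated A) (ho : ∀ t, IsOpen (A t)) :
    IsOpen (G.glue A) := by
  rw [G.isOpen_iff]
  intro t
  have : G.chart t ⁻¹' G.glue A = A t := by ext w; exact chart_mem_glue hA
  rw [this]
  exact ho t

/-- The interior of a face. -/
def cell (t : T) (t' : T) : Set StdTriangle := {w | t' = t ∧ w ∈ stdInterior}

/-- The neighborhood of an edge. -/
def star (Δ : IdealTriangulation T) (t : T) (i : Fin 3) (t' : T) : Set StdTriangle :=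
  {w | (t' = t ∧ w ∈ edgeNhd i) ∨ (t' = (Δ.opp (t, i)).1 ∧ w ∈ edgeNhd (Δ.opp (t, i)).2)}

theorem isOpen_setOf_and {X : Type*} [TopologicalSpace X] (P : Prop) {s : Set X} (hs : IsOpen s) :
    IsOpen {w | P ∧ w ∈ s} := by
  by_cases h : P <;> simp [h, hs]

theorem isOpen_cell (t t' : T) : IsOpen (cell t t') := isOpen_setOf_and _ isOpen_stdInterior

theorem isOpen_star (t : T) (i : Fin 3) (t' : T) : IsOpen (star Δ t i t') :=
  (isOpen_setOf_and _ (isOpen_edgeNhd _)).union (isOpen_setOf_and _ (isOpen_edgeNhd _))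

theorem saturated_cell (t : T) : G.Saturated (cell t) := fun _ i x h =>
  absurd h.2 (edgePoint_notMem_stdInterior i x)

theorem saturated_star (t : T) (i : Fin 3) : G.Saturated (star Δ t i) := by
  rintro t' k x (⟨rfl, h⟩ | ⟨rfl, h⟩)
  · obtain rfl := edgePoint_mem_edgeNhd_iff.1 h
    exact .inr ⟨rfl, edgePoint_mem_edgeNhd _ _⟩
  · obtain rfl := edgePoint_mem_edgeNhd_iff.1 h
    have : Δ.opp ((Δ.opp (t, i)).1, (Δ.opp (t, i)).2) = (t, i) := Δ.opp_opp (t, i)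
    exact .inl ⟨congrArg Prod.fst this, by
      rw [edgePoint_mem_edgeNhd_iff]; exact congrArg Prod.snd this⟩

end HomotheticGluing

/-- A continuous open map is a homeomorphism from each sheet onto `V`, and the index type of the
sheets is made discrete. -/
theorem IsEvenlyCovered.of_sheets {X F : Type*} [TopologicalSpace X] [TopologicalSpace F]
    {q : X → F} (hq : Continuous q) (hqo : IsOpenMap q) {ι : Type*} [Nonempty ι] (U : ι → Set X)
    {V : Set F} (hU : ∀ n, IsOpen (U n)) (hV : IsOpen V) (inj : ∀ n, Set.InjOn q (U n))
    (surj : ∀ n, Set.SurjOn q (U n) V) (disj : ∀ n m x, x ∈ U n → x ∈ U m → n = m)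
    (exh : ∀ x, q x ∈ V → ∃ n, x ∈ U n) {y : F} (hy : y ∈ V) :
    IsEvenlyCovered q y (q ⁻¹' {y}) := by
  let _ : TopologicalSpace ι := ⊥
  have : DiscreteTopology ι := ⟨rfl⟩
  obtain ⟨x₀, -, -⟩ := surj (Classical.arbitrary ι) hy
  have : Nonempty (F → X) := ⟨fun _ => x₀⟩
  refine .to_isEvenlyCovered_preimage (.of_trivialization
    (t := hV.trivializationDiscrete U V (fun n W hW => ⟨fun h => ?_, fun h => ?_⟩) inj surj
      (fun n m hnm => Set.disjoint_left.2 fun x hn hm => hnm (disj n m x hn hm))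
      fun x hx => Set.mem_iUnion.2 (exh x hx)) hy)
  · exact (h.preimage hq).inter (hU n)
  · have : W = q '' (q ⁻¹' W ∩ U n) := by
      ext z
      constructor
      · intro hz
        obtain ⟨x, hx, rfl⟩ := surj n (hW hz)
        exact ⟨x, ⟨hz, hx⟩, rfl⟩
      · rintro ⟨x, ⟨hx, -⟩, rfl⟩
        exact hx
    rw [this]
    exact hqo _ h

section Morphism

variable {N T : Type*} {Δ' : IdealTriangulation N} {Δ : IdealTriangulation T} {X F : Type*}
  [TopologicalSpace X] [TopologicalSpace F] {G' : HomotheticGluing Δ' X} {G : HomotheticGluing Δ F}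
  {φ : N → T} (hφ : Function.Surjective φ)
  (hopp : ∀ n i, Δ.opp (φ n, i) = (φ (Δ'.opp (n, i)).1, (Δ'.opp (n, i)).2))
  (hscale : ∀ n i, G'.scale (n, i) = G.scale (φ n, i))
  (hshift : ∀ n i, G'.shift (n, i) = G.shift (φ n, i))

open HomotheticGluing

include hφ hopp hscale hshift

/-- A map of gluings which is given by a covering of the triangulations is a covering map. -/
theorem exists_isCoveringMap : ∃ q : X → F, (∀ n w, q (G'.chart n w) = G.chart (φ n) w) ∧
    IsCoveringMap q ∧ Function.Surjective q := by
  have hwd : ∀ n w n' w', G'.chart n w = G'.chart n' w' →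
      G.chart (φ n) w = G.chart (φ n') w' := by
    intro n w n' w' h
    rcases (G'.chart_eq_iff _ _ _ _).1 h with ⟨rfl, rfl⟩ | ⟨i, x, rfl, rfl, rfl⟩
    · rfl
    · rw [G.chart_edgePoint, hopp, hscale, hshift]
  choose face w hfw using G'.exists_chart_eq
  let q : X → F := fun x => G.chart (φ (face x)) (w x)
  have hq : ∀ n w, q (G'.chart n w) = G.chart (φ n) w := fun n w' => hwd _ _ _ _ (hfw _)
  have hqc : Continuous q := by
    rw [G'.isQuotientMap.continuous_iff, continuous_sigma_iff]
    intro n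
    exact (G.continuous_chart (φ n)).congr fun w => (hq n w).symm
  -- Every representation of an image point by a chart of `G` lifts to a representation of the given
  -- preimage. This computes chart preimages of images of open sets, whence `q` is open.
  have hlift : ∀ n w' t w, G.chart t w = G.chart (φ n) w' →
      ∃ m, φ m = t ∧ G'.chart m w = G'.chart n w' := by
    intro n w' t w h
    rcases (G.chart_eq_iff _ _ _ _).1 h.symm with ⟨rfl, rfl⟩ | ⟨i, x, rfl, rfl, rfl⟩
    · exact ⟨n, rfl, rfl⟩
    · refine ⟨(Δ'.opp (n, i)).1, by rw [hopp], ?_⟩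
      have h2 := G'.chart_edgePoint n i x
      rw [hscale, hshift] at h2
      rw [h2, hopp]
  have hqo : IsOpenMap q := by
    intro W hW
    rw [G.isOpen_iff]
    intro t
    have : G.chart t ⁻¹' (q '' W) = ⋃ n : {n // φ n = t}, G'.chart n.1 ⁻¹' W := by
      ext w
      rw [Set.mem_preimage, Set.mem_iUnion]
      constructor
      · rintro ⟨x, hx, h⟩
        obtain ⟨n, w', rfl⟩ := G'.exists_chart_eq x
        rw [hq] at h
        obtain ⟨m, hm, h'⟩ := hlift n w' t w h.symm
        exact ⟨⟨m, hm⟩, by rw [Set.mem_preimage, h']; exact hx⟩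
      · rintro ⟨⟨n, rfl⟩, hw⟩
        exact ⟨_, hw, hq _ _⟩
    rw [this]
    exact isOpen_iUnion fun n => hW.preimage (G'.continuous_chart n.1)
  refine ⟨q, hq, fun y => ?_, fun y => ?_⟩
  swap
  · obtain ⟨t, w, rfl⟩ := G.exists_chart_eq y
    obtain ⟨n, rfl⟩ := hφ t
    exact ⟨_, hq n w⟩
  obtain ⟨t, w, rfl⟩ := G.exists_chart_eq y
  have hne : Nonempty {n // φ n = t} := ⟨_, (hφ t).choose_spec⟩
  rcases mem_stdInterior_or w with hw | ⟨i, x, rfl⟩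
  · -- interior points of faces
    have hinj : ∀ {t w t' w'}, w ∈ stdInterior → G.chart t w = G.chart t' w' → t = t' ∧ w = w' := by
      intro t w t' w' hw h
      rcases (G.chart_eq_iff _ _ _ _).1 h with h | ⟨i, x, rfl, -, -⟩
      · exact h
      · exact absurd hw (edgePoint_notMem_stdInterior i x)
    refine IsEvenlyCovered.of_sheets hqc hqo (ι := {n // φ n = t})
      (fun n => G'.glue (cell n.1)) (V := G.glue (cell t))
      (fun n => isOpen_glue (saturated_cell _) (isOpen_cell _))
      (isOpen_glue (saturated_cell _) (isOpen_cell _)) ?_ ?_ ?_ ?_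
      ((chart_mem_glue (saturated_cell t)).2 ⟨rfl, hw⟩)
    · rintro ⟨n, rfl⟩ x₁ h₁ x₂ h₂ h
      obtain ⟨n₁, w₁, rfl⟩ := G'.exists_chart_eq x₁
      obtain ⟨n₂, w₂, rfl⟩ := G'.exists_chart_eq x₂
      obtain ⟨rfl, h₁'⟩ := (chart_mem_glue (saturated_cell _)).1 h₁
      obtain ⟨rfl, h₂'⟩ := (chart_mem_glue (saturated_cell _)).1 h₂
      rw [hq, hq] at h
      rw [(hinj h₁' h).2]
    · rintro ⟨n, rfl⟩ y hy
      obtain ⟨t', w', rfl⟩ := G.exists_chart_eq y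
      obtain ⟨rfl, h⟩ := (chart_mem_glue (saturated_cell _)).1 hy
      exact ⟨G'.chart n w', (chart_mem_glue (saturated_cell _)).2 ⟨rfl, h⟩, hq _ _⟩
    · rintro ⟨n, hn⟩ ⟨m, hm⟩ x h₁ h₂
      obtain ⟨n₁, w₁, rfl⟩ := G'.exists_chart_eq x
      obtain ⟨rfl, -⟩ := (chart_mem_glue (saturated_cell _)).1 h₁
      obtain ⟨rfl, -⟩ := (chart_mem_glue (saturated_cell _)).1 h₂
      rfl
    · intro x hx
      obtain ⟨n, w', rfl⟩ := G'.exists_chart_eq x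
      rw [hq, chart_mem_glue (saturated_cell _)] at hx
      exact ⟨⟨n, hx.1⟩, (chart_mem_glue (saturated_cell _)).2 ⟨rfl, hx.2⟩⟩
  · -- points on edges
    -- A face may be glued to itself, so the two halves of a star can lie in one face; they are then
    -- told apart by their edges, as no edge is glued to itself.
    have hne' : ∀ t i, (Δ.opp (t, i)).1 = t → i ≠ (Δ.opp (t, i)).2 := fun t i h1 h2 =>
      Δ.opp_ne (t, i) (Prod.ext h1 h2.symm)
    have hj : ∀ n i, (Δ'.opp (n, i)).2 = (Δ.opp (φ n, i)).2 := fun n i => by rw [hopp]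
    have hf : ∀ n i, φ (Δ'.opp (n, i)).1 = (Δ.opp (φ n, i)).1 := fun n i => by rw [hopp]
    refine IsEvenlyCovered.of_sheets hqc hqo (ι := {n // φ n = t})
      (fun n => G'.glue (star Δ' n.1 i)) (V := G.glue (star Δ t i))
      (fun n => isOpen_glue (saturated_star _ _) (isOpen_star _ _))
      (isOpen_glue (saturated_star _ _) (isOpen_star _ _)) ?_ ?_ ?_ ?_
      ((chart_mem_glue (saturated_star t i)).2 (.inl ⟨rfl, edgePoint_mem_edgeNhd i x⟩))
    · -- two points of the star with the same image
      have same : ∀ {n w₁ w₂ j}, w₁ ∈ edgeNhd j → w₂ ∈ edgeNhd j →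
          G.chart (φ n) w₁ = G.chart (φ n) w₂ → w₁ = w₂ := by
        intro n w₁ w₂ j h₁ h₂ h
        rcases (G.chart_eq_iff _ _ _ _).1 h with ⟨-, h'⟩ | ⟨k, x, rfl, h', rfl⟩
        · exact h'
        · rw [edgePoint_mem_edgeNhd_iff] at h₁ h₂
          subst h₁
          exact absurd h₂.symm (hne' _ _ h'.symm)
      have mixed : ∀ {n w₁ w₂}, w₁ ∈ edgeNhd i → w₂ ∈ edgeNhd (Δ'.opp (n, i)).2 →
          G.chart (φ n) w₁ = G.chart (φ (Δ'.opp (n, i)).1) w₂ →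
          G'.chart n w₁ = G'.chart (Δ'.opp (n, i)).1 w₂ := by
        intro n w₁ w₂ h₁ h₂ h
        rcases (G.chart_eq_iff _ _ _ _).1 h with ⟨h', rfl⟩ | ⟨k, x, rfl, -, rfl⟩
        · have := eq_of_mem_edgeNhd h₁ h₂
          rw [hj] at this
          rw [hf] at h'
          exact absurd this (hne' _ _ h'.symm)
        · rw [edgePoint_mem_edgeNhd_iff] at h₁
          subst h₁
          rw [G'.chart_edgePoint, hscale, hshift, hj]
      rintro ⟨n, rfl⟩ x₁ h₁ x₂ h₂ h
      obtain ⟨n₁, w₁, rfl⟩ := G'.exists_chart_eq x₁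
      obtain ⟨n₂, w₂, rfl⟩ := G'.exists_chart_eq x₂
      rw [hq, hq] at h
      rcases (chart_mem_glue (saturated_star _ _)).1 h₁ with ⟨rfl, k₁⟩ | ⟨rfl, k₁⟩ <;>
        rcases (chart_mem_glue (saturated_star _ _)).1 h₂ with ⟨rfl, k₂⟩ | ⟨rfl, k₂⟩
      · rw [same k₁ k₂ h]
      · exact mixed k₁ k₂ h
      · exact (mixed k₂ k₁ h.symm).symm
      · rw [same k₁ k₂ h]
    · rintro ⟨n, rfl⟩ y hy
      obtain ⟨t', w', rfl⟩ := G.exists_chart_eq y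
      rcases (chart_mem_glue (saturated_star _ _)).1 hy with ⟨rfl, h⟩ | ⟨rfl, h⟩
      · exact ⟨G'.chart n w', (chart_mem_glue (saturated_star _ _)).2 (.inl ⟨rfl, h⟩), hq _ _⟩
      · rw [← hj] at h
        exact ⟨G'.chart (Δ'.opp (n, i)).1 w',
          (chart_mem_glue (saturated_star _ _)).2 (.inr ⟨rfl, h⟩), by rw [hq, hf]⟩
    · rintro ⟨n, hn⟩ ⟨m, hm⟩ x h₁ h₂
      obtain ⟨n₁, w₁, rfl⟩ := G'.exists_chart_eq x
      have hcross : ∀ {n m}, φ n = t → φ m = t → n = (Δ'.opp (m, i)).1 → w₁ ∈ edgeNhd i →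
          w₁ ∈ edgeNhd (Δ'.opp (m, i)).2 → False := by
        intro n m hn hm h h₁ h₂
        have h3 := eq_of_mem_edgeNhd h₁ h₂
        rw [hj, hm] at h3
        refine hne' t i ?_ h3
        rw [← hm, ← hf, ← h, hn, hm]
      apply Subtype.ext
      rcases (chart_mem_glue (saturated_star _ _)).1 h₁ with ⟨h3, h₁⟩ | ⟨h3, h₁⟩ <;>
        rcases (chart_mem_glue (saturated_star _ _)).1 h₂ with ⟨h4, h₂⟩ | ⟨h4, h₂⟩
      · exact h3.symm.trans h4
      · exact (hcross hn hm (h3.symm.trans h4) h₁ h₂).elim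
      · exact (hcross hm hn (h4.symm.trans h3) h₂ h₁).elim
      · have h5 : Δ'.opp (n, i) = Δ'.opp (m, i) :=
          Prod.ext (h3.symm.trans h4) (by rw [hj, hj, hn, hm])
        have h6 := congrArg Δ'.opp h5
        rw [Δ'.opp_opp, Δ'.opp_opp] at h6
        exact congrArg Prod.fst h6
    · intro x hx
      obtain ⟨n, w', rfl⟩ := G'.exists_chart_eq x
      rw [hq, chart_mem_glue (saturated_star _ _)] at hx
      rcases hx with ⟨h, hw⟩ | ⟨h, hw⟩
      · exact ⟨⟨n, h⟩, (chart_mem_glue (saturated_star _ _)).2 (.inl ⟨rfl, hw⟩)⟩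
      · have h1 : Δ.opp (φ n, (Δ.opp (t, i)).2) = (t, i) := by rw [h]; exact Δ.opp_opp _
        have h2 : Δ'.opp (n, (Δ.opp (t, i)).2) = ((Δ'.opp (n, (Δ.opp (t, i)).2)).1, i) :=
          Prod.ext rfl (by rw [hj, h1])
        have h3 : Δ'.opp ((Δ'.opp (n, (Δ.opp (t, i)).2)).1, i) = (n, (Δ.opp (t, i)).2) := by
          rw [← h2, Δ'.opp_opp]
        refine ⟨⟨(Δ'.opp (n, (Δ.opp (t, i)).2)).1, by rw [hf, h1]⟩,
          (chart_mem_glue (saturated_star _ _)).2 (.inr ?_)⟩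
        dsimp only
        rw [h3]
        exact ⟨rfl, hw⟩

end Morphism

end

noncomputable section

/-! ## The gluing of the hyperbolic plane -/

namespace DevData

variable {T : Type*} {Δ : IdealTriangulation T} {R : DevData Δ} {F : Type*} [TopologicalSpace F]
  (G : HomotheticGluing Δ F)

/-- The homothetic factor of the map of an edge of the standard triangle to the development. -/
def slope (q : T × Fin 3) : ℝ := √(G.scale q)

/-- The constant term of the map of an edge of the standard triangle to the development. -/
def offset (q : T × Fin 3) : ℝ := -(G.shift q / (2 * √(G.scale q)))

theorem slope_pos (q : T × Fin 3) : 0 < slope G q := Real.sqrt_pos.2 (G.scale_pos q)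

/-- The scaling factors of the two sides are inverse, so square roots share them symmetrically
between the two faces. The sign appears because the faces run through their common edge in opposite
directions. -/
theorem slope_offset_opp (q : T × Fin 3) (x : ℝ) :
    slope G (Δ.opp q) * (G.shift q - G.scale q * x) + offset G (Δ.opp q) =
      -(slope G q * x + offset G q) := by
  have h := slope_pos G q
  have hs : G.scale q = slope G q ^ 2 := (Real.sq_sqrt (G.scale_pos q).le).symm
  have h1 : slope G (Δ.opp q) = (slope G q)⁻¹ := by rw [slope, G.scale_opp, Real.sqrt_inv, slope]
  rw [offset, offset, ← slope, ← slope, G.shift_opp, h1, hs]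
  field_simp
  ring

/-- The map of the standard triangle to a triangle of the development. -/
def triMap (n : R.Tri) : StdTriangle ≃ₜ idealTriangle n.nd.vert :=
  stdHomeo.symm.trans ((coneHomeo (fun i => slope G (n.nd.face, i)) (fun i => offset G (n.nd.face, i))
    fun _ => slope_pos G _).trans (triHomeo n.triple))

/-- The logarithmic coordinates of the image of a point of the standard triangle. -/
def simplexPt (t : T) (w : StdTriangle) : PuncturedSimplex :=
  coneHomeo (fun i => slope G (t, i)) (fun i => offset G (t, i)) (fun _ => slope_pos G _)
    (stdHomeo.symm w)

theorem triMap_apply (n : R.Tri) (w : StdTriangle) :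
    triMap G n w = triHomeo n.triple (simplexPt G n.nd.face w) := rfl

theorem simplexPt_edgePoint (t : T) (i : Fin 3) (x : ℝ) :
    simplexPt G t (edgePoint i x) = simplexEdge i (slope G (t, i) * x + offset G (t, i)) := by
  rw [simplexPt, edgePoint_eq, Homeomorph.symm_apply_apply, coneHomeo_simplexEdge]

theorem exists_eq_edgePoint_of_simplexPt {t : T} {w : StdTriangle} {i : Fin 3}
    (h : (simplexPt G t w).1 i = 0) : ∃ x, w = edgePoint i x := by
  obtain ⟨y, hy⟩ := exists_eq_simplexEdge h
  have hs := slope_pos G (t, i)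
  refine ⟨(y - offset G (t, i)) / slope G (t, i), ?_⟩
  have h2 := simplexPt_edgePoint G t i ((y - offset G (t, i)) / slope G (t, i))
  rw [mul_div_cancel₀ _ hs.ne', sub_add_cancel, ← hy] at h2
  exact stdHomeo.symm.injective ((coneHomeo _ _ _).injective h2.symm)

/-- The parametrization of an edge depends only on its two end vectors. That these agree as vectors,
and not merely as rays, is essential here. -/
theorem triHomeo_simplexEdge_opp {a b : Node T} {i j : Fin 3} (h : Glued Δ a i b j)
    (ha : IsConeTriple a.vert) (hb : IsConeTriple b.vert) (y : ℝ) :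
    (triHomeo ha (simplexEdge i y)).1 = (triHomeo hb (simplexEdge j (-y))).1 := by
  apply Subtype.ext
  change normalize _ = normalize _
  rw [sum_fin3 _ i, sum_fin3 _ j]
  simp only [simplexEdge_self, simplexEdge_one, simplexEdge_two, neg_neg, zero_smul, zero_add,
    h.vert_one, h.vert_two]
  congr 1
  rw [add_comm (Real.exp y), add_comm ((Real.exp y / _) • _)]

theorem triMap_edgePoint_opp (n : R.Tri) (i : Fin 3) (x : ℝ) :
    (triMap G n (edgePoint i x)).1 = (triMap G ((triang R).opp (n, i)).1
      (edgePoint ((triang R).opp (n, i)).2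
        (G.shift (n.nd.face, i) - G.scale (n.nd.face, i) * x))).1 := by
  have hg := glued_opp n i
  rw [triMap_apply, triMap_apply, simplexPt_edgePoint, simplexPt_edgePoint,
    triHomeo_simplexEdge_opp hg n.triple (Tri.triple _), ← hg.opp, slope_offset_opp]

theorem triMap_mem_carrier (n : R.Tri) (w : StdTriangle) : (triMap G n w).1 ∈ n.carrier :=
  (n.triple.mem_idealTriangle_iff _).1 (triMap G n w).2

theorem carrier_eq (n : R.Tri) : n.carrier = idealTriangle n.nd.vert := by
  ext x; exact (n.triple.mem_idealTriangle_iff x).symm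

theorem triMap_isClosedEmbedding (n : R.Tri) :
    IsClosedEmbedding fun w => (triMap G n w).1 := by
  have : IsClosed (idealTriangle n.nd.vert) := carrier_eq n ▸ isClosed_carrier n
  exact this.isClosedEmbedding_subtypeVal.comp (triMap G n).isClosedEmbedding

variable (R) in
/-- The hyperbolic plane as a gluing of ideal triangles by the homotheties of a surface. -/
def hypGluing [Finite T] : HomotheticGluing (triang R) HypPlane where
  chart n w := (triMap G n w).1
  scale q := G.scale (q.1.nd.face, q.2)
  shift q := G.shift (q.1.nd.face, q.2)
  scale_pos _ := G.scale_pos _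
  isQuotientMap := by
    -- The image of a closed set is a locally finite union of closed subsets of the triangles, and a
    -- continuous closed surjection is a quotient map.
    refine IsClosedMap.isQuotientMap (fun C hC => ?_)
      (continuous_sigma fun n => (triMap_isClosedEmbedding G n).continuous) fun x => ?_
    · have : (fun q : (Σ _ : R.Tri, StdTriangle) => (triMap G q.1 q.2).1) '' C =
          ⋃ n, (fun w => (triMap G n w).1) '' ((fun w => (⟨n, w⟩ : Σ _ : R.Tri, StdTriangle)) ⁻¹' C) := by
        ext x
        simp [Set.mem_iUnion]
      rw [this]
      refine (locallyFinite_carrier.subset fun n => ?_).isClosed_iUnion fun n => ?_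
      · rintro _ ⟨w, -, rfl⟩
        exact triMap_mem_carrier G n w
      · exact (triMap_isClosedEmbedding G n).isClosedMap _ (hC.preimage (continuous_sigmaMk (σ := fun _ : R.Tri => StdTriangle)))
    · obtain ⟨n, hn⟩ := exists_mem_carrier (R := R) x
      rw [carrier_eq] at hn
      obtain ⟨w, hw⟩ := (triMap G n).surjective ⟨x, hn⟩
      exact ⟨⟨n, w⟩, congrArg Subtype.val hw⟩
  chart_eq_iff n w m w' := by
    constructor
    · intro h
      have hn := triMap_mem_carrier G n w
      have hm := triMap_mem_carrier G m w'
      rw [← h] at hm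
      rcases carrier_overlap hn hm with rfl | ⟨i, rfl, hi⟩
      · exact .inl ⟨rfl, (triMap G n).injective (Subtype.ext h)⟩
      · rw [triMap_apply, coord_triHomeo_eq_zero_iff] at hi
        obtain ⟨x, rfl⟩ := exists_eq_edgePoint_of_simplexPt G hi
        refine .inr ⟨i, x, rfl, rfl, ?_⟩
        rw [triMap_edgePoint_opp] at h
        exact (triMap G _).injective (Subtype.ext h.symm)
    · rintro (⟨rfl, rfl⟩ | ⟨i, x, rfl, rfl, rfl⟩)
      · rfl
      · exact triMap_edgePoint_opp G n i x

theorem face_surjective : Function.Surjective fun n : R.Tri => n.nd.face := by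
  intro t
  have h := Δ.connected (Tri.root : R.Tri).nd.face t
  induction h with
  | refl => exact ⟨_, rfl⟩
  | tail _ hbc ih =>
    obtain ⟨n, rfl⟩ := ih
    obtain ⟨i, rfl⟩ := hbc
    exact ⟨((triang R).opp (n, i)).1, by dsimp only; rw [(glued_opp n i).opp]⟩

variable (R) in
/-- The hyperbolic plane covers the surface. -/
theorem exists_hyp_covering [Finite T] : ∃ q : HypPlane → F,
    (∀ (n : R.Tri) w, q (triMap G n w).1 = G.chart n.nd.face w) ∧
    IsCoveringMap q ∧ Function.Surjective q :=
  exists_isCoveringMap (G' := hypGluing R G) (G := G) (φ := fun n : R.Tri => n.nd.face)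
    face_surjective (fun n i => (glued_opp n i).opp) (fun _ _ => rfl) fun _ _ => rfl

end DevData

/-! ## Simply connected coverings -/

/-- The vertical projection of the hyperboloid to the plane. -/
def hypHomeo : HypPlane ≃ₜ ℝ × ℝ where
  toFun x := (x.1 0, x.1 1)
  invFun y := ⟨![y.1, y.2, √(1 + y.1 ^ 2 + y.2 ^ 2)], by
    have h : √(1 + y.1 ^ 2 + y.2 ^ 2) ^ 2 = 1 + y.1 ^ 2 + y.2 ^ 2 := Real.sq_sqrt (by positivity)
    refine ⟨?_, ?_⟩
    · simp only [form, Matrix.cons_val]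
      linarith
    · simp only [Matrix.cons_val]
      positivity⟩
  left_inv x := by
    apply Subtype.ext
    have h1 := x.2.1
    simp only [form] at h1
    have h : √(1 + x.1 0 ^ 2 + x.1 1 ^ 2) = x.1 2 := by
      rw [show 1 + x.1 0 ^ 2 + x.1 1 ^ 2 = x.1 2 ^ 2 by linarith, Real.sqrt_sq x.2.2.le]
    funext k
    fin_cases k
    · rfl
    · rfl
    · exact h
  right_inv y := rfl
  continuous_toFun := by
    have := fun k : Fin 3 => (continuous_apply k).comp
      (continuous_subtype_val : Continuous fun x : HypPlane => x.1)
    exact (this 0).prodMk (this 1)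
  continuous_invFun := by
    refine Continuous.subtype_mk (continuous_pi fun k => ?_) _
    fin_cases k
    · exact continuous_fst
    · exact continuous_snd
    · change Continuous fun y : ℝ × ℝ => √(1 + y.1 ^ 2 + y.2 ^ 2)
      fun_prop

instance : ContractibleSpace HypPlane := hypHomeo.contractibleSpace

instance : LocallyPathConnectedSpace HypPlane := hypHomeo.isOpenEmbedding.locallyPathConnectedSpace

theorem IsLocalHomeomorph.locallyPathConnectedSpace {X Y : Type*} [TopologicalSpace X]
    [TopologicalSpace Y] [LocallyPathConnectedSpace Y] {f : X → Y} (hf : IsLocalHomeomorph f) :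
    LocallyPathConnectedSpace X := by
  choose e he _ using hf
  let _ : ChartedSpace Y X :=
    { atlas := Set.range e
      chartAt := e
      mem_chart_source := he
      chart_mem_atlas := Set.mem_range_self }
  exact ChartedSpace.locallyPathConnectedSpace Y X

/-- Simply connected coverings are unique. -/
theorem exists_homeomorph_of_coverings {E X F : Type*} [TopologicalSpace E] [TopologicalSpace X]
    [TopologicalSpace F] [SimplyConnectedSpace E] [SimplyConnectedSpace X]
    [LocallyPathConnectedSpace X] {p : E → F} {q : X → F} (hp : IsCoveringMap p)
    (hq : IsCoveringMap q) (hqs : Function.Surjective q) {e₀ : E} {x₀ : X} (h₀ : p e₀ = q x₀) :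
    ∃ D : E ≃ₜ X, (∀ e, q (D e) = p e) ∧ D e₀ = x₀ := by
  -- The lifting criterion needs local path connectedness, which passes from `X` to its quotient `F`
  -- and back to `E` through the local homeomorphism `p`.
  have : LocallyPathConnectedSpace F := (hq.isQuotientMap hqs).locallyPathConnectedSpace
  have : LocallyPathConnectedSpace E :=
    IsLocalHomeomorph.locallyPathConnectedSpace hp.isLocalHomeomorph
  obtain ⟨f, ⟨hf0, hf⟩, -⟩ :=
    hq.existsUnique_continuousMap_lifts ⟨p, hp.continuous⟩ e₀ x₀ h₀.symm
  obtain ⟨g, ⟨hg0, hg⟩, -⟩ :=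
    hp.existsUnique_continuousMap_lifts ⟨q, hq.continuous⟩ x₀ e₀ h₀
  have hgf : g ∘ f = id := hp.eq_of_comp_eq (g.continuous.comp f.continuous) continuous_id
    (by rw [← Function.comp_assoc, hg]; exact hf) e₀ (by simp [hf0, hg0])
  have hfg : f ∘ g = id := hq.eq_of_comp_eq (f.continuous.comp g.continuous) continuous_id
    (by rw [← Function.comp_assoc, hf]; exact hg) x₀ (by simp [hf0, hg0])
  exact ⟨⟨⟨f, g, congrFun hgf, congrFun hfg⟩, f.continuous, g.continuous⟩, congrFun hf, hf0⟩

end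

noncomputable section

/-! ## Cocycles over the punctures -/

/-- A map over a permutation of a finite set has an equivariant section, as soon as there is one
periodic sequence over each cycle. -/
theorem exists_equivariant {X Y : Type*} [Finite X] {f : X → X} (hf : Function.Injective f)
    (A : X → Y → Y) (P : Y → Prop)
    (h : ∀ r n, f^[n] r = r → ∃ y : ℕ → Y, (∀ k, y (k + 1) = A (f^[k] r) (y k)) ∧
      y n = y 0 ∧ ∀ k < n, P (y k)) :
    ∃ g : X → Y, (∀ s, g (f s) = A s (g s)) ∧ ∀ s, P (g s) := by
  have hb : Function.Bijective f := ⟨hf, Finite.surjective_of_injective hf⟩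
  let σ : Equiv.Perm X := Equiv.ofBijective f hb
  have hσ : ∀ k s, (σ ^ k) s = f^[k] s := fun k s => by rw [Equiv.Perm.coe_pow]; rfl
  -- One representative is fixed on each cycle, and every other value is transported from it along
  -- the cycle.
  let rep : X → X := fun s => @Quotient.out _ (Equiv.Perm.SameCycle.setoid σ)
    (@Quotient.mk _ (Equiv.Perm.SameCycle.setoid σ) s)
  have hrep : ∀ s, ∃ k, f^[k] (rep s) = s := fun s => by
    have : σ.SameCycle (rep s) s := @Quotient.mk_out _ (Equiv.Perm.SameCycle.setoid σ) s
    obtain ⟨k, hk⟩ := this.exists_nat_pow_eq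
    exact ⟨k, by rw [← hσ]; exact hk⟩
  have hrepf : ∀ s, rep (f s) = rep s := fun s => by
    have : @Quotient.mk _ (Equiv.Perm.SameCycle.setoid σ) (f s) =
        @Quotient.mk _ (Equiv.Perm.SameCycle.setoid σ) s :=
      @Quotient.sound _ (Equiv.Perm.SameCycle.setoid σ) _ _
        (Equiv.Perm.sameCycle_apply_left.2 (Equiv.Perm.SameCycle.refl σ s))
    simp only [rep, this]
  have hper : ∀ r, 0 < Function.minimalPeriod f r := fun r => by
    obtain ⟨i, hi, -, hr⟩ := (Equiv.Perm.SameCycle.refl σ r).exists_pow_eq''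
    exact Function.IsPeriodicPt.minimalPeriod_pos hi (by
      rw [Function.IsPeriodicPt, Function.IsFixedPt, ← hσ, hr])
  choose y hy hy0 hyP using fun r => h r _ (Function.iterate_minimalPeriod (f := f) (x := r))
  choose k hk using hrep
  have hperiod : ∀ r j, y r (j + Function.minimalPeriod f r) = y r j := fun r j => by
    induction j with
    | zero => rw [zero_add, hy0]
    | succ j ih =>
      rw [add_right_comm, hy, hy, ih, Function.iterate_add_apply, Function.iterate_minimalPeriod]
  have hmod : ∀ r j, y r (j % Function.minimalPeriod f r) = y r j := fun r j => by
    conv_rhs => rw [← Nat.mod_add_div j (Function.minimalPeriod f r)]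
    generalize j / Function.minimalPeriod f r = a
    induction a with
    | zero => simp
    | succ a ih => rw [Nat.mul_succ, ← add_assoc, hperiod, ih]
  -- The sequence closes up after one period, so its value depends only on the point reached, not on
  -- the number of steps.
  have huniq : ∀ r i j, f^[i] r = f^[j] r → y r i = y r j := fun r i j hij => by
    rw [← hmod r i, ← hmod r j]
    rw [← Function.iterate_mod_minimalPeriod_eq (n := i),
      ← Function.iterate_mod_minimalPeriod_eq (n := j),
      Function.iterate_eq_iterate_iff_of_lt_minimalPeriod (Nat.mod_lt _ (hper r))
        (Nat.mod_lt _ (hper r))] at hij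
    rw [hij]
  refine ⟨fun s => y (rep s) (k s), fun s => ?_, fun s => ?_⟩
  · have h1 : y (rep s) (k (f s)) = y (rep s) (k s + 1) := huniq _ _ _ (by
      have := hk (f s)
      rw [hrepf] at this
      rw [this, Function.iterate_succ_apply', hk])
    dsimp only
    rw [hrepf, h1, hy, hk]
  · dsimp only
    rw [← hmod]
    exact hyP _ _ (Nat.mod_lt _ (hper _))

theorem IdealTriangulation.next_injective {T : Type*} (Δ : IdealTriangulation T) :
    Function.Injective Δ.next := by
  intro s s' h
  rw [next, next, Prod.mk.injEq] at h
  have h1 : Δ.opp (exitEdge s) = Δ.opp (exitEdge s') := Prod.ext h.1 (add_right_cancel h.2)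
  have h2 := congrArg Δ.opp h1
  rw [Δ.opp_opp, Δ.opp_opp, exitEdge, exitEdge, Prod.mk.injEq] at h2
  exact Prod.ext h2.1 (add_right_cancel h2.2)

variable {T : Type*} {Δ : IdealTriangulation T} {F : Type*} [TopologicalSpace F]

theorem HomotheticGluing.tendsto_leafDepth (G : HomotheticGluing Δ F) (s : T × Fin 3) (k : ℕ) :
    Tendsto (fun x => G.leafDepth s x k) atTop atTop := by
  induction k with
  | zero => exact tendsto_id
  | succ k ih =>
    exact tendsto_atTop_add_const_right _ _ (ih.const_mul_atTop (G.scale_pos _))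

theorem BrokenHyperbolicStructure.nonempty_decoration [Finite T]
    (H : BrokenHyperbolicStructure Δ F) : Nonempty (Decoration H) := by
  obtain ⟨g, hg, hg0⟩ := exists_equivariant Δ.next_injective
    (fun s x => H.scale (exitEdge s) * x - H.shift (exitEdge s)) (fun x : ℝ => 0 ≤ x)
    fun r n hn => by
      -- A leaf that starts deep enough stays in the foliated parts of all sectors of one turn, and
      -- by completeness it also closes up.
      have h1 : ∀ᶠ x in atTop, ∀ k < n, 0 ≤ H.leafDepth r x k :=
        (Filter.eventually_all_finite (Set.finite_lt_nat n)).2 fun k _ => (H.tendsto_leafDepth r k).eventually_ge_atTop 0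
      obtain ⟨x, hx1, hx2⟩ := (h1.and (H.complete r n hn)).exists
      exact ⟨H.leafDepth r x, fun k => rfl, hx2, hx1⟩
  exact ⟨⟨g, hg0, hg⟩⟩

/-- Scaling factors of the sectors which trivialize a power of the scaling factors of the edges. -/
theorem BrokenHyperbolicStructure.exists_sectorScale [Finite T]
    (H : BrokenHyperbolicStructure Δ F) (e : ℤ) : ∃ ρ : T × Fin 3 → ℝ, (∀ s, 0 < ρ s) ∧
      ∀ s, ρ (Δ.next s) = H.scale (exitEdge s) ^ e * ρ s := by
  obtain ⟨g, hg, hg0⟩ := exists_equivariant Δ.next_injective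
    (fun s x => H.scale (exitEdge s) ^ e * x) (fun x : ℝ => 0 < x)
    fun r n hn => by
      -- Partial products of the factors solve the recursion from the value one. Trivial holonomy
      -- makes them close up.
      refine ⟨fun k => (∏ j ∈ Finset.range k, H.scale (exitEdge (Δ.next^[j] r))) ^ e,
        fun k => ?_, ?_, fun k _ => ?_⟩
      · dsimp only
        rw [Finset.prod_range_succ, mul_zpow, mul_comm]
      · dsimp only
        rw [H.no_horocyclic_holonomy r n hn, Finset.prod_range_zero]
      · exact zpow_pos (Finset.prod_pos fun j _ => H.scale_pos _) _
  exact ⟨g, hg0, hg⟩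

/-- The scaling factors of the two sectors at the end `i + 2` of the edge `i`. -/
theorem BrokenHyperbolicStructure.sectorScale_opp {H : BrokenHyperbolicStructure Δ F} {e : ℤ}
    {ρ : T × Fin 3 → ℝ} (hρ : ∀ s, ρ (Δ.next s) = H.scale (exitEdge s) ^ e * ρ s) (q : T × Fin 3) :
    ρ ((Δ.opp q).1, (Δ.opp q).2 + 1) = H.scale q ^ e * ρ (q.1, q.2 + 2) := by
  have h := hρ (q.1, q.2 + 2)
  rw [IdealTriangulation.next, exitEdge] at h
  simpa [add_assoc] using h

theorem BrokenHyperbolicStructure.sectorScale_opp' {H : BrokenHyperbolicStructure Δ F} {e : ℤ}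
    {ρ : T × Fin 3 → ℝ} (hρ : ∀ s, ρ (Δ.next s) = H.scale (exitEdge s) ^ e * ρ s) (q : T × Fin 3) :
    ρ ((Δ.opp q).1, (Δ.opp q).2 + 2) = H.scale q ^ e * ρ (q.1, q.2 + 1) := by
  have h := sectorScale_opp hρ (Δ.opp q)
  rw [Δ.opp_opp, H.scale_opp, inv_zpow] at h
  rw [h, mul_inv_cancel_left₀ (zpow_pos (H.scale_pos q) _).ne']

theorem Decoration.lam_pos {H : BrokenHyperbolicStructure Δ F} (d : Decoration H)
    (q : T × Fin 3) : 0 < d.lam q := Real.sqrt_pos.2 (by positivity)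

end

noncomputable section

/-! ## Rescaled vertices -/

theorem LightCone.smul {u : Fin 3 → ℝ} (hu : u ∈ LightCone) {c : ℝ} (hc : 0 < c) :
    c • u ∈ LightCone :=
  ⟨by rw [form_smul_left, form_smul_right, hu.1, mul_zero, mul_zero], mul_pos hc hu.2⟩

theorem minkLambda_sq {u v : Fin 3 → ℝ} (hu : u ∈ LightCone) (hv : v ∈ LightCone) :
    minkLambda u v ^ 2 = -form u v :=
  Real.sq_sqrt (neg_nonneg.2 (form_nonpos_of_causal hu.1.le hu.2 hv.1.le hv.2))

theorem gram_smul (u : Fin 3 → Fin 3 → ℝ) (s : Fin 3 → ℝ) (k : Fin 3) :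
    gram (fun k => s k • u k) k = s (k + 1) * s (k + 2) * gram u k := by
  simp only [gram, form_smul_left, form_smul_right]
  ring

theorem orient_smul (u : Fin 3 → Fin 3 → ℝ) (s : Fin 3 → ℝ) :
    orient (fun k => s k • u k) = s 0 * s 1 * s 2 * orient u := by
  simp only [orient, det_vec, Pi.smul_apply, smul_eq_mul]
  ring

theorem IsConeTriple.smul {u : Fin 3 → Fin 3 → ℝ} (hu : IsConeTriple u) {s : Fin 3 → ℝ}
    (hs : ∀ k, 0 < s k) : IsConeTriple fun k => s k • u k := by
  refine .of_orient (fun k => LightCone.smul (hu.mem k) (hs k)) ?_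
  rw [orient_smul]
  exact mul_ne_zero (mul_pos (mul_pos (hs 0) (hs 1)) (hs 2)).ne' hu.orient_ne

theorem idealEdge_smul (u : Fin 3 → Fin 3 → ℝ) {s : Fin 3 → ℝ} (hs : ∀ k, 0 < s k) (i : Fin 3) :
    idealEdge (fun k => s k • u k) i = idealEdge u i := by
  ext x
  constructor
  · rintro ⟨a, ha, hi, h⟩
    refine ⟨fun k => a k * s k, fun k => mul_nonneg (ha k) (hs k).le, by simp [hi], ?_⟩
    simp only [h, mul_smul]
  · rintro ⟨a, ha, hi, h⟩
    refine ⟨fun k => a k / s k, fun k => div_nonneg (ha k) (hs k).le, by simp [hi], ?_⟩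
    simp only [h, smul_smul, div_mul_cancel₀ _ (hs _).ne']

theorem idealTriangle_smul (u : Fin 3 → Fin 3 → ℝ) {s : Fin 3 → ℝ} (hs : ∀ k, 0 < s k) :
    idealTriangle (fun k => s k • u k) = idealTriangle u := by
  ext x
  constructor
  · rintro ⟨a, ha, h⟩
    refine ⟨fun k => a k * s k, fun k => mul_nonneg (ha k) (hs k).le, ?_⟩
    simp only [h, mul_smul]
  · rintro ⟨a, ha, h⟩
    refine ⟨fun k => a k / s k, fun k => div_nonneg (ha k) (hs k).le, ?_⟩
    simp only [h, smul_smul, div_mul_cancel₀ _ (hs _).ne']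

variable {T : Type*} {Δ : IdealTriangulation T} {F : Type*} [TopologicalSpace F]
  {H : BrokenHyperbolicStructure Δ F} {E : Type*} [TopologicalSpace E] {p : E → F}

/-! ## The developed triangles -/

theorem IsBaseLift.triple {d : Decoration H} {L₀ : LiftedFace H p} {u₀ : Fin 3 → Fin 3 → ℝ}
    (h : IsBaseLift d L₀ u₀) : IsConeTriple u₀ :=
  .of_orient h.1 ((linearIndependent_iff_orient u₀).1 h.2.1)

theorem IsBaseLift.gram_eq {d : Decoration H} {L₀ : LiftedFace H p} {u₀ : Fin 3 → Fin 3 → ℝ}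
    (h : IsBaseLift d L₀ u₀) (i : Fin 3) : gram u₀ i = d.lam (L₀.face, i) ^ 2 := by
  rw [← h.2.2 i, minkLambda_sq (h.1 _) (h.1 _), gram]

/-- Rescaling the vertices of the developed triangles by the factors of the sectors makes their
products bounded. -/
def devData (d : Decoration H) {ρ : T × Fin 3 → ℝ} (hρ : ∀ s, 0 < ρ s) {L₀ : LiftedFace H p}
    {u₀ : Fin 3 → Fin 3 → ℝ} (hb : IsBaseLift d L₀ u₀) : DevData Δ where
  face := L₀.face
  vert k := ρ (L₀.face, k) • u₀ k
  weight q := ρ (q.1, q.2 + 1) * ρ (q.1, q.2 + 2) * d.lam q ^ 2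
  triple := hb.triple.smul fun k => hρ _
  weight_pos q := mul_pos (mul_pos (hρ _) (hρ _)) (pow_pos (d.lam_pos q) 2)
  gram_vert i := by rw [gram_smul, hb.gram_eq]

namespace DevData

/-- The accumulated factor. -/
def factor (R : DevData Δ) (H : BrokenHyperbolicStructure Δ F) (e : ℤ) : List (Fin 3) → ℝ
  | [] => 1
  | i :: l => factor R H e l * H.scale ((R.node l).face, i) ^ e

theorem factor_pos (R : DevData Δ) (H : BrokenHyperbolicStructure Δ F) (e : ℤ)
    (l : List (Fin 3)) : 0 < R.factor H e l := by
  induction l with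
  | nil => exact one_pos
  | cons i l ih => exact mul_pos ih (zpow_pos (H.scale_pos _) _)

/-- The lifts of the vertices of the developed triangles. -/
def devVert (R : DevData Δ) (H : BrokenHyperbolicStructure Δ F) (ρ : T × Fin 3 → ℝ) (e : ℤ)
    (l : List (Fin 3)) (k : Fin 3) : Fin 3 → ℝ :=
  (R.factor H e l / ρ ((R.node l).face, k)) • (R.node l).vert k

section

variable (R : DevData Δ) {ρ : T × Fin 3 → ℝ} (hρ : ∀ s, 0 < ρ s) {e : ℤ}
include hρ

theorem devVert_scale_pos (l : List (Fin 3)) (k : Fin 3) :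
    0 < R.factor H e l / ρ ((R.node l).face, k) := div_pos (factor_pos _ _ _ _) (hρ _)

theorem devVert_triple (l : List (Fin 3)) : IsConeTriple (R.devVert H ρ e l) :=
  (R.triple_node l).smul (devVert_scale_pos R hρ l)

theorem idealTriangle_devVert (l : List (Fin 3)) :
    idealTriangle (R.devVert H ρ e l) = idealTriangle (R.node l).vert :=
  idealTriangle_smul _ (devVert_scale_pos R hρ l)

theorem idealEdge_devVert (l : List (Fin 3)) (i : Fin 3) :
    idealEdge (R.devVert H ρ e l) i = idealEdge (R.node l).vert i :=
  idealEdge_smul _ (devVert_scale_pos R hρ l) i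

variable (hρ' : ∀ s, ρ (Δ.next s) = H.scale (exitEdge s) ^ e * ρ s)
include hρ'

/-- Crossing an edge multiplies the accumulated factor and `ρ` by the same `σ ^ e`, so the
coefficient of a shared vertex does not change. -/
theorem devVert_cons_one (i : Fin 3) (l : List (Fin 3)) :
    R.devVert H ρ e (i :: l) ((Δ.opp ((R.node l).face, i)).2 + 1) = R.devVert H ρ e l (i + 2) := by
  have h := BrokenHyperbolicStructure.sectorScale_opp hρ' ((R.node l).face, i)
  have hs : (R.node (i :: l)).face = (Δ.opp ((R.node l).face, i)).1 := rfl
  have hz := zpow_pos (H.scale_pos ((R.node l).face, i)) e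
  rw [devVert, devVert, (R.glued_cons i l).vert_one, hs, h, factor]
  congr 1
  have := hρ ((R.node l).face, i + 2)
  field_simp

theorem devVert_cons_two (i : Fin 3) (l : List (Fin 3)) :
    R.devVert H ρ e (i :: l) ((Δ.opp ((R.node l).face, i)).2 + 2) = R.devVert H ρ e l (i + 1) := by
  have h := BrokenHyperbolicStructure.sectorScale_opp' hρ' ((R.node l).face, i)
  have hs : (R.node (i :: l)).face = (Δ.opp ((R.node l).face, i)).1 := rfl
  have hz := zpow_pos (H.scale_pos ((R.node l).face, i)) e
  rw [devVert, devVert, (R.glued_cons i l).vert_two, hs, h, factor]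
  congr 1
  have := hρ ((R.node l).face, i + 1)
  field_simp

theorem oppositeSides_devVert (i : Fin 3) (l : List (Fin 3)) :
    OppositeSides (R.devVert H ρ e l (i + 1)) (R.devVert H ρ e l (i + 2)) (R.devVert H ρ e l i)
      (R.devVert H ρ e (i :: l) (Δ.opp ((R.node l).face, i)).2) := by
  have hor : 0 < orient (R.devVert H ρ e l) * orient (R.devVert H ρ e (i :: l)) := by
    have h1 := devVert_scale_pos (H := H) (e := e) R hρ l
    have h2 := devVert_scale_pos (H := H) (e := e) R hρ (i :: l)
    have h3 := mul_pos (mul_pos (h1 0) (h1 1)) (h1 2)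
    have h4 := mul_pos (mul_pos (h2 0) (h2 1)) (h2 2)
    have h5 := mul_pos (mul_pos h3 h4) (R.glued_cons i l).orient
    have e1 := orient_smul (R.node l).vert fun k => R.factor H e l / ρ ((R.node l).face, k)
    have e2 := orient_smul (R.node (i :: l)).vert
      fun k => R.factor H e (i :: l) / ρ ((R.node (i :: l)).face, k)
    calc _ < _ := h5
      _ = _ := mul_mul_mul_comm _ _ _ _
      _ = _ := congrArg₂ _ e1.symm e2.symm
  rw [OppositeSides, det_eq_orient, ← devVert_cons_one R hρ hρ', ← devVert_cons_two R hρ hρ',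
    det_swap, det_eq_orient]
  linarith

end

end DevData

section

variable (d : Decoration H) {ρ : T × Fin 3 → ℝ} (hρ : ∀ s, 0 < ρ s) {L₀ : LiftedFace H p}
  {u₀ : Fin 3 → Fin 3 → ℝ} (hb : IsBaseLift d L₀ u₀) {e : ℤ}

theorem devVert_nil : (devData d hρ hb).devVert H ρ e [] = u₀ := by
  funext k
  change (1 / ρ (L₀.face, k)) • ρ (L₀.face, k) • u₀ k = u₀ k
  rw [smul_smul, one_div_mul_cancel (hρ _).ne', one_smul]

/-- The two values of `ρ` contained in the weight cancel against the rescaling, which leaves the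
λ-length times the accumulated factor. An entry edge has its product from the previous triangle
instead. -/
theorem gram_devVert {l : List (Fin 3)} {k : Fin 3}
    (hk : ((devData d hρ hb).node l).entry ≠ some k) :
    gram ((devData d hρ hb).devVert H ρ e l) k =
      ((devData d hρ hb).factor H e l * d.lam (((devData d hρ hb).node l).face, k)) ^ 2 := by
  change gram (fun k => ((devData d hρ hb).factor H e l /
    ρ (((devData d hρ hb).node l).face, k)) • ((devData d hρ hb).node l).vert k) k = _
  rw [gram_smul, (devData d hρ hb).gram_node l k hk]
  change _ * (ρ (_, k + 1) * ρ (_, k + 2) * d.lam (_, k) ^ 2) = _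
  have h1 := hρ (((devData d hρ hb).node l).face, k + 1)
  have h2 := hρ (((devData d hρ hb).node l).face, k + 2)
  field_simp

theorem minkLambda_devVert_one {l : List (Fin 3)} {j : Fin 3}
    (hj : ((devData d hρ hb).node l).entry = some j) :
    minkLambda ((devData d hρ hb).devVert H ρ e l j) ((devData d hρ hb).devVert H ρ e l (j + 1)) =
      (devData d hρ hb).factor H e l * d.lam (((devData d hρ hb).node l).face, j + 2) := by
  have h := gram_devVert (e := e) d hρ hb (l := l) (k := j + 2) (by
    rw [hj]; simp)
  rw [gram_add_two] at h
  rw [minkLambda, h, Real.sqrt_sq (mul_nonneg (DevData.factor_pos _ _ _ _).le (d.lam_pos _).le)]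

theorem minkLambda_devVert_two {l : List (Fin 3)} {j : Fin 3}
    (hj : ((devData d hρ hb).node l).entry = some j) :
    minkLambda ((devData d hρ hb).devVert H ρ e l j) ((devData d hρ hb).devVert H ρ e l (j + 2)) =
      (devData d hρ hb).factor H e l * d.lam (((devData d hρ hb).node l).face, j + 1) := by
  have h := gram_devVert (e := e) d hρ hb (l := l) (k := j + 1) (by
    rw [hj]; simp)
  rw [gram_add_one, form_comm] at h
  rw [minkLambda, h, Real.sqrt_sq (mul_nonneg (DevData.factor_pos _ _ _ _).le (d.lam_pos _).le)]

end

/-- The decorated triangle on the other side of an edge is determined by its λ-lengths. -/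
theorem eq_of_minkLambda {u v v' : Fin 3 → Fin 3 → ℝ} (hu : IsConeTriple u) {i j : Fin 3}
    (h1 : v (j + 1) = u (i + 2)) (h2 : v (j + 2) = u (i + 1)) (h1' : v' (j + 1) = u (i + 2))
    (h2' : v' (j + 2) = u (i + 1)) (hc : v j ∈ LightCone) (hc' : v' j ∈ LightCone)
    (ho : OppositeSides (u (i + 1)) (u (i + 2)) (u i) (v j))
    (ho' : OppositeSides (u (i + 1)) (u (i + 2)) (u i) (v' j))
    (hl1 : minkLambda (v j) (v (j + 1)) = minkLambda (v' j) (v' (j + 1)))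
    (hl2 : minkLambda (v j) (v (j + 2)) = minkLambda (v' j) (v' (j + 2))) : v = v' := by
  have key : ∀ w, w ∈ LightCone → minkLambda (v j) w = minkLambda (v' j) w →
      form (v j) w = form (v' j) w := fun w hw h => by
    have := congrArg (· ^ 2) h
    simp only [minkLambda_sq hc hw, minkLambda_sq hc' hw] at this
    linarith
  rw [h1, h1'] at hl1
  rw [h2, h2'] at hl2
  have h0 : v j = v' j := by
    refine eq_of_form_eq (hu.mem (i + 1)) (hu.mem (i + 2)) ?_ hc.1 hc'.1
      (key _ (hu.mem _) hl2) (key _ (hu.mem _) hl1) ?_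
    · have := hu.gram_pos i
      rw [gram] at this
      linarith
    · rw [OppositeSides] at ho ho'
      exact pos_of_mul_pos_right (a := Matrix.det ![u (i + 1), u (i + 2), u i] ^ 2)
        (by nlinarith [mul_pos_of_neg_of_neg ho ho']) (sq_nonneg _)
  exact ext_fin3 j h0 (h1.trans h1'.symm) (h2.trans h2'.symm)

end

noncomputable section

/-! ## Lifted faces -/

variable {T : Type*} {Δ : IdealTriangulation T} {F : Type*} [TopologicalSpace F]
  {H : BrokenHyperbolicStructure Δ F} {E : Type*} [TopologicalSpace E] {p : E → F}

theorem LiftedFace.ext' {L L' : LiftedFace H p} (hf : L.face = L'.face) (hl : L.lift = L'.lift) :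
    L = L' := by
  cases L; cases L'
  cases hf; cases hl
  rfl

/-- The standard triangle is connected, so two lifts of one chart which agree at a point are equal.
-/
theorem LiftedFace.eq_of_lift_eq (hp : IsCoveringMap p) {L L' : LiftedFace H p}
    (hf : L.face = L'.face) (w : StdTriangle) (hw : L.lift w = L'.lift w) : L = L' :=
  LiftedFace.ext' hf <| hp.eq_of_comp_eq L.continuous_lift L'.continuous_lift
    (funext fun w => by simp only [Function.comp_apply, L.proj_lift, L'.proj_lift, hf]) w hw

theorem exists_mem_stdInterior : ∃ w : StdTriangle, w ∈ stdInterior := by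
  have ha : IsConePt fun _ : Fin 3 => (1 : ℝ) := ⟨fun _ => zero_le_one, fun _ => by norm_num⟩
  obtain ⟨c, hc, h⟩ := stdTriple.exists_coord_pt _ ha
  refine ⟨⟨stdTriple.pt _ ha, stdTriple.pt_mem _ ha⟩, fun k => ?_⟩
  rw [h]
  simpa using hc

/-- A point in the interior of the standard triangle. -/
def stdCenter : StdTriangle := exists_mem_stdInterior.choose

theorem stdCenter_ne (i : Fin 3) (x : ℝ) : stdCenter ≠ edgePoint i x := fun h =>
  edgePoint_notMem_stdInterior i x (h ▸ exists_mem_stdInterior.choose_spec)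

namespace DevData

variable {R : DevData Δ} (hp : IsCoveringMap p) {q : HypPlane → F}
  (hq : ∀ (n : R.Tri) w, q (triMap H.toHomotheticGluing n w).1 = H.chart n.nd.face w)
  {D : E ≃ₜ HypPlane} (hD : ∀ x, q (D x) = p x)

/-- The lifted face which corresponds to a triangle. -/
def liftedFace (n : R.Tri) : LiftedFace H p where
  face := n.nd.face
  lift w := D.symm (triMap H.toHomotheticGluing n w).1
  continuous_lift := D.symm.continuous.comp
    (continuous_subtype_val.comp (triMap H.toHomotheticGluing n).continuous)
  proj_lift w := by rw [← hD, D.apply_symm_apply, hq]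

theorem liftedFace_lift (n : R.Tri) (w : StdTriangle) :
    D ((liftedFace hq hD n).lift w) = (triMap H.toHomotheticGluing n w).1 := D.apply_symm_apply _

theorem adjacentAcross_nbr (n : R.Tri) (i : Fin 3) :
    AdjacentAcross (liftedFace hq hD n) i (liftedFace hq hD (nbr (n, i)).1) := by
  have hg := (nbr_spec n i).1.opp
  refine ⟨congrArg Prod.fst hg, fun x => D.injective ?_⟩
  rw [liftedFace_lift, liftedFace_lift, triMap_edgePoint_opp]
  exact congrArg (fun j => (triMap H.toHomotheticGluing (nbr (n, i)).1
    (edgePoint j (H.shift (n.nd.face, i) - H.scale (n.nd.face, i) * x))).1)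
      (congrArg Prod.snd hg).symm

include hp in
-- Two faces adjacent across the same edge lift the same chart and agree at a point of that edge.
theorem eq_nbr_of_adjacentAcross {n : R.Tri} {i : Fin 3} {L : LiftedFace H p}
    (h : AdjacentAcross (liftedFace hq hD n) i L) : L = liftedFace hq hD (nbr (n, i)).1 := by
  have h' := adjacentAcross_nbr hq hD n i
  exact LiftedFace.eq_of_lift_eq hp (h.1.symm.trans h'.1) _ ((h.2 0).symm.trans (h'.2 0))

variable [Finite T]

theorem triMap_eq_iff (n : R.Tri) (w : StdTriangle) (m : R.Tri) (w' : StdTriangle) :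
    (triMap H.toHomotheticGluing n w).1 = (triMap H.toHomotheticGluing m w').1 ↔
    (n = m ∧ w = w') ∨ ∃ i x, w = edgePoint i x ∧ m = (nbr (n, i)).1 ∧
      w' = edgePoint (nbr (n, i)).2 (H.shift (n.nd.face, i) - H.scale (n.nd.face, i) * x) :=
  (hypGluing R H.toHomotheticGluing).chart_eq_iff n w m w'

theorem liftedFace_injective : Function.Injective (liftedFace hq hD : R.Tri → LiftedFace H p) := by
  intro n m h
  have h1 : (triMap H.toHomotheticGluing n stdCenter).1 =
      (triMap H.toHomotheticGluing m stdCenter).1 := by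
    rw [← liftedFace_lift hq hD, ← liftedFace_lift hq hD, h]
  rcases (triMap_eq_iff n _ m _).1 h1 with h | ⟨i, x, h, -⟩
  · exact h.1
  · exact absurd h (stdCenter_ne i x)

include hp in
-- The center of `L` is carried into some triangle. Since it is on no edge, the gluing relation
-- forces the same face and the same point, and lifts agreeing there coincide.
theorem liftedFace_surjective :
    Function.Surjective (liftedFace hq hD : R.Tri → LiftedFace H p) := by
  intro L
  obtain ⟨n, hn⟩ := exists_mem_carrier (R := R) (D (L.lift stdCenter))
  rw [carrier_eq] at hn
  obtain ⟨w, hw⟩ := (triMap H.toHomotheticGluing n).surjective ⟨_, hn⟩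
  have hw1 : (triMap H.toHomotheticGluing n w).1 = D (L.lift stdCenter) := congrArg Subtype.val hw
  have h1 : H.chart L.face stdCenter = H.chart n.nd.face w := by
    rw [← L.proj_lift, ← hD, ← hw1, hq]
  rcases (H.chart_eq_iff _ _ _ _).1 h1 with ⟨h, rfl⟩ | ⟨i, x, h, -⟩
  · refine ⟨n, (LiftedFace.eq_of_lift_eq hp h stdCenter (D.injective ?_)).symm⟩
    rw [← hw1, liftedFace_lift]
  · exact absurd h (stdCenter_ne i x)

end DevData

/-! ## The construction -/

open DevData

section

variable (hp : IsCoveringMap p) {d : Decoration H} {ρ : T × Fin 3 → ℝ}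
  (hρ : ∀ s, 0 < ρ s) {L₀ : LiftedFace H p} {u₀ : Fin 3 → Fin 3 → ℝ} (hb : IsBaseLift d L₀ u₀)
  {e : ℤ} (hρ' : ∀ s, ρ (Δ.next s) = H.scale (exitEdge s) ^ e * ρ s) {q : HypPlane → F}
  (hq : ∀ (n : (devData d hρ hb).Tri) w,
    q (triMap H.toHomotheticGluing n w).1 = H.chart n.nd.face w)
  {D : E ≃ₜ HypPlane} (hD : ∀ x, q (D x) = p x)
  (h₀ : liftedFace hq hD Tri.root = L₀)
include h₀ hρ'

/-- Existence half of the construction: the rescaled development satisfies every condition of the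
inductive definition. -/
theorem developed_liftedFace (n : (devData d hρ hb).Tri) :
    Developed d e L₀ u₀ (liftedFace hq hD n) n.nd.entry ((devData d hρ hb).factor H e n.1)
      ((devData d hρ hb).devVert H ρ e n.1) := by
  obtain ⟨l, hl⟩ := n
  induction l with
  | nil =>
    have h : ∀ L, L = L₀ → Developed d e L₀ u₀ L none 1 u₀ := fun L h => by
      rw [h]
      exact .base
    rw [devVert_nil]
    exact h _ h₀
  | cons i l ih =>
    have hnbr : (nbr (⟨l, hl.1⟩, i)).1 = (⟨i :: l, hl⟩ : (devData d hρ hb).Tri) := by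
      rw [nbr_of_entry_ne ⟨l, hl.1⟩ hl.2]
    have hadj := adjacentAcross_nbr hq hD ⟨l, hl.1⟩ i
    rw [hnbr] at hadj
    exact .step _ _ _ _ i _ _ _ _ (ih hl.1) hl.2 hadj rfl rfl
      (devVert_cons_one _ hρ hρ' i l) (devVert_cons_two _ hρ hρ' i l)
      ((devVert_triple _ hρ _).mem _) (oppositeSides_devVert _ hρ hρ' i l)
      (minkLambda_devVert_one d hρ hb rfl) (minkLambda_devVert_two d hρ hb rfl)

section

variable [Finite T]

theorem developingImage_eq_univ : developingImage d e L₀ u₀ = Set.univ := by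
  refine Set.eq_univ_of_forall fun x => ?_
  obtain ⟨n, hn⟩ := exists_mem_carrier (R := devData d hρ hb) x
  rw [carrier_eq] at hn
  refine ⟨_, _, _, _, developed_liftedFace hρ hb hρ' hq hD h₀ n, ?_⟩
  rwa [idealTriangle_devVert _ hρ]

end

include hp

/-- Uniqueness half: in each step the adjacent lifted face is a neighbor in the tree and the third
vertex is forced by `eq_of_minkLambda`. -/
theorem eq_of_developed {L : LiftedFace H p} {o : Option (Fin 3)} {c : ℝ}
    {u : Fin 3 → Fin 3 → ℝ} (h : Developed d e L₀ u₀ L o c u) :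
    ∃ n : (devData d hρ hb).Tri, L = liftedFace hq hD n ∧ o = n.nd.entry ∧
      c = (devData d hρ hb).factor H e n.1 ∧ u = (devData d hρ hb).devVert H ρ e n.1 := by
  induction h with
  | base => exact ⟨Tri.root, h₀.symm, rfl, rfl, (devVert_nil d hρ hb).symm⟩
  | step L o c u i L' j c' u' _ ho hadj hj hc h1 h2 hcone hopp hl1 hl2 ih =>
    obtain ⟨n, rfl, rfl, rfl, rfl⟩ := ih
    obtain rfl := eq_nbr_of_adjacentAcross hp hq hD hadj
    rw [nbr_of_entry_ne n ho] at *
    subst hj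
    subst hc
    refine ⟨⟨i :: n.1, ⟨n.2, ho⟩⟩, rfl, rfl, rfl, ?_⟩
    refine eq_of_minkLambda (devVert_triple _ hρ n.1) h1 h2
      (devVert_cons_one _ hρ hρ' i n.1) (devVert_cons_two _ hρ hρ' i n.1) hcone
      ((devVert_triple _ hρ _).mem _) hopp (oppositeSides_devVert _ hρ hρ' i n.1) ?_ ?_
    · exact hl1.trans (minkLambda_devVert_one d hρ hb (l := i :: n.1) rfl).symm
    · exact hl2.trans (minkLambda_devVert_two d hρ hb (l := i :: n.1) rfl).symm

theorem image_of_developed {L : LiftedFace H p} {o : Option (Fin 3)} {c : ℝ}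
    {u : Fin 3 → Fin 3 → ℝ} (h : Developed d e L₀ u₀ L o c u) :
    D '' Set.range L.lift = idealTriangle u ∧
      ∀ i, D '' Set.range (fun x => L.lift (edgePoint i x)) = idealEdge u i := by
  obtain ⟨n, rfl, rfl, rfl, rfl⟩ := eq_of_developed hp hρ hb hρ' hq hD h₀ h
  rw [← Set.range_comp, idealTriangle_devVert _ hρ]
  constructor
  · ext x
    constructor
    · rintro ⟨w, rfl⟩
      rw [Function.comp_apply, liftedFace_lift]
      exact (triMap _ n w).2
    · intro hx
      obtain ⟨w, hw⟩ := (triMap H.toHomotheticGluing n).surjective ⟨x, hx⟩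
      exact ⟨w, by rw [Function.comp_apply, liftedFace_lift, hw]⟩
  · intro i
    rw [← Set.range_comp, idealEdge_devVert _ hρ]
    ext x
    refine Iff.trans ?_ (n.triple.mem_idealEdge_iff x i).symm
    constructor
    · rintro ⟨y, rfl⟩
      dsimp only [Function.comp_apply]
      rw [liftedFace_lift]
      refine ⟨triMap_mem_carrier _ n _, ?_⟩
      rw [triMap_apply, coord_triHomeo_eq_zero_iff, simplexPt_edgePoint, simplexEdge_self]
    · rintro ⟨hx, hi⟩
      obtain ⟨w, hw⟩ := (triMap H.toHomotheticGluing n).surjective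
        ⟨x, (n.triple.mem_idealTriangle_iff x).2 hx⟩
      have hw' : (triMap H.toHomotheticGluing n w).1 = x := congrArg Subtype.val hw
      rw [← hw', triMap_apply, coord_triHomeo_eq_zero_iff] at hi
      obtain ⟨y, rfl⟩ := exists_eq_edgePoint_of_simplexPt _ hi
      refine ⟨y, ?_⟩
      dsimp only [Function.comp_apply]
      rw [liftedFace_lift, hw']

variable [Finite T]

theorem existsUnique_developed (L : LiftedFace H p) :
    ∃! u, ∃ o c, Developed d e L₀ u₀ L o c u := by
  obtain ⟨n, rfl⟩ := liftedFace_surjective hp hq hD L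
  refine ⟨_, ⟨_, _, developed_liftedFace hρ hb hρ' hq hD h₀ n⟩, ?_⟩
  rintro u ⟨o, c, hu⟩
  obtain ⟨m, hm, -, -, rfl⟩ := eq_of_developed hp hρ hb hρ' hq hD h₀ hu
  rw [liftedFace_injective hq hD hm]

end

/-! ## Initial faces -/

theorem exists_isBaseLift (d : Decoration H) (L₀ : LiftedFace H p) :
    ∃ u₀, IsBaseLift d L₀ u₀ := by
  let l : Fin 3 → ℝ := fun i => d.lam (L₀.face, i)
  have hl : ∀ i, 0 < l i := fun i => d.lam_pos _
  -- These factors satisfy `s (i + 1) * s (i + 2) = l i ^ 2`, and the standard vertices have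
  -- products `-1`.
  let s : Fin 3 → ℝ := fun i => l (i + 1) * l (i + 2) / l i
  have hs : ∀ i, 0 < s i := fun i => div_pos (mul_pos (hl _) (hl _)) (hl _)
  have ht := stdTriple.smul hs
  refine ⟨fun k => s k • stdVertex k, ht.mem, (linearIndependent_iff_orient _).2 ht.orient_ne,
    fun i => ?_⟩
  have hg := gram_smul stdVertex s i
  rw [gram_stdVertex] at hg
  have h0 := hl i
  have h1 := hl (i + 1)
  have h2 := hl (i + 2)
  have hsl : s (i + 1) * s (i + 2) * 1 = l i ^ 2 := by
    simp only [s, fin3_add_one_one, fin3_add_one_two, fin3_add_two_one, fin3_add_two_two]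
    field_simp
  rw [hsl, gram] at hg
  rw [minkLambda, hg, Real.sqrt_sq h0.le]

/-- Development data for any surface and initial face. -/
def stdData (Δ : IdealTriangulation T) (t : T) : DevData Δ where
  face := t
  vert := stdVertex
  weight _ := 1
  triple := stdTriple
  weight_pos _ := one_pos
  gram_vert := gram_stdVertex

/-- A development with all weights one already identifies `E` with the hyperbolic plane. Starting it
at `t` makes the root a lift of the face `t`. -/
theorem exists_liftedFace [Finite T] [SimplyConnectedSpace E] (hp : IsCoveringMap p) (t : T) :
    ∃ L₀ : LiftedFace H p, L₀.face = t := by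
  obtain ⟨q, hq, hqc, hqs⟩ := exists_hyp_covering (stdData Δ t) H.toHomotheticGluing
  obtain ⟨e₀⟩ : Nonempty E := inferInstance
  obtain ⟨x₀, hx₀⟩ := hqs (p e₀)
  obtain ⟨D, hD, -⟩ := exists_homeomorph_of_coverings hp hqc hqs hx₀.symm
  exact ⟨liftedFace hq hD Tri.root, rfl⟩

end

noncomputable section

/-! ## Hyperbolic distance -/

theorem one_le_neg_form (x y : HypPlane) : 1 ≤ -form x.1 y.1 := by
  have := form_hyp_le x.2 y.2
  linarith

theorem cosh_hdist (x y : HypPlane) : Real.cosh (hdist x y) = -form x.1 y.1 :=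
  Real.cosh_arcosh (one_le_neg_form x y)

theorem hdist_nonneg (x y : HypPlane) : 0 ≤ hdist x y := Real.arcosh_nonneg (one_le_neg_form x y)

theorem hdist_comm (x y : HypPlane) : hdist x y = hdist y x := by rw [hdist, form_comm, hdist]

theorem hdist_self (x : HypPlane) : hdist x x = 0 := by
  rw [hdist, x.2.1, neg_neg, ← Real.cosh_zero, Real.arcosh_cosh le_rfl]

theorem hdist_le_of_cosh {x y : HypPlane} {d : ℝ} (hd : 0 ≤ d) (h : -form x.1 y.1 ≤ Real.cosh d) :
    hdist x y ≤ d := by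
  rw [← cosh_hdist] at h
  have := Real.cosh_le_cosh.1 h
  rwa [abs_of_nonneg (hdist_nonneg x y), abs_of_nonneg hd] at this

/-- Nonnegativity of the Gram determinant says that `cosh` of the third side differs from `cosh *
cosh` of the others by at most `sinh * sinh`. The addition theorem concludes. -/
theorem hdist_triangle (x y z : HypPlane) : hdist x z ≤ hdist x y + hdist y z := by
  refine hdist_le_of_cosh (add_nonneg (hdist_nonneg _ _) (hdist_nonneg _ _)) ?_
  rw [Real.cosh_add]
  have h1 := Real.cosh_sq (hdist x y)
  have h2 := Real.cosh_sq (hdist y z)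
  have hs := mul_nonneg (Real.sinh_nonneg_iff.2 (hdist_nonneg x y))
    (Real.sinh_nonneg_iff.2 (hdist_nonneg y z))
  have hd := det_sq x.1 y.1 z.1
  rw [x.2.1, y.2.1, z.2.1] at hd
  have hd0 := sq_nonneg (Matrix.det ![x.1, y.1, z.1])
  have hc1 := cosh_hdist x y
  have hc2 := cosh_hdist y z
  have hx : form x.1 y.1 = -Real.cosh (hdist x y) := by rw [hc1, neg_neg]
  have hy : form y.1 z.1 = -Real.cosh (hdist y z) := by rw [hc2, neg_neg]
  rw [hd, hx, hy] at hd0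
  have hsq : (-form x.1 z.1 - Real.cosh (hdist x y) * Real.cosh (hdist y z)) ^ 2 ≤
      (Real.sinh (hdist x y) * Real.sinh (hdist y z)) ^ 2 := by
    rw [mul_pow]
    rw [show Real.sinh (hdist x y) ^ 2 = Real.cosh (hdist x y) ^ 2 - 1 by linarith,
      show Real.sinh (hdist y z) ^ 2 = Real.cosh (hdist y z) ^ 2 - 1 by linarith]
    nlinarith
  have := abs_le_of_sq_le_sq' hsq hs
  linarith [this.2]

/-- The difference `x - y` is null and orthogonal to the timelike vector `x`. The Cauchy–Schwarz
inequality then makes its last coordinate vanish, and with it the others. -/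
theorem eq_of_form_eq_neg_one {x y : HypPlane} (h : form x.1 y.1 = -1) : x = y := by
  have hx := x.2.1
  have hy := y.2.1
  have hx2 := x.2.2
  simp only [form] at hx hy h
  have hw : (x.1 2 - y.1 2) ^ 2 ≤ 0 := by
    have e1 : (x.1 2 - y.1 2) * x.1 2 = (x.1 0 - y.1 0) * x.1 0 + (x.1 1 - y.1 1) * x.1 1 := by
      linarith
    have e2 : (x.1 2 - y.1 2) ^ 2 = (x.1 0 - y.1 0) ^ 2 + (x.1 1 - y.1 1) ^ 2 := by linarith
    have e3 : ((x.1 2 - y.1 2) * x.1 2) ^ 2 ≤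
        ((x.1 0 - y.1 0) ^ 2 + (x.1 1 - y.1 1) ^ 2) * (x.1 0 ^ 2 + x.1 1 ^ 2) := by
      rw [e1]
      nlinarith [sq_nonneg ((x.1 0 - y.1 0) * x.1 1 - (x.1 1 - y.1 1) * x.1 0)]
    rw [← e2, show x.1 0 ^ 2 + x.1 1 ^ 2 = x.1 2 ^ 2 - 1 by linarith, mul_pow] at e3
    linarith
  have h2 : x.1 2 - y.1 2 = 0 := pow_eq_zero_iff two_ne_zero |>.1 (le_antisymm hw (sq_nonneg _))
  have e2 : (x.1 0 - y.1 0) ^ 2 + (x.1 1 - y.1 1) ^ 2 = 0 := by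
    have : (x.1 0 - y.1 0) ^ 2 + (x.1 1 - y.1 1) ^ 2 = (x.1 2 - y.1 2) ^ 2 := by linarith
    rw [this, h2]
    norm_num
  have h0 : x.1 0 - y.1 0 = 0 := pow_eq_zero_iff two_ne_zero |>.1
    (le_antisymm (by linarith [sq_nonneg (x.1 1 - y.1 1)]) (sq_nonneg _))
  have h1 : x.1 1 - y.1 1 = 0 := pow_eq_zero_iff two_ne_zero |>.1
    (le_antisymm (by linarith [sq_nonneg (x.1 0 - y.1 0)]) (sq_nonneg _))
  apply Subtype.ext
  funext k
  fin_cases k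
  · exact sub_eq_zero.1 h0
  · exact sub_eq_zero.1 h1
  · exact sub_eq_zero.1 h2

theorem exists_geodesic (x y : HypPlane) : ∃ γ : ℝ → HypPlane, Continuous γ ∧ γ 0 = x ∧
    γ (hdist x y) = y ∧ ∀ s t, hdist (γ s) (γ t) = |s - t| := by
  rcases eq_or_ne x y with rfl | hxy
  · -- any geodesic through `x`
    obtain ⟨v, hv, hxv⟩ : ∃ v, form v v = 1 ∧ form x.1 v = 0 := by
      have hpos : 0 < x.1 2 ^ 2 - x.1 0 ^ 2 := by
        have := x.2.1
        simp only [form] at this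
        nlinarith [sq_nonneg (x.1 1)]
      refine ⟨(√(x.1 2 ^ 2 - x.1 0 ^ 2))⁻¹ • ![x.1 2, 0, x.1 0], ?_, ?_⟩
      · rw [form_smul_left, form_smul_right, ← mul_assoc, ← mul_inv,
          Real.mul_self_sqrt hpos.le]
        simp only [form, Matrix.cons_val]
        field_simp
        ring
      · rw [form_smul_right]
        simp only [form, Matrix.cons_val]
        ring
    obtain ⟨γ, h1, h2, -, h4⟩ := key x v hv hxv
    exact ⟨γ, h1, h2, by rw [hdist_self, h2], h4⟩
  · have hc := cosh_hdist x y
    have hd : 0 < hdist x y := (hdist_nonneg x y).lt_of_ne fun h => hxy <|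
      eq_of_form_eq_neg_one (by rw [← h, Real.cosh_zero] at hc; linarith)
    have hs := Real.sinh_pos_iff.2 hd
    have hcs := Real.cosh_sq (hdist x y)
    have hx := x.2.1
    have hy := y.2.1
    have hf : form x.1 y.1 = -Real.cosh (hdist x y) := by rw [hc, neg_neg]
    -- The unit tangent vector at `x` towards `y`, obtained by subtracting from `y` its component
    -- along `x`.
    obtain ⟨γ, h1, h2, h3, h4⟩ := key x
      ((Real.sinh (hdist x y))⁻¹ • (y.1 + (-Real.cosh (hdist x y)) • x.1))
      (by
        rw [form_smul_left, form_smul_right, form_add_left, form_add_right, form_add_right,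
          form_smul_left, form_smul_left, form_smul_right, form_smul_right, hx, hy,
          form_comm y.1 x.1, hf]
        field_simp
        linarith)
      (by
        rw [form_smul_right, form_add_right, form_smul_right, hx, hf]
        ring)
    refine ⟨γ, h1, h2, ?_, h4⟩
    apply Subtype.ext
    rw [h3, smul_smul, mul_inv_cancel₀ hs.ne', one_smul, neg_smul]
    abel
where
  key (x : HypPlane) (v : Fin 3 → ℝ) (hv : form v v = 1) (hxv : form x.1 v = 0) :
      ∃ γ : ℝ → HypPlane, Continuous γ ∧ γ 0 = x ∧
        (∀ t, (γ t).1 = Real.cosh t • x.1 + Real.sinh t • v) ∧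
        ∀ s t, hdist (γ s) (γ t) = |s - t| := by
    have hform : ∀ s t, form (Real.cosh s • x.1 + Real.sinh s • v)
        (Real.cosh t • x.1 + Real.sinh t • v) = -Real.cosh (s - t) := fun s t => by
      rw [form_add_left, form_add_right, form_add_right, form_smul_left, form_smul_left,
        form_smul_left, form_smul_left, form_smul_right, form_smul_right, form_smul_right,
        form_smul_right, hv, form_comm v x.1, hxv, x.2.1, Real.cosh_sub]
      ring
    have hmem : ∀ t, Real.cosh t • x.1 + Real.sinh t • v ∈ HypPlane := fun t => by
      have h1 : form (Real.cosh t • x.1 + Real.sinh t • v)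
          (Real.cosh t • x.1 + Real.sinh t • v) = -1 := by
        rw [hform, sub_self, Real.cosh_zero]
      refine ⟨h1, pos_of_form_neg (u := x.1) (by rw [h1]; norm_num) (by rw [x.2.1]; norm_num)
        x.2.2 ?_⟩
      rw [form_add_left, form_smul_left, form_smul_left, form_comm v, hxv, x.2.1]
      linarith [Real.cosh_pos t]
    refine ⟨fun t => ⟨_, hmem t⟩, ?_, ?_, fun t => rfl, fun s t => ?_⟩
    · refine Continuous.subtype_mk ?_ _
      exact (Real.continuous_cosh.smul continuous_const).add
        (Real.continuous_sinh.smul continuous_const)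
    · apply Subtype.ext
      dsimp only
      rw [Real.cosh_zero, Real.sinh_zero, one_smul, zero_smul, add_zero]
    · rw [hdist, hform, neg_neg, ← Real.cosh_abs, Real.arcosh_cosh (abs_nonneg _)]

/-- The addition theorem with `cosh ≥ 1`. It turns a factor in a bound for `sinh` of a distance into
the same factor for the distance. -/
theorem sinh_mul_ge (n : ℕ) {d : ℝ} (hd : 0 ≤ d) : n * Real.sinh d ≤ Real.sinh (n * d) := by
  induction n with
  | zero => simp
  | succ n ih =>
    have h1 := Real.one_le_cosh d
    have h2 := Real.one_le_cosh (n * d)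
    have h3 := Real.sinh_nonneg_iff.2 hd
    have h4 : 0 ≤ Real.sinh (n * d) := Real.sinh_nonneg_iff.2 (by positivity)
    rw [Nat.cast_succ, add_one_mul, add_one_mul, Real.sinh_add]
    nlinarith

/-- A linear bound of the distance from a bound of its hyperbolic sine. -/
theorem hdist_le_mul {x y x' y' : HypPlane} (n : ℕ)
    (h : form x'.1 y'.1 ^ 2 - 1 ≤ (n : ℝ) ^ 2 * (form x.1 y.1 ^ 2 - 1)) :
    hdist x' y' ≤ n * hdist x y := by
  have h1 := Real.cosh_sq (hdist x y)
  have h2 := Real.cosh_sq (hdist x' y')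
  rw [cosh_hdist, neg_sq] at h1 h2
  have hs := Real.sinh_nonneg_iff.2 (hdist_nonneg x y)
  rw [h1, h2, add_sub_cancel_right, add_sub_cancel_right, ← mul_pow] at h
  have h3 := abs_le_of_sq_le_sq' h (by positivity)
  exact Real.sinh_le_sinh.1 (h3.2.trans (sinh_mul_ge n (hdist_nonneg x y)))

/-- A map which is locally Lipschitz at all points, with the same constant, is Lipschitz. -/
theorem hdist_le_of_local {f : HypPlane → HypPlane} {K : ℝ}
    (h : ∀ x, ∀ᶠ y in 𝓝 x, hdist (f x) (f y) ≤ K * hdist x y) (x y : HypPlane) :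
    hdist (f x) (f y) ≤ K * hdist x y := by
  obtain ⟨γ, hγ, h0, h1, hd⟩ := exists_geodesic x y
  have hloc : ∀ t, ∀ᶠ s in 𝓝 t, |hdist (f x) (f (γ s)) - hdist (f x) (f (γ t))| ≤ K * |t - s| := by
    intro t
    filter_upwards [hγ.continuousAt.eventually (h (γ t))] with s hs
    rw [hd] at hs
    have h1 := hdist_triangle (f x) (f (γ t)) (f (γ s))
    have h2 := hdist_triangle (f x) (f (γ s)) (f (γ t))
    rw [hdist_comm (f (γ s))] at h2
    rw [abs_le]
    constructor <;> linarith
  have hcont : Continuous fun t => hdist (f x) (f (γ t)) := by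
    rw [continuous_iff_continuousAt]
    intro t
    have hlim : Tendsto (fun s => K * |t - s|) (𝓝 t) (𝓝 0) := by
      have : Continuous fun s => K * |t - s| := by fun_prop
      simpa using this.tendsto t
    exact tendsto_iff_dist_tendsto_zero.2
      (squeeze_zero' (.of_forall fun _ => dist_nonneg) (hloc t) hlim)
  -- Along a unit speed geodesic the distance from `f x` grows at rate at most `K`, so it stays
  -- below the linear function `K * t`.
  have key := image_le_of_liminf_slope_right_le_deriv_boundary (a := 0) (b := hdist x y)
    (f := fun t => hdist (f x) (f (γ t))) (B := fun t => K * t) (B' := fun _ => K)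
    hcont.continuousOn (by rw [h0, hdist_self, mul_zero])
    (by fun_prop)
    (fun t _ => by simpa using ((hasDerivAt_id t).const_mul K).hasDerivWithinAt)
    (fun t _ r hr => by
      refine Eventually.frequently ?_
      filter_upwards [nhdsWithin_le_nhds (hloc t), self_mem_nhdsWithin] with s hs hst
      have hst' : 0 < s - t := sub_pos.2 hst
      rw [abs_sub_comm t s, abs_of_pos hst'] at hs
      rw [slope_def_field, div_lt_iff₀ hst']
      nlinarith [le_abs_self (hdist (f x) (f (γ s)) - hdist (f x) (f (γ t)))])
    (Set.right_mem_Icc.2 (hdist_nonneg x y))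
  rwa [h1] at key

end

noncomputable section

/-! ## An estimate in the coordinates of an ideal triangle -/

/-- The Minkowski form, with positive sign, in the coordinates of a triangle of λ-lengths one. -/
def pairing (a b : Fin 3 → ℝ) : ℝ := ∑ k, b k * (a (k + 1) + a (k + 2))

/-- The discriminant of two vectors. -/
def discr (a b : Fin 3 → ℝ) : ℝ := pairing a b ^ 2 - pairing a a * pairing b b

/-- The discriminant depends only on the three `2 × 2` minors of `a` and `b`. All later estimates
are made for these minors. -/
theorem discr_eq (a b : Fin 3 → ℝ) (i : Fin 3) : discr a b =
    ((a i * b (i + 1) - a (i + 1) * b i) - (a (i + 2) * b i - a i * b (i + 2))) ^ 2 +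
    (a (i + 1) * b (i + 2) - a (i + 2) * b (i + 1)) ^ 2 -
    2 * (a (i + 1) * b (i + 2) - a (i + 2) * b (i + 1)) *
      ((a i * b (i + 1) - a (i + 1) * b i) + (a (i + 2) * b i - a i * b (i + 2))) := by
  simp only [discr, pairing, sum_fin3 _ i, fin3_add_one_one, fin3_add_one_two, fin3_add_two_one,
    fin3_add_two_two]
  ring

/-! ### The estimate near an ideal vertex. -/

section Estimate

variable {α β x y : ℝ}

/-- Here `n` is the discriminant of `(1, α, β)` and `(1, α + x, β + y)`: `x + y` measures the motion
towards the vertex and `α * y - β * x` the transverse motion. After multiplication by `α + β` the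
mixed term is absorbed because `|α - β| ≤ α + β`. -/
theorem discr_lower (hα : 0 ≤ α) (hβ : 0 ≤ β) (hα1 : α ≤ 1) (hβ1 : β ≤ 1) (hS : 0 < α + β) {n : ℝ}
    (hn : n = (x + y) ^ 2 + (α * y - β * x) ^ 2 - 2 * (α * y - β * x) * (x - y)) :
    (α * y - β * x) ^ 2 ≤ (α + β) * n ∧ (x + y) ^ 2 ≤ 4 * n := by
  obtain ⟨D, hD⟩ : ∃ D, D = x + y := ⟨_, rfl⟩
  obtain ⟨ω, hω⟩ : ∃ ω, ω = α * y - β * x := ⟨_, rfl⟩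
  have hSn : (α + β) * n = (α + β) * D ^ 2 + (α + β + 4) * ω ^ 2 - 2 * (α - β) * (ω * D) := by
    rw [hn, hD, hω]
    ring
  have hcross : |(α - β) * (ω * D)| ≤ (α + β) * (|ω| * |D|) := by
    rw [abs_mul, abs_mul]
    refine mul_le_mul_of_nonneg_right ?_ (by positivity)
    rw [abs_le]
    constructor <;> linarith
  have hc := abs_le.1 hcross
  have h2 : 2 * (|ω| * |D|) ≤ ω ^ 2 + D ^ 2 := by
    nlinarith [sq_nonneg (|ω| - |D|), sq_abs ω, sq_abs D]
  -- The weights leave one `D ^ 2` of the four, and a nonnegative coefficient of `ω ^ 2` since `α +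
  -- β ≤ 2`.
  have h3 : 8 * (|ω| * |D|) ≤ 3 * D ^ 2 + (16 / 3) * ω ^ 2 := by
    nlinarith [sq_nonneg (4 * |ω| - 3 * |D|), sq_abs ω, sq_abs D]
  rw [← hD, ← hω]
  constructor
  · rw [hSn]
    nlinarith [mul_le_mul_of_nonneg_left h2 hS.le, sq_nonneg ω]
  · refine le_of_mul_le_mul_left ?_ hS
    have : (α + β) * (4 * n) = 4 * ((α + β) * n) := by ring
    rw [this, hSn]
    nlinarith [mul_le_mul_of_nonneg_left h3 hS.le, sq_nonneg ω,
      mul_nonneg (show 0 ≤ 2 - (α + β) by linarith) (sq_nonneg ω)]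

/-- The vector `(x, y)` is decomposed along `(α, β)` and `(-1, 1)`. -/
theorem mul_variation_le (hα : 0 ≤ α) (hβ : 0 ≤ β) : (α + β) * (|x| + |y|) ≤
    (α + β) * |x + y| + 2 * |α * y - β * x| := by
  have hx : (α + β) * |x| ≤ α * |x + y| + |α * y - β * x| := by
    have h : (α + β) * x = α * (x + y) - (α * y - β * x) := by ring
    calc (α + β) * |x| = |(α + β) * x| := by rw [abs_mul, abs_of_nonneg (add_nonneg hα hβ)]
      _ ≤ _ := by
        rw [h]
        refine (abs_sub _ _).trans ?_
        rw [abs_mul, abs_of_nonneg hα]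
  have hy : (α + β) * |y| ≤ β * |x + y| + |α * y - β * x| := by
    have h : (α + β) * y = β * (x + y) + (α * y - β * x) := by ring
    calc (α + β) * |y| = |(α + β) * y| := by rw [abs_mul, abs_of_nonneg (add_nonneg hα hβ)]
      _ ≤ _ := by
        rw [h]
        refine (abs_add_le _ _).trans ?_
        rw [abs_mul, abs_of_nonneg hβ]
  linarith

variable {C : ℝ} {μ₀ μ₁ μ₂ p₀ p₁ p₂ : ℝ}

theorem abs_lin_le {a b : ℝ} (ha : 0 ≤ a) (hb : 0 ≤ b) (haC : a ≤ C) (hbC : b ≤ C) (x y : ℝ) :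
    |a * x + b * y| ≤ C * (|x| + |y|) := by
  calc |a * x + b * y| ≤ |a * x| + |b * y| := abs_add_le _ _
    _ = a * |x| + b * |y| := by rw [abs_mul, abs_mul, abs_of_nonneg ha, abs_of_nonneg hb]
    _ ≤ C * |x| + C * |y| := by gcongr
    _ = _ := by ring

theorem abs_mul_le_mul {a b A B : ℝ} (ha : |a| ≤ A) (hb : |b| ≤ B) : |a * b| ≤ A * B := by
  rw [abs_mul]
  exact mul_le_mul ha hb (abs_nonneg _) ((abs_nonneg _).trans ha)

/-- Bookkeeping with `t ^ 2 = α + β`, `r ^ 2 = n`, `h = |x| + |y|`, and `X`, `Y` the transverse and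
radial parts. The constant is rounded up generously. -/
theorem discr_combine {t r h n X Y w₀ w₁ w₂ : ℝ} (ht : 0 < t) (ht2 : t ^ 2 ≤ 2) (hr : 0 ≤ r)
    (hrs : n = r ^ 2) (hω : X ≤ t * r) (hD : Y ≤ 2 * r) (hv : t ^ 2 * h ≤ t ^ 2 * Y + 2 * X)
    (b0 : |w₀| ≤ 9 * C ^ 2 * X + 12 * C ^ 2 * ((t ^ 2) ^ 2 * h))
    (b1 : |w₂ + w₁| ≤ 36 * C ^ 2 * h)
    (b3 : |w₂ - w₁| ≤ 3 * C ^ 2 * Y + 24 * C ^ 2 * (t ^ 2 * h)) :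
    (w₂ - w₁) ^ 2 + w₀ ^ 2 - 2 * w₀ * (w₂ + w₁) ≤ 200000 * C ^ 4 * n := by
  have ht32 : t ≤ 3 / 2 := by nlinarith
  have hCC : 0 ≤ C ^ 2 := sq_nonneg C
  have htr := mul_nonneg ht.le hr
  have hn : 0 ≤ n := hrs ▸ sq_nonneg r
  -- The variation may exceed `r`, but only by a factor of order `1 / t`; the errors below always
  -- carry enough powers of `t`.
  have hth : t * h ≤ 5 * r := by
    refine le_of_mul_le_mul_left ?_ ht
    linarith [mul_le_mul_of_nonneg_left hD (sq_nonneg t),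
      mul_nonneg htr (show 0 ≤ 3 / 2 - t by linarith)]
  have c0 : |w₀| ≤ 129 * C ^ 2 * (t * r) := by
    have e1 : (t ^ 2) ^ 2 * h ≤ 10 * (t * r) := by
      have : (t ^ 2) ^ 2 * h = t ^ 2 * (t * (t * h)) := by ring
      rw [this]
      have h5 : t * (t * h) ≤ t * (5 * r) := mul_le_mul_of_nonneg_left hth ht.le
      linarith [mul_le_mul_of_nonneg_left h5 (sq_nonneg t),
        mul_nonneg (show 0 ≤ 2 - t ^ 2 by linarith) htr]
    linarith [mul_le_mul_of_nonneg_left e1 hCC, mul_le_mul_of_nonneg_left hω hCC]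
  have c3 : |w₂ - w₁| ≤ 186 * C ^ 2 * r := by
    have e1 : t ^ 2 * h ≤ (15 / 2) * r := by
      have : t ^ 2 * h = t * (t * h) := by ring
      rw [this]
      linarith [mul_le_mul_of_nonneg_left hth ht.le,
        mul_nonneg (show 0 ≤ 3 / 2 - t by linarith) hr]
    linarith [mul_le_mul_of_nonneg_left e1 hCC, mul_le_mul_of_nonneg_left hD hCC]
  have q0 : w₀ ^ 2 ≤ 33282 * C ^ 4 * n := by
    have : w₀ ^ 2 ≤ (129 * C ^ 2 * (t * r)) ^ 2 := sq_le_sq.2 (c0.trans (le_abs_self _))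
    refine this.trans ?_
    have e : (129 * C ^ 2 * (t * r)) ^ 2 = 16641 * (C ^ 4 * n) * t ^ 2 := by rw [hrs]; ring
    rw [e]
    linarith [mul_nonneg (show 0 ≤ C ^ 4 * n by positivity) (show 0 ≤ 2 - t ^ 2 by linarith)]
  have q1 : (w₂ - w₁) ^ 2 ≤ 34596 * C ^ 4 * n := by
    have : (w₂ - w₁) ^ 2 ≤ (186 * C ^ 2 * r) ^ 2 := sq_le_sq.2 (c3.trans (le_abs_self _))
    refine this.trans_eq ?_
    rw [hrs]
    ring
  have q2 : |w₀ * (w₂ + w₁)| ≤ 23220 * C ^ 4 * n := by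
    refine (abs_mul_le_mul c0 b1).trans ?_
    have e : 129 * C ^ 2 * (t * r) * (36 * C ^ 2 * h) = 4644 * (C ^ 4 * r) * (t * h) := by ring
    rw [e]
    refine (mul_le_mul_of_nonneg_left hth (by positivity)).trans_eq ?_
    rw [hrs]
    ring
  have := (abs_le.1 q2).1
  have hCn : 0 ≤ C ^ 4 * n := by positivity
  linarith

section Upper

variable (hμ₀ : 0 ≤ μ₀) (hμ₁ : 0 ≤ μ₁) (hμ₂ : 0 ≤ μ₂) (hp₀ : 0 ≤ p₀) (hp₁ : 0 ≤ p₁)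
  (hp₂ : 0 ≤ p₂) (hμ₀C : μ₀ ≤ C) (hμ₁C : μ₁ ≤ C) (hμ₂C : μ₂ ≤ C) (hp₀C : p₀ ≤ C) (hp₁C : p₁ ≤ C)
  (hp₂C : p₂ ≤ C) (hα : 0 ≤ α) (hβ : 0 ≤ β) (hα1 : α ≤ 1) (hβ1 : β ≤ 1)
  (hx : |x| ≤ (α + β) / 4) (hy : |y| ≤ (α + β) / 4) {A₀ A₁ A₂ d₀ d₁ d₂ : ℝ}
  (hA₀ : A₀ = μ₀ + p₁ * α + p₂ * β) (hA₁ : A₁ = p₀ + μ₁ * α + p₂ * β)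
  (hA₂ : A₂ = p₀ + p₁ * α + μ₂ * β) (hd₀ : d₀ = p₁ * x + p₂ * y) (hd₁ : d₁ = μ₁ * x + p₂ * y)
  (hd₂ : d₂ = p₁ * x + μ₂ * y)

theorem affine_le {a b c : ℝ} (ha : 0 ≤ a) (hb : 0 ≤ b) (hc : 0 ≤ c) (haC : a ≤ C) (hbC : b ≤ C)
    (hcC : c ≤ C) (hα : 0 ≤ α) (hβ : 0 ≤ β) (hα1 : α ≤ 1) (hβ1 : β ≤ 1) :
    |a + b * α + c * β| ≤ 3 * C := by
  rw [abs_of_nonneg (by positivity)]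
  nlinarith [mul_le_mul hbC hα1 hα (hb.trans hbC), mul_le_mul hcC hβ1 hβ (hc.trans hcC)]

section

include hμ₀ hμ₁ hp₀ hp₁ hp₂ hμ₀C hμ₁C hp₀C hp₁C hp₂C hα hβ hα1 hβ1 hx hA₀ hA₁ hd₀ hd₁

/-- The images of the two points under `spread` are `(A₀, α A₁, β A₂)` and `(A₀ + d₀, (α + x) (A₁ +
d₁), (β + y) (A₂ + d₂)`. This crude bound serves for two minors by exchanging `α` and `β`; it
suffices where a minor is multiplied by the small minor `w₀`. -/
theorem wedge_two_le : |A₀ * ((α + x) * (A₁ + d₁)) - α * A₁ * (A₀ + d₀)| ≤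
    18 * C ^ 2 * (|x| + |y|) := by
  have a0 : |A₀| ≤ 3 * C := hA₀ ▸ affine_le hμ₀ hp₁ hp₂ hμ₀C hp₁C hp₂C hα hβ hα1 hβ1
  have a1 : |A₁| ≤ 3 * C := hA₁ ▸ affine_le hp₀ hμ₁ hp₂ hp₀C hμ₁C hp₂C hα hβ hα1 hβ1
  have e0 : |d₀| ≤ C * (|x| + |y|) := hd₀ ▸ abs_lin_le hp₁ hp₂ hp₁C hp₂C x y
  have e1 : |d₁| ≤ C * (|x| + |y|) := hd₁ ▸ abs_lin_le hμ₁ hp₂ hμ₁C hp₂C x y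
  have f1 : |α| ≤ 1 := by rwa [abs_of_nonneg hα]
  have f2 : |x| ≤ |x| + |y| := le_add_of_nonneg_right (abs_nonneg y)
  have g1 : |α + x| ≤ 2 := by
    have := abs_le.1 hx
    rw [abs_le]
    constructor <;> linarith
  have t1 := abs_mul_le_mul (abs_mul_le_mul a0 a1) f2
  have t2 := abs_mul_le_mul g1 (abs_mul_le_mul a0 e1)
  have t3 := abs_mul_le_mul f1 (abs_mul_le_mul a1 e0)
  have h : A₀ * ((α + x) * (A₁ + d₁)) - α * A₁ * (A₀ + d₀) =
      A₀ * A₁ * x + (α + x) * (A₀ * d₁) - α * (A₁ * d₀) := by ring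
  rw [h]
  refine (abs_sub _ _).trans ((add_le_add_left (abs_add_le _ _) _).trans ?_)
  linarith

end

include hμ₁ hμ₂ hp₀ hp₁ hp₂ hμ₁C hμ₂C hp₀C hp₁C hp₂C hα hβ hα1 hβ1 hx hy hA₁ hA₂ hd₁ hd₂

/-- The main term is `A₁ A₂` times the original minor `α y - β x`. The errors contain one coordinate
of each point, whence the factor `(α + β) ^ 2`. -/
theorem wedge_zero_le : |α * A₁ * ((β + y) * (A₂ + d₂)) - β * A₂ * ((α + x) * (A₁ + d₁))| ≤
    9 * C ^ 2 * |α * y - β * x| + 12 * C ^ 2 * ((α + β) ^ 2 * (|x| + |y|)) := by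
  have a1 : |A₁| ≤ 3 * C := hA₁ ▸ affine_le hp₀ hμ₁ hp₂ hp₀C hμ₁C hp₂C hα hβ hα1 hβ1
  have a2 : |A₂| ≤ 3 * C := hA₂ ▸ affine_le hp₀ hp₁ hμ₂ hp₀C hp₁C hμ₂C hα hβ hα1 hβ1
  have e1 : |d₁| ≤ C * (|x| + |y|) := hd₁ ▸ abs_lin_le hμ₁ hp₂ hμ₁C hp₂C x y
  have e2 : |d₂| ≤ C * (|x| + |y|) := hd₂ ▸ abs_lin_le hp₁ hμ₂ hp₁C hμ₂C x y
  have f1 : |α| ≤ α + β := by rw [abs_of_nonneg hα]; linarith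
  have f2 : |β| ≤ α + β := by rw [abs_of_nonneg hβ]; linarith
  have g1 : |α + x| ≤ 2 * (α + β) := by
    have := abs_le.1 hx
    rw [abs_le]
    constructor <;> linarith
  have g2 : |β + y| ≤ 2 * (α + β) := by
    have := abs_le.1 hy
    rw [abs_le]
    constructor <;> linarith
  have t1 := abs_mul_le_mul (abs_mul_le_mul a1 a2) (le_refl |α * y - β * x|)
  have t2 := abs_mul_le_mul (abs_mul_le_mul f1 a1) (abs_mul_le_mul g2 e2)
  have t3 := abs_mul_le_mul (abs_mul_le_mul f2 a2) (abs_mul_le_mul g1 e1)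
  have h : α * A₁ * ((β + y) * (A₂ + d₂)) - β * A₂ * ((α + x) * (A₁ + d₁)) =
      A₁ * A₂ * (α * y - β * x) + α * A₁ * ((β + y) * d₂) - β * A₂ * ((α + x) * d₁) := by ring
  rw [h]
  refine (abs_sub _ _).trans ((add_le_add_left (abs_add_le _ _) _).trans ?_)
  linarith

include hμ₀ hμ₀C hA₀ hd₀

/-- The leading parts of the two small image coordinates have the same coefficient `p₀`, so together
they vary by `p₀ * (x + y)`. This is how being nearly a homothety at the vertex is used; all other
terms gain a factor `α + β`. -/
theorem wedge_sub_le : |(A₀ * ((α + x) * (A₁ + d₁)) - α * A₁ * (A₀ + d₀)) -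
      (β * A₂ * (A₀ + d₀) - A₀ * ((β + y) * (A₂ + d₂)))| ≤
    3 * C ^ 2 * |x + y| + 24 * C ^ 2 * ((α + β) * (|x| + |y|)) := by
  have a0 : |A₀| ≤ 3 * C := hA₀ ▸ affine_le hμ₀ hp₁ hp₂ hμ₀C hp₁C hp₂C hα hβ hα1 hβ1
  have a1 : |A₁| ≤ 3 * C := hA₁ ▸ affine_le hp₀ hμ₁ hp₂ hp₀C hμ₁C hp₂C hα hβ hα1 hβ1
  have a2 : |A₂| ≤ 3 * C := hA₂ ▸ affine_le hp₀ hp₁ hμ₂ hp₀C hp₁C hμ₂C hα hβ hα1 hβ1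
  have e0 : |d₀| ≤ C * (|x| + |y|) := hd₀ ▸ abs_lin_le hp₁ hp₂ hp₁C hp₂C x y
  have f1 : |α| ≤ α := (abs_of_nonneg hα).le
  have f2 : |β| ≤ β := (abs_of_nonneg hβ).le
  have hT : |α * A₁ + β * A₂| ≤ 3 * C * (α + β) := by
    refine (abs_add_le _ _).trans ?_
    linarith [abs_mul_le_mul f1 a1, abs_mul_le_mul f2 a2]
  have hp0 : |p₀| ≤ C := by rwa [abs_of_nonneg hp₀]
  have t1 := abs_mul_le_mul hp0 (le_refl |x + y|)
  have hxx : |x * (2 * α + x)| ≤ |x| * (3 * (α + β)) := abs_mul_le_mul le_rfl (by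
    have := abs_le.1 hx
    rw [abs_le]
    constructor <;> linarith)
  have hyy : |y * (2 * β + y)| ≤ |y| * (3 * (α + β)) := abs_mul_le_mul le_rfl (by
    have := abs_le.1 hy
    rw [abs_le]
    constructor <;> linarith)
  have hxy : |α * y + (β + y) * x| ≤ 2 * ((α + β) * (|x| + |y|)) := by
    have g1 : |α| ≤ α + β := by rw [abs_of_nonneg hα]; linarith
    have g2 : |β + y| ≤ 2 * (α + β) := by
      have := abs_le.1 hy
      rw [abs_le]
      constructor <;> linarith
    refine (abs_add_le _ _).trans ?_
    have := abs_mul_le_mul g1 (le_refl |y|)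
    have := abs_mul_le_mul g2 (le_refl |x|)
    nlinarith [mul_nonneg (add_nonneg hα hβ) (abs_nonneg y)]
  have hm1 : |μ₁| ≤ C := by rwa [abs_of_nonneg hμ₁]
  have hm2 : |μ₂| ≤ C := by rwa [abs_of_nonneg hμ₂]
  have hp12 : |p₁ + p₂| ≤ 2 * C := by rw [abs_of_nonneg (by positivity)]; linarith
  have t2 := abs_mul_le_mul hm1 hxx
  have t3 := abs_mul_le_mul hm2 hyy
  have t4 := abs_mul_le_mul hp12 hxy
  have hdT : |p₀ * (x + y) + μ₁ * (x * (2 * α + x)) + μ₂ * (y * (2 * β + y)) +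
      (p₁ + p₂) * (α * y + (β + y) * x)| ≤ C * |x + y| + 7 * C * ((α + β) * (|x| + |y|)) := by
    refine (abs_add_le _ _).trans ((add_le_add_left ((abs_add_le _ _).trans
      (add_le_add_left (abs_add_le _ _) _)) _).trans ?_)
    linarith
  have s1 := abs_mul_le_mul a0 hdT
  have s2 := abs_mul_le_mul hT e0
  have h : (A₀ * ((α + x) * (A₁ + d₁)) - α * A₁ * (A₀ + d₀)) -
      (β * A₂ * (A₀ + d₀) - A₀ * ((β + y) * (A₂ + d₂))) =
      A₀ * (p₀ * (x + y) + μ₁ * (x * (2 * α + x)) + μ₂ * (y * (2 * β + y)) +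
      (p₁ + p₂) * (α * y + (β + y) * x)) - (α * A₁ + β * A₂) * d₀ := by
    rw [hA₁, hA₂, hd₁, hd₂]
    ring
  rw [h]
  refine (abs_sub _ _).trans ?_
  linarith

theorem discr_upper (hS : 0 < α + β) {n : ℝ}
    (hn : n = (x + y) ^ 2 + (α * y - β * x) ^ 2 - 2 * (α * y - β * x) * (x - y))
    {w₀ w₁ w₂ : ℝ} (hw₀ : w₀ = α * A₁ * ((β + y) * (A₂ + d₂)) - β * A₂ * ((α + x) * (A₁ + d₁)))
    (hw₁ : w₁ = β * A₂ * (A₀ + d₀) - A₀ * ((β + y) * (A₂ + d₂)))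
    (hw₂ : w₂ = A₀ * ((α + x) * (A₁ + d₁)) - α * A₁ * (A₀ + d₀)) :
    (w₂ - w₁) ^ 2 + w₀ ^ 2 - 2 * w₀ * (w₂ + w₁) ≤ 200000 * C ^ 4 * n := by
  obtain ⟨h1, h2⟩ := discr_lower hα hβ hα1 hβ1 hS hn
  have hn0 : 0 ≤ n := by nlinarith [sq_nonneg (x + y)]
  obtain ⟨t, ht, hts⟩ : ∃ t, 0 < t ∧ α + β = t ^ 2 :=
    ⟨√(α + β), Real.sqrt_pos.2 hS, (Real.sq_sqrt hS.le).symm⟩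
  obtain ⟨r, hr, hrs⟩ : ∃ r, 0 ≤ r ∧ n = r ^ 2 := ⟨√n, Real.sqrt_nonneg _, (Real.sq_sqrt hn0).symm⟩
  have ht2 : t ^ 2 ≤ 2 := by linarith
  have hω : |α * y - β * x| ≤ t * r := abs_le_of_sq_le_sq (by rw [mul_pow, ← hts, ← hrs]; exact h1)
    (by positivity)
  have hD : |x + y| ≤ 2 * r := abs_le_of_sq_le_sq (by rw [mul_pow, ← hrs]; linarith) (by positivity)
  have hv := mul_variation_le (x := x) (y := y) hα hβ
  have b0 := wedge_zero_le hμ₁ hμ₂ hp₀ hp₁ hp₂ hμ₁C hμ₂C hp₀C hp₁C hp₂C hα hβ hα1 hβ1 hx hy hA₁ hA₂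
    hd₁ hd₂
  have b2 := wedge_two_le hμ₀ hμ₁ hp₀ hp₁ hp₂ hμ₀C hμ₁C hp₀C hp₁C hp₂C hα hβ hα1 hβ1
    hx hA₀ hA₁ hd₀ hd₁
  have b3 := wedge_sub_le hμ₀ hμ₁ hμ₂ hp₀ hp₁ hp₂ hμ₀C hμ₁C hμ₂C hp₀C hp₁C hp₂C hα hβ hα1 hβ1
    hx hy hA₀ hA₁ hA₂ hd₀ hd₁ hd₂
  have b1 := wedge_two_le (x := y) (y := x) (A₀ := A₀) (d₀ := d₀) hμ₀ hμ₂ hp₀ hp₂ hp₁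
    hμ₀C hμ₂C hp₀C hp₂C hp₁C hβ hα hβ1 hα1 (by rwa [add_comm]) (by rw [hA₀]; ring)
    (hA₂.trans (by ring)) (by rw [hd₀]; ring) (hd₂.trans (add_comm _ _))
  rw [← hw₀] at b0
  rw [← hw₂] at b2
  rw [← hw₂, ← hw₁] at b3
  rw [abs_sub_comm, ← hw₁, add_comm |y|] at b1
  rw [hts] at hv b0 b3
  exact discr_combine ht ht2 hr hrs hω hD hv b0 (by linarith [abs_add_le w₂ w₁]) b3

end Upper

end Estimate

theorem pairing_eq (a b : Fin 3 → ℝ) (i : Fin 3) : pairing a b =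
    b i * (a (i + 1) + a (i + 2)) + b (i + 1) * (a (i + 2) + a i) + b (i + 2) * (a i + a (i + 1)) := by
  simp only [pairing, sum_fin3 _ i, fin3_add_one_one, fin3_add_one_two, fin3_add_two_one,
    fin3_add_two_two]

theorem pairing_smul (r s : ℝ) (a b : Fin 3 → ℝ) :
    pairing (r • a) (s • b) = r * s * pairing a b := by
  simp only [pairing_eq _ _ 0, Pi.smul_apply, smul_eq_mul]
  ring

theorem discr_smul (r s : ℝ) (a b : Fin 3 → ℝ) :
    discr (r • a) (s • b) = r ^ 2 * s ^ 2 * discr a b := by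
  simp only [discr, pairing_smul]
  ring

/-- A quadratic map which preserves the edges of the simplex. Near each vertex it is close to a
homothety. -/
def spread (μ p a : Fin 3 → ℝ) (i : Fin 3) : ℝ :=
  a i * (μ i * a i + p (i + 1) * a (i + 1) + p (i + 2) * a (i + 2))

theorem spread_smul (μ p a : Fin 3 → ℝ) (r : ℝ) : spread μ p (r • a) = r ^ 2 • spread μ p a := by
  funext i
  simp only [spread, Pi.smul_apply, smul_eq_mul]
  ring

theorem spread_estimate_of_eq_one {c C : ℝ} (hc : 0 < c) {μ p : Fin 3 → ℝ}
    (hμ : ∀ k, c ≤ μ k ∧ μ k ≤ C) (hp : ∀ k, c ≤ p k ∧ p k ≤ C) {a b : Fin 3 → ℝ} {i : Fin 3}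
    (ha0 : a i = 1) (hb0 : b i = 1) (ha : ∀ k, 0 ≤ a k) (hb : ∀ k, 0 ≤ b k) (ha1 : ∀ k, a k ≤ 1)
    (hS : 0 < a (i + 1) + a (i + 2))
    (hab : ∀ k, |b k - a k| ≤ (a (i + 1) + a (i + 2)) / 4) :
    discr (spread μ p a) (spread μ p b) * (pairing a a * pairing b b) ≤
      3200000 * C ^ 4 / c ^ 4 * discr a b *
        (pairing (spread μ p a) (spread μ p a) * pairing (spread μ p b) (spread μ p b)) := by
  obtain ⟨α, hα⟩ : ∃ α, α = a (i + 1) := ⟨_, rfl⟩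
  obtain ⟨β, hβ⟩ : ∃ β, β = a (i + 2) := ⟨_, rfl⟩
  obtain ⟨x, hx⟩ : ∃ x, x = b (i + 1) - α := ⟨_, rfl⟩
  obtain ⟨y, hy⟩ : ∃ y, y = b (i + 2) - β := ⟨_, rfl⟩
  have hbx : b (i + 1) = α + x := by rw [hx]; ring
  have hby : b (i + 2) = β + y := by rw [hy]; ring
  have h1 := hab (i + 1)
  have h2 := hab (i + 2)
  have hα0 := ha (i + 1)
  have hβ0 := ha (i + 2)
  have hα1 := ha1 (i + 1)
  have hβ1 := ha1 (i + 2)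
  have hbx0 := hb (i + 1)
  have hby0 := hb (i + 2)
  rw [← hα, ← hβ] at hS h1 h2
  rw [← hα] at hα0 hα1
  rw [← hβ] at hβ0 hβ1
  rw [← hx] at h1
  rw [← hy] at h2
  rw [hbx] at hbx0
  rw [hby] at hby0
  have hx' := abs_le.1 h1
  have hy' := abs_le.1 h2
  have hpos : ∀ k, 0 ≤ μ k ∧ 0 ≤ p k := fun k => ⟨hc.le.trans (hμ k).1, hc.le.trans (hp k).1⟩
  obtain ⟨n, hn⟩ : ∃ n, n =
      (x + y) ^ 2 + (α * y - β * x) ^ 2 - 2 * (α * y - β * x) * (x - y) := ⟨_, rfl⟩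
  have hd : discr a b = n := by
    rw [discr_eq a b i, ha0, hb0, hbx, hby, ← hα, ← hβ, hn]
    ring
  have hn0 : 0 ≤ n := by
    have := (discr_lower hα0 hβ0 hα1 hβ1 hS hn).2
    linarith [sq_nonneg (x + y)]
  obtain ⟨A₀, hA₀⟩ : ∃ A₀, A₀ = μ i + p (i + 1) * α + p (i + 2) * β := ⟨_, rfl⟩
  obtain ⟨A₁, hA₁⟩ : ∃ A₁, A₁ = p i + μ (i + 1) * α + p (i + 2) * β := ⟨_, rfl⟩
  obtain ⟨A₂, hA₂⟩ : ∃ A₂, A₂ = p i + p (i + 1) * α + μ (i + 2) * β := ⟨_, rfl⟩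
  obtain ⟨d₀, hd₀⟩ : ∃ d₀, d₀ = p (i + 1) * x + p (i + 2) * y := ⟨_, rfl⟩
  obtain ⟨d₁, hd₁⟩ : ∃ d₁, d₁ = μ (i + 1) * x + p (i + 2) * y := ⟨_, rfl⟩
  obtain ⟨d₂, hd₂⟩ : ∃ d₂, d₂ = p (i + 1) * x + μ (i + 2) * y := ⟨_, rfl⟩
  have sa0 : spread μ p a i = A₀ := by rw [spread, ha0, ← hα, ← hβ, hA₀]; ring
  have sa1 : spread μ p a (i + 1) = α * A₁ := by
    rw [spread, fin3_add_one_one, fin3_add_one_two, ha0, ← hα, ← hβ, hA₁]; ring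
  have sa2 : spread μ p a (i + 2) = β * A₂ := by
    rw [spread, fin3_add_two_one, fin3_add_two_two, ha0, ← hα, ← hβ, hA₂]; ring
  have sb0 : spread μ p b i = A₀ + d₀ := by rw [spread, hb0, hbx, hby, hA₀, hd₀]; ring
  have sb1 : spread μ p b (i + 1) = (α + x) * (A₁ + d₁) := by
    rw [spread, fin3_add_one_one, fin3_add_one_two, hb0, hbx, hby, hA₁, hd₁]; ring
  have sb2 : spread μ p b (i + 2) = (β + y) * (A₂ + d₂) := by
    rw [spread, fin3_add_two_one, fin3_add_two_two, hb0, hbx, hby, hA₂, hd₂]; ring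
  have hup := discr_upper (hpos i).1 (hpos (i + 1)).1 (hpos (i + 2)).1 (hpos i).2 (hpos (i + 1)).2
    (hpos (i + 2)).2 (hμ i).2 (hμ (i + 1)).2 (hμ (i + 2)).2 (hp i).2 (hp (i + 1)).2 (hp (i + 2)).2
    hα0 hβ0 hα1 hβ1 h1 h2 hA₀ hA₁ hA₂ hd₀ hd₁ hd₂ hS hn rfl rfl rfl
  have hd' : discr (spread μ p a) (spread μ p b) ≤ 200000 * C ^ 4 * n := by
    rw [discr_eq _ _ i, sa0, sa1, sa2, sb0, sb1, sb2]
    exact hup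
  have lin : ∀ {u v w s t : ℝ}, c ≤ u → 0 ≤ v → 0 ≤ w → 0 ≤ s → 0 ≤ t → c ≤ u + v * s + w * t :=
    fun hu hv hw hs ht => by linarith [mul_nonneg hv hs, mul_nonneg hw ht]
  have cA₀ : c ≤ A₀ := hA₀ ▸ lin (hμ i).1 (hpos _).2 (hpos _).2 hα0 hβ0
  have cA₁ : c ≤ A₁ := hA₁ ▸ lin (hp i).1 (hpos _).1 (hpos _).2 hα0 hβ0
  have cA₂ : c ≤ A₂ := hA₂ ▸ lin (hp i).1 (hpos _).2 (hpos _).1 hα0 hβ0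
  have cB₀ : c ≤ A₀ + d₀ := by
    have := lin (hμ i).1 (hpos (i + 1)).2 (hpos (i + 2)).2 hbx0 hby0
    rw [hA₀, hd₀]; linarith
  have cB₁ : c ≤ A₁ + d₁ := by
    have := lin (hp i).1 (hpos (i + 1)).1 (hpos (i + 2)).2 hbx0 hby0
    rw [hA₁, hd₁]; linarith
  have cB₂ : c ≤ A₂ + d₂ := by
    have := lin (hp i).1 (hpos (i + 1)).2 (hpos (i + 2)).1 hbx0 hby0
    rw [hA₂, hd₂]; linarith
  have lower : ∀ {s t u v w : ℝ}, 0 ≤ s → 0 ≤ t → c ≤ u → c ≤ v → c ≤ w →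
      2 * c ^ 2 * (s + t) ≤
        u * (s * v + t * w) + s * v * (t * w + u) + t * w * (u + s * v) := by
    intro s t u v w hs ht hu hv hw
    have e1 : c * s ≤ v * s := mul_le_mul_of_nonneg_right hv hs
    have e2 : c * t ≤ w * t := mul_le_mul_of_nonneg_right hw ht
    have e3 : c * (c * s + c * t) ≤ u * (v * s + w * t) :=
      mul_le_mul hu (by linarith) (by positivity) (hc.le.trans hu)
    have e4 : 0 ≤ (s * v) * (t * w) :=
      mul_nonneg (mul_nonneg hs (hc.le.trans hv)) (mul_nonneg ht (hc.le.trans hw))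
    linarith
  have la : 2 * c ^ 2 * (α + β) ≤ pairing (spread μ p a) (spread μ p a) := by
    rw [pairing_eq _ _ i, sa0, sa1, sa2]
    exact lower hα0 hβ0 cA₀ cA₁ cA₂
  -- Each small coordinate moves by at most a quarter of `α + β`, so at least half of the sum
  -- remains; this loses the factor two.
  have lb : c ^ 2 * (α + β) ≤ pairing (spread μ p b) (spread μ p b) := by
    rw [pairing_eq _ _ i, sb0, sb1, sb2]
    refine le_trans ?_ (lower hbx0 hby0 cB₀ cB₁ cB₂)
    linarith [mul_nonneg (sq_nonneg c) (show 0 ≤ 2 * (α + x + (β + y)) - (α + β) by linarith)]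
  have ua : pairing a a ≤ 4 * (α + β) := by
    rw [pairing_eq _ _ i, ha0, ← hα, ← hβ]
    linarith [mul_nonneg hα0 (sub_nonneg.2 hβ1)]
  have ub : pairing b b ≤ 8 * (α + β) := by
    rw [pairing_eq _ _ i, hb0, hbx, hby]
    linarith [mul_nonneg hbx0 (show 0 ≤ 3 / 2 - (β + y) by linarith)]
  have na : 0 ≤ pairing a a := by
    rw [pairing_eq _ _ i, ha0, ← hα, ← hβ]
    positivity
  have nb : 0 ≤ pairing b b := by
    rw [pairing_eq _ _ i, hb0, hbx, hby]
    positivity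
  have hPP : pairing a a * pairing b b ≤ 32 * (α + β) ^ 2 :=
    (mul_le_mul ua ub nb (by positivity)).trans_eq (by ring)
  have hPP' : 2 * c ^ 4 * (α + β) ^ 2 ≤
      pairing (spread μ p a) (spread μ p a) * pairing (spread μ p b) (spread μ p b) := by
    refine le_trans (by rw [show 2 * c ^ 4 * (α + β) ^ 2 =
      2 * c ^ 2 * (α + β) * (c ^ 2 * (α + β)) by ring]) (mul_le_mul la lb (by positivity) ?_)
    exact le_trans (by positivity) la
  have hK : 0 ≤ 200000 * C ^ 4 * n := by positivity
  -- The constant is `200000 * 32 / 2`, from the upper bound `32` for the old denominator and the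
  -- lower bound `2` for the new one.
  calc _ ≤ 200000 * C ^ 4 * n * (32 * (α + β) ^ 2) :=
        mul_le_mul hd' hPP (mul_nonneg na nb) hK
    _ = 3200000 * C ^ 4 / c ^ 4 * n * (2 * c ^ 4 * (α + β) ^ 2) := by field_simp; ring
    _ ≤ _ := by
        rw [hd]
        exact mul_le_mul_of_nonneg_left hPP' (by positivity)

/-- Infinitesimally, the distance is multiplied at most by a constant. -/
theorem spread_estimate {c C : ℝ} (hc : 0 < c) {μ p : Fin 3 → ℝ}
    (hμ : ∀ k, c ≤ μ k ∧ μ k ≤ C) (hp : ∀ k, c ≤ p k ∧ p k ≤ C) {a : Fin 3 → ℝ}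
    (ha : IsConePt a) : ∀ᶠ b in 𝓝 a, (∀ k, 0 ≤ b k) →
    discr (spread μ p a) (spread μ p b) * (pairing a a * pairing b b) ≤
      3200000 * C ^ 4 / c ^ 4 * discr a b *
        (pairing (spread μ p a) (spread μ p a) * pairing (spread μ p b) (spread μ p b)) := by
  -- Both points are normalized by their coordinates at an index where `a` is largest, so the other
  -- coordinates of `a` become at most one.
  obtain ⟨i, hi⟩ := Finite.exists_max a
  have hai : 0 < a i := by
    have := ha.add_pos 0
    by_contra! h
    linarith [hi (0 + 1), hi (0 + 2)]
  have hS : 0 < (a i)⁻¹ * a (i + 1) + (a i)⁻¹ * a (i + 2) := by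
    rw [← mul_add]
    exact mul_pos (inv_pos.2 hai) (ha.add_pos i)
  have hlim : ∀ k, ∀ᶠ b : Fin 3 → ℝ in 𝓝 a, |(b i)⁻¹ * b k - (a i)⁻¹ * a k| <
      ((a i)⁻¹ * a (i + 1) + (a i)⁻¹ * a (i + 2)) / 4 := fun k => by
    have hcont : ContinuousAt (fun b : Fin 3 → ℝ => |(b i)⁻¹ * b k - (a i)⁻¹ * a k|) a :=
      (((((continuous_apply i).continuousAt).inv₀ hai.ne').mul
        (continuous_apply k).continuousAt).sub continuousAt_const).abs
    exact hcont.eventually_lt continuousAt_const (by simpa using by linarith)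
  have hpos : ∀ᶠ b : Fin 3 → ℝ in 𝓝 a, 0 < b i :=
    continuousAt_const.eventually_lt (continuous_apply i).continuousAt hai
  filter_upwards [eventually_all.2 hlim, hpos] with b hb hbi hb0
  have key := spread_estimate_of_eq_one hc hμ hp (a := (a i)⁻¹ • a) (b := (b i)⁻¹ • b) (i := i)
    (inv_mul_cancel₀ hai.ne') (inv_mul_cancel₀ hbi.ne')
    (fun k => mul_nonneg (inv_nonneg.2 hai.le) (ha.nonneg k))
    (fun k => mul_nonneg (inv_nonneg.2 hbi.le) (hb0 k))
    (fun k => by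
      rw [Pi.smul_apply, smul_eq_mul, inv_mul_le_iff₀ hai, mul_one]
      exact hi k) hS (fun k => (hb k).le)
  simp only [spread_smul, discr_smul, pairing_smul] at key
  -- Both sides are homogeneous of degree six in `a` and in `b`.
  have hr : 0 < ((a i)⁻¹) ^ 6 * ((b i)⁻¹) ^ 6 := by positivity
  refine le_of_mul_le_mul_left ?_ hr
  calc _ = _ := by ring
    _ ≤ _ := key
    _ = _ := by ring

end

noncomputable section

/-! ## Comparison of ideal triangles -/

/-- Multiplication by these numbers turns the coordinates with respect to a triple into the
coordinates with respect to a triple of λ-lengths one. -/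
def unitScale (u : Fin 3 → Fin 3 → ℝ) (k : Fin 3) : ℝ :=
  √(gram u (k + 1) * gram u (k + 2) / gram u k)

/-- A map between two ideal triangles which is projective on the horocycles and which depends on an
edge only through its λ-lengths. -/
def shear (u u' : Fin 3 → Fin 3 → ℝ) (a : Fin 3 → ℝ) (i : Fin 3) : ℝ :=
  a i * (a i + gram u (i + 1) / gram u' (i + 1) * a (i + 2) +
    gram u (i + 2) / gram u' (i + 2) * a (i + 1))

theorem unitScale_bounds {u : Fin 3 → Fin 3 → ℝ} {ε K : ℝ} (hε : 0 < ε)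
    (hb : ∀ k, ε ≤ gram u k ∧ gram u k ≤ K) (k : Fin 3) : √(ε * ε / K) ≤ unitScale u k ∧ unitScale u k ≤ √(K * K / ε) := by
  have h := fun k => hε.trans_le (hb k).1
  have hK := (h 0).le.trans (hb 0).2
  exact ⟨Real.sqrt_le_sqrt (div_le_div₀ (mul_pos (h _) (h _)).le
      (mul_le_mul (hb _).1 (hb _).1 hε.le (h _).le) (h k) (hb k).2),
    Real.sqrt_le_sqrt (div_le_div₀ (mul_nonneg hK hK)
      (mul_le_mul (hb _).2 (hb _).2 (h _).le hK) hε (hb k).1)⟩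

namespace IsConeTriple

variable {u : Fin 3 → Fin 3 → ℝ} (hu : IsConeTriple u)
include hu

theorem unitScale_pos (k : Fin 3) : 0 < unitScale u k :=
  Real.sqrt_pos.2 (div_pos (mul_pos (hu.gram_pos _) (hu.gram_pos _)) (hu.gram_pos _))

theorem unitScale_mul (k : Fin 3) : unitScale u (k + 1) * unitScale u (k + 2) = gram u k := by
  have h0 := hu.gram_pos k
  have h1 := hu.gram_pos (k + 1)
  have h2 := hu.gram_pos (k + 2)
  rw [unitScale, unitScale, ← Real.sqrt_mul (by
    rw [fin3_add_one_one, fin3_add_one_two]; positivity), fin3_add_one_one, fin3_add_one_two,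
    fin3_add_two_one, fin3_add_two_two,
    show gram u (k + 2) * gram u k / gram u (k + 1) * (gram u k * gram u (k + 1) / gram u (k + 2)) =
      gram u k ^ 2 by field_simp, Real.sqrt_sq h0.le]

theorem neg_form_eq_pairing (a b : Fin 3 → ℝ) : -form (∑ k, a k • u k) (∑ k, b k • u k) =
    pairing (unitScale u * a) (unitScale u * b) := by
  rw [hu.form_sum_sum, pairing]
  refine Finset.sum_congr rfl fun k _ => ?_
  have h1 := hu.unitScale_mul (k + 1)
  have h2 := hu.unitScale_mul (k + 2)
  rw [fin3_add_one_one, fin3_add_one_two] at h1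
  rw [fin3_add_two_one, fin3_add_two_two] at h2
  rw [← h1, ← h2]
  simp only [Pi.mul_apply]
  ring

theorem pairing_self_pos {a : Fin 3 → ℝ} (ha : IsConePt a) :
    0 < pairing (unitScale u * a) (unitScale u * a) := by
  rw [← hu.neg_form_eq_pairing]
  linarith [hu.form_sum_neg ha]

theorem form_pt_sq {a b : Fin 3 → ℝ} (ha : IsConePt a) (hb : IsConePt b) :
    form (hu.pt a ha).1 (hu.pt b hb).1 ^ 2 = pairing (unitScale u * a) (unitScale u * b) ^ 2 /
      (pairing (unitScale u * a) (unitScale u * a) *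
        pairing (unitScale u * b) (unitScale u * b)) := by
  have h1 := hu.pairing_self_pos ha
  have h2 := hu.pairing_self_pos hb
  change form (normalize _) (normalize _) ^ 2 = _
  rw [normalize, normalize, form_smul_left, form_smul_right, hu.neg_form_eq_pairing,
    hu.neg_form_eq_pairing, mul_pow, mul_pow, inv_pow, inv_pow, Real.sq_sqrt h1.le,
    Real.sq_sqrt h2.le, ← neg_sq (form _ _), hu.neg_form_eq_pairing]
  field_simp

theorem form_pt_sq_sub_one {a b : Fin 3 → ℝ} (ha : IsConePt a) (hb : IsConePt b) :
    form (hu.pt a ha).1 (hu.pt b hb).1 ^ 2 - 1 = discr (unitScale u * a) (unitScale u * b) /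
      (pairing (unitScale u * a) (unitScale u * a) *
        pairing (unitScale u * b) (unitScale u * b)) := by
  have h1 := hu.pairing_self_pos ha
  have h2 := hu.pairing_self_pos hb
  rw [hu.form_pt_sq, discr, sub_div, div_self (mul_pos h1 h2).ne']

theorem pt_smul {a : Fin 3 → ℝ} (ha : IsConePt a) {c : ℝ} (hc : 0 < c) :
    hu.pt (c • a) (ha.smul hc) = hu.pt a ha := by
  obtain ⟨c', hc', h⟩ := hu.exists_coord_pt a ha
  refine hu.pt_eq_of_smul _ (c := c' / c) (by positivity) ?_
  rw [h, smul_smul, div_mul_cancel₀ _ hc.ne']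

/-- Points with comparable coordinates have bounded distance. -/
theorem hdist_pt_le {a b : Fin 3 → ℝ} (ha : IsConePt a) (hb : IsConePt b) {m M : ℝ} (hm : 0 < m)
    (h : ∀ k, m * a k ≤ b k ∧ b k ≤ M * a k) (hmM : m ≤ M) :
    hdist (hu.pt a ha) (hu.pt b hb) ≤ Real.arcosh (M / m) := by
  have hM : 1 ≤ M / m := (one_le_div hm).2 hmM
  refine hdist_le_of_cosh (Real.arcosh_nonneg hM) ?_
  rw [Real.cosh_arcosh hM]
  have h1 := hu.pairing_self_pos ha
  have h2 := hu.pairing_self_pos hb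
  have hs := fun k => (hu.unitScale_pos k).le
  have hsa := fun k => mul_nonneg (hs k) (ha.nonneg k)
  have hsb := fun k => mul_nonneg (hs k) (hb.nonneg k)
  have hlow : ∀ k, m * (unitScale u k * a k) ≤ unitScale u k * b k := fun k =>
    (mul_le_mul_of_nonneg_left (h k).1 (hs k)).trans_eq' (by ring)
  have hup : ∀ k, unitScale u k * b k ≤ M * (unitScale u k * a k) := fun k =>
    (mul_le_mul_of_nonneg_left (h k).2 (hs k)).trans_eq (by ring)
  have e1 : pairing (unitScale u * a) (unitScale u * b) ≤
      M * pairing (unitScale u * a) (unitScale u * a) := by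
    rw [pairing, pairing, Finset.mul_sum]
    refine Finset.sum_le_sum fun k _ => ?_
    rw [← mul_assoc]
    exact mul_le_mul_of_nonneg_right (hup k) (add_nonneg (hsa _) (hsa _))
  have e2 : m ^ 2 * pairing (unitScale u * a) (unitScale u * a) ≤
      pairing (unitScale u * b) (unitScale u * b) := by
    rw [pairing, pairing, Finset.mul_sum]
    refine Finset.sum_le_sum fun k _ => ?_
    calc _ = (m * (unitScale u k * a k)) * (m * (unitScale u (k + 1) * a (k + 1)) +
          m * (unitScale u (k + 2) * a (k + 2))) := by simp only [Pi.mul_apply]; ring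
      _ ≤ _ := mul_le_mul (hlow k) (add_le_add (hlow _) (hlow _))
        (add_nonneg (mul_nonneg hm.le (hsa _)) (mul_nonneg hm.le (hsa _))) (hsb k)
  have e0 : 0 ≤ pairing (unitScale u * a) (unitScale u * b) :=
    Finset.sum_nonneg fun k _ => mul_nonneg (hsb k) (add_nonneg (hsa _) (hsa _))
  refine abs_le_of_sq_le_sq' ?_ (by linarith) |>.2
  rw [neg_sq, hu.form_pt_sq, div_pow, div_le_div_iff₀ (mul_pos h1 h2) (by positivity)]
  calc _ ≤ (M * pairing (unitScale u * a) (unitScale u * a)) ^ 2 * m ^ 2 := by gcongr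
    _ = M ^ 2 * (pairing (unitScale u * a) (unitScale u * a) *
        (m ^ 2 * pairing (unitScale u * a) (unitScale u * a))) := by ring
    _ ≤ _ := by gcongr

variable {u' : Fin 3 → Fin 3 → ℝ} (hu' : IsConeTriple u')
include hu'

theorem shear_isConePt {a : Fin 3 → ℝ} (ha : IsConePt a) : IsConePt (shear u u' a) := by
  have hγ : ∀ k, 0 < gram u k / gram u' k := fun k => div_pos (hu.gram_pos k) (hu'.gram_pos k)
  have h0 : ∀ k, a k ^ 2 ≤ shear u u' a k := fun k => by
    have := mul_nonneg (ha.nonneg k) (add_nonneg (mul_nonneg (hγ (k + 1)).le (ha.nonneg (k + 2)))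
      (mul_nonneg (hγ (k + 2)).le (ha.nonneg (k + 1))))
    rw [shear]
    linarith
  refine ⟨fun k => (sq_nonneg _).trans (h0 k), fun k => ?_⟩
  refine lt_of_lt_of_le ?_ (add_le_add (h0 (k + 1)) (h0 (k + 2)))
  have := ha.add_pos k
  have h1 := ha.nonneg (k + 1)
  have h2 := ha.nonneg (k + 2)
  nlinarith [mul_nonneg h1 h2, mul_pos this this]

/-- In unit coordinates the coefficient of the coordinate `i` is the same in the factors of both
other coordinates. Hence near the vertex `i` those two coordinates are multiplied by nearly the same
number, as required for `spread_estimate`. -/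
theorem unitScale_mul_shear (a : Fin 3 → ℝ) : unitScale u' * shear u u' a =
    spread (fun k => unitScale u' k / unitScale u k ^ 2) (fun k => (unitScale u' k)⁻¹)
      (unitScale u * a) := by
  funext i
  have h1 := hu.unitScale_mul (i + 1)
  have h2 := hu.unitScale_mul (i + 2)
  have h1' := hu'.unitScale_mul (i + 1)
  have h2' := hu'.unitScale_mul (i + 2)
  rw [fin3_add_one_one, fin3_add_one_two] at h1 h1'
  rw [fin3_add_two_one, fin3_add_two_two] at h2 h2'
  have p0 := hu.unitScale_pos i
  have q0 := hu'.unitScale_pos i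
  have q1 := hu'.unitScale_pos (i + 1)
  have q2 := hu'.unitScale_pos (i + 2)
  simp only [Pi.mul_apply, shear, spread]
  rw [← h1, ← h2, ← h1', ← h2']
  field_simp
  ring

/-- Comparison of the linear map and the shear map between two ideal triangles. -/
theorem hdist_shear_le {ε K : ℝ} (hε : 0 < ε) (hb : ∀ k, ε ≤ gram u k ∧ gram u k ≤ K)
    (hb' : ∀ k, ε ≤ gram u' k ∧ gram u' k ≤ K) {a : Fin 3 → ℝ} (ha : IsConePt a) :
    hdist (hu'.pt a ha) (hu'.pt (shear u u' a) (hu.shear_isConePt hu' ha)) ≤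
      Real.arcosh (K / ε / (ε / K)) := by
  have hεK : ε ≤ K := (hb 0).1.trans (hb 0).2
  have hK : 0 < K := hε.trans_le hεK
  have hγ : ∀ k, ε / K ≤ gram u k / gram u' k ∧ gram u k / gram u' k ≤ K / ε := fun k => by
    have h1 := hε.trans_le (hb' k).1
    exact ⟨div_le_div₀ (hu.gram_pos k).le (hb k).1 h1 (hb' k).2,
      div_le_div₀ hK.le (hb k).2 hε (hb' k).1⟩
  have hm1 : ε / K ≤ 1 := (div_le_one hK).2 hεK
  have hM1 : 1 ≤ K / ε := (one_le_div hε).2 hεK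
  have hσ := ha.sum_pos
  -- Both points are written with the common factor `a i`: the linear map has the sum of all
  -- coordinates beside it, the shear map a sum with weights in `[ε / K, K / ε]`.
  have key := hu'.hdist_pt_le (ha.smul hσ) (hu.shear_isConePt hu' ha) (m := ε / K) (M := K / ε)
    (by positivity) (fun i => ?_) (hm1.trans hM1)
  · rwa [hu'.pt_smul ha hσ] at key
  · have hsum : ((∑ k, a k) • a) i = a i * (a i + a (i + 1) + a (i + 2)) := by
      rw [sum_fin3 _ i, Pi.smul_apply, smul_eq_mul]
      ring
    have n0 := ha.nonneg i
    have n1 := ha.nonneg (i + 1)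
    have n2 := ha.nonneg (i + 2)
    rw [hsum, shear]
    constructor
    · rw [mul_left_comm]
      refine mul_le_mul_of_nonneg_left ?_ n0
      linarith [mul_le_mul_of_nonneg_right hm1 n0, mul_le_mul_of_nonneg_right (hγ (i + 1)).1 n2,
        mul_le_mul_of_nonneg_right (hγ (i + 2)).1 n1]
    · rw [mul_left_comm (K / ε)]
      refine mul_le_mul_of_nonneg_left ?_ n0
      linarith [mul_le_mul_of_nonneg_right hM1 n0, mul_le_mul_of_nonneg_right (hγ (i + 1)).2 n2,
        mul_le_mul_of_nonneg_right (hγ (i + 2)).2 n1]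

/-- The shear map between two ideal triangles is locally Lipschitz. -/
theorem eventually_hdist_shear_le {c C : ℝ} (hc : 0 < c)
    (hs : ∀ k, c ≤ unitScale u k ∧ unitScale u k ≤ C)
    (hs' : ∀ k, c ≤ unitScale u' k ∧ unitScale u' k ≤ C) {n : ℕ}
    (hn : 3200000 * max (C / c ^ 2) c⁻¹ ^ 4 / min (c / C ^ 2) C⁻¹ ^ 4 ≤ (n : ℝ) ^ 2)
    {x : HypPlane} (hx : ∀ k, 0 ≤ coord u x.1 k) :
    ∀ᶠ y : HypPlane in 𝓝 x, ∀ hy : ∀ k, 0 ≤ coord u y.1 k,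
      hdist (hu'.pt _ (hu.shear_isConePt hu' (hu.coord_isConePt hx)))
        (hu'.pt _ (hu.shear_isConePt hu' (hu.coord_isConePt hy))) ≤ n * hdist x y := by
  have hC : 0 < C := hc.trans_le ((hs 0).1.trans (hs 0).2)
  have hcont : ContinuousAt (fun y : HypPlane => unitScale u * coord u y.1) x :=
    Continuous.continuousAt (continuous_const.mul (continuous_pi fun k =>
      (continuous_coord u k).comp continuous_subtype_val))
  have hsx : IsConePt (unitScale u * coord u x.1) := by
    have h := hu.coord_isConePt hx
    refine ⟨fun k => mul_nonneg (hu.unitScale_pos k).le (h.nonneg k), fun k => ?_⟩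
    have := mul_pos hc (h.add_pos k)
    have := mul_le_mul_of_nonneg_right (hs (k + 1)).1 (h.nonneg (k + 1))
    have := mul_le_mul_of_nonneg_right (hs (k + 2)).1 (h.nonneg (k + 2))
    simp only [Pi.mul_apply]
    linarith
  have hest := spread_estimate (c := min (c / C ^ 2) C⁻¹) (C := max (C / c ^ 2) c⁻¹)
    (by positivity) (μ := fun k => unitScale u' k / unitScale u k ^ 2)
    (p := fun k => (unitScale u' k)⁻¹) (fun k => by
      have h1 := hs k
      have h2 := hs' k
      have h0 := hu.unitScale_pos k
      exact ⟨(min_le_left _ _).trans (div_le_div₀ (hc.le.trans h2.1) h2.1 (by positivity)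
        (pow_le_pow_left₀ h0.le h1.2 2)), (div_le_div₀ hC.le h2.2 (by positivity)
        (pow_le_pow_left₀ hc.le h1.1 2)).trans (le_max_left _ _)⟩) (fun k =>
      ⟨(min_le_right _ _).trans (inv_anti₀ (hu'.unitScale_pos k) (hs' k).2),
        (inv_anti₀ hc (hs' k).1).trans (le_max_right _ _)⟩) hsx
  filter_upwards [hcont.eventually hest] with y hest hy
  have ha := hu.coord_isConePt hx
  have hb := hu.coord_isConePt hy
  have hest := hest fun k => mul_nonneg (hu.unitScale_pos k).le (hy k)
  rw [← hu.unitScale_mul_shear hu', ← hu.unitScale_mul_shear hu'] at hest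
  refine hdist_le_mul n ?_
  rw [hu'.form_pt_sq_sub_one]
  have hform := hu.form_pt_sq_sub_one ha hb
  have h1 := hu.pairing_self_pos ha
  have h2 := hu.pairing_self_pos hb
  have h1' := hu'.pairing_self_pos (hu.shear_isConePt hu' ha)
  have h2' := hu'.pairing_self_pos (hu.shear_isConePt hu' hb)
  rw [hu.pt_coord hx, hu.pt_coord hy] at hform
  have hd : 0 ≤ form x.1 y.1 ^ 2 - 1 := by
    have := one_le_neg_form x y
    nlinarith
  refine le_trans ?_ (mul_le_mul_of_nonneg_right hn hd)
  rw [hform, ← mul_div_assoc, div_le_div_iff₀ (mul_pos h1' h2') (mul_pos h1 h2)]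
  exact hest

end IsConeTriple

end

noncomputable section

/-! ## Automorphisms of the triangulation of the hyperbolic plane -/

/-- On the common edge both triangles expand the point in the same two vectors. -/
theorem Glued.coord_one {T : Type*} {Δ : IdealTriangulation T} {a b : Node T} {i j : Fin 3}
    (h : Glued Δ a i b j) (ha : IsConeTriple a.vert) (hb : IsConeTriple b.vert) {x : Fin 3 → ℝ}
    (hx : coord a.vert x i = 0) : coord b.vert x (j + 1) = coord a.vert x (i + 2) := by
  have hj := (h.coord_eq_zero_iff ha hb x).2 hx
  have e1 := ha.form_eq x (i + 1)
  have e2 := hb.form_eq x (j + 2)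
  rw [fin3_add_one_one, fin3_add_one_two, hx, mul_zero, add_zero] at e1
  rw [fin3_add_two_one, fin3_add_two_two, hj, mul_zero, zero_add, h.vert_two, h.gram_eq, e1] at e2
  exact (mul_left_cancel₀ (ha.gram_pos i).ne' e2).symm

theorem Glued.coord_two {T : Type*} {Δ : IdealTriangulation T} {a b : Node T} {i j : Fin 3}
    (h : Glued Δ a i b j) (ha : IsConeTriple a.vert) (hb : IsConeTriple b.vert) {x : Fin 3 → ℝ}
    (hx : coord a.vert x i = 0) : coord b.vert x (j + 2) = coord a.vert x (i + 1) :=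
  (h.symm.coord_one hb ha ((h.coord_eq_zero_iff ha hb x).2 hx)).symm

namespace DevData

variable {T : Type*} {Δ : IdealTriangulation T} {R : DevData Δ} (φ : R.Tri → R.Tri)

/-- The shear map from a triangle to its image. -/
def shearPt (n : R.Tri) (x : HypPlane) (hx : x ∈ n.carrier) : HypPlane :=
  (φ n).triple.pt _ (n.triple.shear_isConePt (φ n).triple (n.triple.coord_isConePt hx))

variable {φ} (hφ : ∀ n i, Glued Δ (φ n).nd i (φ (nbr (n, i)).1).nd (nbr (n, i)).2)
include hφ

/-- On the edge `i` the shear map involves only the ratio of the products of this edge and of its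
image, and both products are shared by the adjacent triangles. -/
theorem shearPt_eq {n m : R.Tri} {x : HypPlane} (hn : x ∈ n.carrier) (hm : x ∈ m.carrier) :
    shearPt φ n x hn = shearPt φ m x hm := by
  rcases carrier_overlap hn hm with rfl | ⟨i, rfl, hi⟩
  · rfl
  · have hg := (nbr_spec n i).1
    have hg' := hφ n i
    have hj := (hg.coord_eq_zero_iff n.triple (Tri.triple _) x.1).2 hi
    have h1 := hg.coord_one n.triple (Tri.triple _) hi
    have h2 := hg.coord_two n.triple (Tri.triple _) hi
    have e := hg.gram_eq
    have e' := hg'.gram_eq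
    apply Subtype.ext
    change normalize _ = normalize _
    change _ = normalize (∑ k, shear (nbr (n, i)).1.nd.vert (φ (nbr (n, i)).1).nd.vert
      (coord (nbr (n, i)).1.nd.vert x.1) k • (φ (nbr (n, i)).1).nd.vert k)
    generalize (nbr (n, i)).2 = j at *
    generalize (nbr (n, i)).1 = m at *
    rw [sum_fin3 _ i, sum_fin3 _ j]
    simp only [shear, fin3_add_one_one, fin3_add_one_two, fin3_add_two_one, fin3_add_two_two,
      hi, hj, h1, h2, e, e', hg'.vert_one, hg'.vert_two]
    congr 1
    simp only [zero_mul, zero_smul, mul_zero, add_zero, zero_add]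
    exact add_comm _ _

/-- An automorphism of the triangulation has bounded distance from a Lipschitz map. -/
theorem exists_hdist_map_le [Finite T] : ∃ K C : ℝ, 0 ≤ K ∧ 0 ≤ C ∧ ∀ f : HypPlane → HypPlane,
    (∀ n a, f (triHomeo n.triple a).1 = (triHomeo (φ n).triple a).1) →
    ∀ x y, hdist (f x) (f y) ≤ K * hdist x y + C := by
  obtain ⟨ε, K, hε, hK, hb⟩ := R.exists_weight_bounds
  have hbn : ∀ n : R.Tri, ∀ k, ε ≤ gram n.nd.vert k ∧ gram n.nd.vert k ≤ K := fun n => hb n.1 n.2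
  have hεK : ε ≤ K := (hbn Tri.root 0).1.trans (hbn Tri.root 0).2
  have hs := fun n : R.Tri => unitScale_bounds hε (hbn n)
  have hc : 0 < √(ε * ε / K) := Real.sqrt_pos.2 (by positivity)
  generalize √(ε * ε / K) = c at hs hc
  generalize √(K * K / ε) = C at hs
  obtain ⟨N, hN1, hN⟩ : ∃ N : ℕ, 1 ≤ N ∧
      3200000 * max (C / c ^ 2) c⁻¹ ^ 4 / min (c / C ^ 2) C⁻¹ ^ 4 ≤ (N : ℝ) ^ 2 := by
    obtain ⟨N, hN⟩ := exists_nat_ge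
      (3200000 * max (C / c ^ 2) c⁻¹ ^ 4 / min (c / C ^ 2) C⁻¹ ^ 4)
    refine ⟨N + 1, by omega, hN.trans ?_⟩
    push_cast
    nlinarith [(Nat.cast_nonneg N : (0 : ℝ) ≤ N)]
  have hex := fun x : HypPlane => exists_mem_carrier (R := R) x
  choose t ht using hex
  have hF : ∀ x (n : R.Tri) (hn : x ∈ n.carrier), shearPt φ (t x) x (ht x) = shearPt φ n x hn :=
    fun x n hn => shearPt_eq hφ (ht x) hn
  have hlip := hdist_le_of_local (f := fun x => shearPt φ (t x) x (ht x)) (K := N) fun x => by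
    have hloc : ∀ n : R.Tri, x ∈ n.carrier → ∀ᶠ y in 𝓝 x, y ∈ n.carrier →
        hdist (shearPt φ (t x) x (ht x)) (shearPt φ (t y) y (ht y)) ≤ N * hdist x y := by
      intro n hn
      filter_upwards [n.triple.eventually_hdist_shear_le (φ n).triple hc (hs n) (hs (φ n)) hN hn]
        with y h hy
      rw [hF x n hn, hF y n hy]
      exact h hy
    obtain ⟨n, hn⟩ := exists_mem_carrier (R := R) x
    obtain ⟨i, hi⟩ := exists_nhds_subset_carrier hn
    -- The estimate in the neighbor compares with `x` itself, so it is available only if `x` lies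
    -- there; otherwise the neighbor is not needed near `x`.
    by_cases hx : x ∈ ((triang R).opp (n, i)).1.carrier
    · filter_upwards [hi, hloc n hn, hloc _ hx] with y hy h1 h2
      exact hy.elim h1 fun h => h2 h.1
    · filter_upwards [hi, hloc n hn] with y hy h1
      exact hy.elim h1 fun h => absurd h.2 hx
  have hC0 : 0 ≤ Real.arcosh (K / ε / (ε / K)) := Real.arcosh_nonneg <|
    (one_le_div (by positivity)).2 (((div_le_one hK).2 hεK).trans ((one_le_div hε).2 hεK))
  refine ⟨N, 2 * Real.arcosh (K / ε / (ε / K)), by positivity, by positivity,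
    fun f hf x y => ?_⟩
  -- On each triangle `f` is the map that keeps homogeneous coordinates, so `hdist_shear_le` bounds
  -- its distance from the shear map.
  have hnear : ∀ x, hdist (f x) (shearPt φ (t x) x (ht x)) ≤ Real.arcosh (K / ε / (ε / K)) := by
    intro x
    obtain ⟨a, ha⟩ := (triHomeo (t x).triple).surjective
      ⟨x, ((t x).triple.mem_idealTriangle_iff x).2 (ht x)⟩
    have hx : (triHomeo (t x).triple a).1 = x := congrArg Subtype.val ha
    obtain ⟨r, hr, hra⟩ := coord_triHomeo (t x).triple a
    rw [hx] at hra
    have hfx : f x = (φ (t x)).triple.pt _ ((t x).triple.coord_isConePt (ht x)) := by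
      have h := hf (t x) a
      rw [hx] at h
      rw [h]
      symm
      change (φ (t x)).triple.pt (coord (t x).nd.vert x.1) _ = (φ (t x)).triple.pt a.1 a.2.1
      rw [← (φ (t x)).triple.pt_smul a.2.1 hr]
      congr 1
    rw [hfx]
    exact (t x).triple.hdist_shear_le (φ (t x)).triple hε (hbn _) (hbn _) _
  have h1 := hdist_triangle (f x) (shearPt φ (t x) x (ht x)) (f y)
  have h2 := hdist_triangle (shearPt φ (t x) x (ht x)) (shearPt φ (t y) y (ht y)) (f y)
  have h3 := hlip x y
  have h4 := hnear x
  have h5 := hnear y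
  rw [hdist_comm (f y)] at h5
  linarith

end DevData

/-! ## Covering transformations -/

open DevData

variable {T : Type*} {Δ : IdealTriangulation T} {F : Type*} [TopologicalSpace F]
  {H : BrokenHyperbolicStructure Δ F} {E : Type*} [TopologicalSpace E] {p : E → F}

/-- The image of a lifted face under a covering transformation. -/
def LiftedFace.map (g : E ≃ₜ E) (hg : ∀ x, p (g x) = p x) (L : LiftedFace H p) :
    LiftedFace H p where
  face := L.face
  lift w := g (L.lift w)
  continuous_lift := g.continuous.comp L.continuous_lift
  proj_lift w := by rw [hg, L.proj_lift]

section

variable [Finite T] {R : DevData Δ} (hp : IsCoveringMap p) {q : HypPlane → F}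
  (hq : ∀ (n : R.Tri) w, q (triMap H.toHomotheticGluing n w).1 = H.chart n.nd.face w)
  {D : E ≃ₜ HypPlane} (hD : ∀ x, q (D x) = p x) {g : E ≃ₜ E} (hg : ∀ x, p (g x) = p x)
include hp hq hD hg

/-- A covering transformation permutes the lifted faces over each face. The parametrization of a
developed triangle depends on the face only up to the final choice of vertices, so homogeneous
coordinates are preserved. -/
theorem exists_map_triangles : ∃ φ : R.Tri → R.Tri,
    (∀ n i, Glued Δ (φ n).nd i (φ (nbr (n, i)).1).nd (nbr (n, i)).2) ∧
    ∀ n a, D (g (D.symm (triHomeo n.triple a).1)) = (triHomeo (φ n).triple a).1 := by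
  choose φ hφ using fun n : R.Tri =>
    liftedFace_surjective hp hq hD ((liftedFace hq hD n).map g hg)
  have hface : ∀ n, (φ n).nd.face = n.nd.face := fun n => congrArg LiftedFace.face (hφ n)
  refine ⟨φ, fun n i => ?_, fun n a => ?_⟩
  · have hadj : AdjacentAcross (liftedFace hq hD (φ n)) i (liftedFace hq hD (φ (nbr (n, i)).1)) := by
      rw [hφ, hφ]
      have h := adjacentAcross_nbr hq hD n i
      exact ⟨h.1, fun x => congrArg g (h.2 x)⟩
    have h1 := liftedFace_injective hq hD (eq_nbr_of_adjacentAcross hp hq hD hadj)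
    have h2 := (nbr_spec (φ n) i).1
    have h3 : (nbr (φ n, i)).2 = (nbr (n, i)).2 := by
      have e1 := congrArg Prod.snd h2.opp
      have e2 := congrArg Prod.snd (nbr_spec n i).1.opp
      rw [hface] at e1
      exact e1.symm.trans e2
    rwa [← h1, h3] at h2
  · obtain ⟨w, rfl⟩ : ∃ w, simplexPt H.toHomotheticGluing n.nd.face w = a :=
      (stdHomeo.symm.trans (coneHomeo _ _ fun _ => slope_pos _ _)).surjective a
    have h := congrArg (fun L => D (LiftedFace.lift L w)) (hφ n)
    rw [liftedFace_lift] at h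
    rw [← triMap_apply]
    refine h.symm.trans ?_
    rw [triMap_apply, hface]

theorem exists_hdist_deck_le : ∃ K C : ℝ, 0 ≤ K ∧ 0 ≤ C ∧
    ∀ x y, hdist (D (g x)) (D (g y)) ≤ K * hdist (D x) (D y) + C := by
  obtain ⟨φ, hφ, hf⟩ := exists_map_triangles hp hq hD hg
  obtain ⟨K, C, hK, hC, h⟩ := exists_hdist_map_le hφ
  refine ⟨K, C, hK, hC, fun x y => ?_⟩
  have := h (fun z => D (g (D.symm z))) hf (D x) (D y)
  simpa only [D.symm_apply_apply] using this

theorem isQuasiIsometry_deck : IsQuasiIsometry (fun x y => hdist (D x) (D y)) g := by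
  obtain ⟨K, C, hK, hC, h⟩ := exists_hdist_deck_le hp hq hD hg
  obtain ⟨K', C', hK', hC', h'⟩ := exists_hdist_deck_le (g := g.symm) hp hq hD fun x => by
    rw [← hg, g.apply_symm_apply]
  have hM : 1 ≤ K + K' + 1 := by linarith
  -- The lower bound is the upper bound for the inverse transformation, and surjectivity of `g` is
  -- exact. Adding one makes the constant at least one.
  refine ⟨K + K' + 1, C + C', hM, by positivity, fun x y => ⟨?_, ?_⟩, fun y => ⟨g.symm y, ?_⟩⟩
  · have h1 := h' (g x) (g y)
    rw [g.symm_apply_apply, g.symm_apply_apply] at h1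
    have hd := hdist_nonneg (D (g x)) (D (g y))
    have hCC : C' ≤ (C + C') * (K + K' + 1) := by nlinarith
    dsimp only
    rw [sub_le_iff_le_add, div_le_iff₀ (by linarith)]
    nlinarith
  · have h1 := h x y
    have hd := hdist_nonneg (D x) (D y)
    dsimp only
    nlinarith
  · dsimp only
    rw [g.apply_symm_apply, hdist_self]
    positivity

end

end

end BrokenHyperbolic

/-! ### The theorem. -/

open BrokenHyperbolic in
theorem theoremB11 {T : Type*} [Finite T] (Δ : IdealTriangulation T)
    {F : Type*} [TopologicalSpace F] (H : BrokenHyperbolicStructure Δ F)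
    {E : Type*} [TopologicalSpace E] [SimplyConnectedSpace E] (p : E → F) (hp : IsCoveringMap p) :
    -- the construction can be carried out: there is a decoration, and there is an initial face
    Nonempty (Decoration H) ∧
    (∀ d : Decoration H, ∀ t : T, ∃ (L₀ : LiftedFace H p) (u₀ : Fin 3 → Fin 3 → ℝ),
      L₀.face = t ∧ IsBaseLift d L₀ u₀) ∧
    -- for all choices
    ∀ (d : Decoration H) (L₀ : LiftedFace H p) (u₀ : Fin 3 → Fin 3 → ℝ), IsBaseLift d L₀ u₀ →
      ∀ e : ℤ, e = 1 ∨ e = -1 →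
        -- every face of the universal cover is developed, in one way only
        (∀ L : LiftedFace H p, ∃! u, ∃ o c, Developed d e L₀ u₀ L o c u) ∧
        -- the developing image is the entire hyperbolic plane
        developingImage d e L₀ u₀ = Set.univ ∧
        -- there is a developing homeomorphism of the universal cover onto the hyperbolic plane
        ∃ D : E ≃ₜ HypPlane,
          (∀ L o c u, Developed d e L₀ u₀ L o c u →
            D '' Set.range L.lift = idealTriangle u ∧
            ∀ i, D '' Set.range (fun x => L.lift (edgePoint i x)) = idealEdge u i) ∧
          -- for its hyperbolic metric the covering transformations are quasi-isometries
          ∀ g : E ≃ₜ E, (∀ x, p (g x) = p x) →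
            IsQuasiIsometry (fun x y => hdist (D x) (D y)) g := by
  refine ⟨H.nonempty_decoration, fun d t => ?_, fun d L₀ u₀ hb e _ => ?_⟩
  · obtain ⟨L₀, h⟩ := exists_liftedFace (H := H) hp t
    obtain ⟨u₀, h₀⟩ := exists_isBaseLift d L₀
    exact ⟨L₀, u₀, h, h₀⟩
  · obtain ⟨ρ, hρ, hρ'⟩ := H.exists_sectorScale e
    obtain ⟨q, hq, hqc, hqs⟩ :=
      DevData.exists_hyp_covering (devData d hρ hb) H.toHomotheticGluing
    -- The base points match the center of `L₀` with the center of the root triangle, so that the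
    -- two correspond under `D`; a center is used because it determines its lifted face.
    obtain ⟨D, hD, hD₀⟩ := exists_homeomorph_of_coverings hp hqc hqs
      (e₀ := L₀.lift stdCenter)
      (x₀ := (DevData.triMap H.toHomotheticGluing (DevData.Tri.root : (devData d hρ hb).Tri)
        stdCenter).1) ((L₀.proj_lift _).trans (hq DevData.Tri.root _).symm)
    have h₀ : DevData.liftedFace hq hD DevData.Tri.root = L₀ :=
      LiftedFace.eq_of_lift_eq hp rfl stdCenter
        (D.injective ((DevData.liftedFace_lift hq hD _ _).trans hD₀.symm))
    exact ⟨fun L => existsUnique_developed hp hρ hb hρ' hq hD h₀ L,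
      developingImage_eq_univ hρ hb hρ' hq hD h₀, D,
      fun L o c u h => image_of_developed hp hρ hb hρ' hq hD h₀ h,
      fun g hg => isQuasiIsometry_deck hp hq hD hg⟩
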